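/- **Setting.** Let $\tau>0$, $N\ge 1$, let $\sigma_1,\dots,\sigma_N$ be real numbers (the eigenvalues of $\Sigma=TT^\dagger$, listed with multiplicity) and $z\in\mathbb C$ such that $$\tau\le\sigma_i\le\tau^{-1},\qquad \frac1N\sum_{i=1}^N\sigma_i=1,\qquad \tau\le\big||z|^2-1\big|\le\tau^{-1}.$$ Let $m_{1c}:\mathbb C_+\to\mathbb C_+$ be the analytic function with $w\,m_{1c}(w)\in\mathbb C_+$ such that, for all $w\in\mathbb C_+$, $$m_{1c}=\frac1N\sum_{i=1}^N\sigma_i\Big[-w(1+\sigma_i m_{2c})+\frac{|z|^2}{1+m_{1c}}\Big]^{-1},\qquad \frac1{m_{2c}}=-w(1+m_{1c})+\frac{|z|^2}{1+m_{1c}}.$$ For real $x$ put $\rho_{1,2c}(x)=\frac1\pi\lim_{\eta\downarrow0}\operatorname{Im}m_{1,2c}(x+i\eta)$ (with value $0$ where there is no finite limit, which can happen only at $x=0$), $m_{1c}(x)=\lim_{\eta\downarrow 0}m_{1c}(x+i\eta)$ and, for $x>0$, $m_c(x)=\sqrt x\,(1+m_{1c}(x))$. Let $$p_i(q,m)=q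 m^3-(\sigma_i+|z|^2)m^2-q|z|^2m+|z|^4,\qquad f(q,m)=-q+m+\frac1N\sum_{i=1}^N\sigma_i\frac{m(m^2-|z|^2)}{p_i(q,m)} .$$ *Edges.* When the support of $\rho_{1c}$ is written as $\bigcup_{1\le k\le L}[e_{2k},e_{2k-1}]$ with $1\le L<\infty$ and $e_1>e_2>\dots>e_{2L}\ge0$, the $e_j$ are called the edges and the $[e_{2k},e_{2k-1}]$ the bulk components. For $\epsilon>0$, an edge $e_j\neq0$ is *$\epsilon$-regular* if $|m_c(e_j)-r|\ge\epsilon$ for every $i$ and every real root $r$ of $p_i(\sqrt{e_j},\cdot)$, and $|\partial_m^2f(\sqrt{e_j},m_c(e_j))|\ge\epsilon$. For a function $c:(0,\infty)\to(0,\infty)$, a bulk component $[e_{2k},e_{2k-1}]$ is *$c$-regular* if $\rho_{1c}\ge c(t)$ on $[e_{2k}+t,e_{2k-1}-t]$ for every $t>0$. Write $a\sim b$ (with constant $C>0$) for $C^{-1}b\le a\le Cb$. **Proposition (basic properties of $\rho_{1,2c}$).** The function $m_{1c}$ exists, and for every real $x\ne0$ the limits of $m_{1c}(x+i\eta)$ and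 $m_{2c}(x+i\eta)$ as $\eta\downarrow 0$ exist and are finite. Moreover: (i) There are $C_0,\epsilon_0>0$ depending only on $\tau$ such that $\rho_{1c}$ and $\rho_{2c}$ have the same support, of the form $\bigcup_{1\le k\le L}[e_{2k},e_{2k-1}]$ with $1\le L<\infty$ and $C_0\ge e_1>e_2>\dots>e_{2L}\ge0$. If $|z|^2\ge1+\tau$, then $e_{2L}\ge\epsilon_0$; if $|z|^2\le1-\tau$, then $e_{2L}=0$. (ii) If $[e_{2k},e_{2k-1}]$ is a $c$-regular bulk component and $\tau'>0$, then $\rho_{1c}(x)\sim1$ and $\rho_{2c}(x)\sim1$ for all $x\in[e_{2k}+\tau',e_{2k-1}-\tau']$, with a constant depending only on $\tau,\tau',c$. (iii) Let $e_j\ne0$ be an $\epsilon$-regular edge. There are $C,\delta>0$ depending only on $\tau,\epsilon$ such that, with constant $C$: if $j$ is even, $\rho_{1c}(x)\sim\sqrt{x-e_j}$ and $\rho_{2c}(x)\sim\sqrt{x-e_j}$ for $x\in(e_j,e_j+\delta)$; if $j$ is odd, $\rho_{1c}(x)\sim\sqrt{e_j-x}$ and $\rho_{2c}(x)\sim\sqrt{e_j-x}$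 for $x\in(e_j-\delta,e_j)$. (iv) There are $C,\delta>0$ depending only on $\tau$ such that, if $|z|^2\le1-\tau$, then $\rho_{1c}(x)\sim x^{-1/2}$ and $\rho_{2c}(x)\sim x^{-1/2}$ for $x\in(0,\delta)$, with constant $C$. (v) $\rho_{2c}$ is a probability density: it is nonnegative, integrable and $\int_{\mathbb R}\rho_{2c}(x)\,dx=1$. -/

import Mathlib

open Filter Topology MeasureTheory

noncomputable section

namespace SelfConsistent

/-- The standing assumptions with parameter `τ`: `σ` lists (with multiplicity) the eigenvalues of
the `N × N` matrix `Σ = T T†`; they lie in `[τ, τ⁻¹]` and have mean one, and `|z|` stays away from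
one and from infinity. -/
structure Admissible (τ : ℝ) {N : ℕ} (σ : Fin N → ℝ) (z : ℂ) : Prop where
  le_eig : ∀ i, τ ≤ σ i
  eig_le : ∀ i, σ i ≤ τ⁻¹
  mean_eq_one : (1 / (N : ℝ)) * ∑ i, σ i = 1
  le_dist : τ ≤ |‖z‖ ^ 2 - 1|
  dist_le : |‖z‖ ^ 2 - 1| ≤ τ⁻¹

/-- `m₂` as a function of `w` and `m₁`: `1 / m₂ = -w (1 + m₁) + |z|² / (1 + m₁)`. -/
def m2Of (z w m₁ : ℂ) : ℂ :=
  (-w * (1 + m₁) + (‖z‖ : ℂ) ^ 2 / (1 + m₁))⁻¹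

/-- Right-hand side of the self-consistent equation for `m₁` (after inserting `m₂`):
`N⁻¹ ∑ σᵢ [-w (1 + σᵢ m₂) + |z|² / (1 + m₁)]⁻¹`. -/
def selfRHS {N : ℕ} (σ : Fin N → ℝ) (z w m₁ : ℂ) : ℂ :=
  (1 / (N : ℂ)) * ∑ i, (σ i : ℂ) *
    (-w * (1 + (σ i : ℂ) * m2Of z w m₁) + (‖z‖ : ℂ) ^ 2 / (1 + m₁))⁻¹

/-- `m` is an analytic function from the upper half plane to itself which solves the
self-consistent equation and for which `w m(w)` lies in the upper half plane as well. -/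
structure IsM1c {N : ℕ} (σ : Fin N → ℝ) (z : ℂ) (m : ℂ → ℂ) : Prop where
  analytic : AnalyticOnNhd ℂ m {w | 0 < w.im}
  im_pos : ∀ w : ℂ, 0 < w.im → 0 < (m w).im
  im_mul_pos : ∀ w : ℂ, 0 < w.im → 0 < (w * m w).im
  eq : ∀ w : ℂ, 0 < w.im → m w = selfRHS σ z w (m w)

open Classical in
/-- The solution `m₁c` of the self-consistent equation (its values off the open upper half plane
play no role). -/
def m1c {N : ℕ} (σ : Fin N → ℝ) (z : ℂ) : ℂ → ℂ :=
  if h : ∃ m, IsM1c σ z m then h.choose else 0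

/-- The function `m₂c`. -/
def m2c {N : ℕ} (σ : Fin N → ℝ) (z : ℂ) (w : ℂ) : ℂ :=
  m2Of z w (m1c σ z w)

/-- `m` has a finite limit at the real point `x` along `x + iη`, `η ↓ 0`. -/
def HasBoundaryLimit (m : ℂ → ℂ) (x : ℝ) : Prop :=
  ∃ l : ℂ, Tendsto (fun η : ℝ => m (x + η * Complex.I)) (𝓝[>] 0) (𝓝 l)

/-- The boundary value `m(x) = lim_{η ↓ 0} m(x + iη)`. -/
def boundaryValue (m : ℂ → ℂ) (x : ℝ) : ℂ :=
  limUnder (𝓝[>] (0 : ℝ)) (fun η : ℝ => m (x + η * Complex.I))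

open Classical in
/-- The density `ρ(x) = π⁻¹ lim_{η ↓ 0} Im m(x + iη)`; at points where there is no finite limit the
density is given the value `0`. -/
def density (m : ℂ → ℂ) (x : ℝ) : ℝ :=
  if ∃ l : ℝ, Tendsto (fun η : ℝ => (m (x + η * Complex.I)).im) (𝓝[>] 0) (𝓝 l) then
    (1 / Real.pi) * limUnder (𝓝[>] (0 : ℝ)) (fun η : ℝ => (m (x + η * Complex.I)).im)
  else 0

/-- The density `ρ₁c`. -/
def rho1c {N : ℕ} (σ : Fin N → ℝ) (z : ℂ) : ℝ → ℝ := density (m1c σ z)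

/-- The density `ρ₂c`. -/
def rho2c {N : ℕ} (σ : Fin N → ℝ) (z : ℂ) : ℝ → ℝ := density (m2c σ z)

/-- `e 1 > e 2 > … > e (2 L) ≥ 0`, `L ≥ 1`, are the edges of `ρ`: the support of `ρ` is
the union of the intervals `[e (2 k), e (2 k - 1)]`, `1 ≤ k ≤ L`. -/
structure IsEdges (ρ : ℝ → ℝ) (L : ℕ) (e : ℕ → ℝ) : Prop where
  one_le : 1 ≤ L
  strictAnti : StrictAntiOn e (Set.Icc 1 (2 * L))
  nonneg : 0 ≤ e (2 * L)
  support_eq : tsupport ρ = ⋃ k ∈ Set.Icc 1 L, Set.Icc (e (2 * k)) (e (2 * k - 1))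

/-- The cubic `√w m³ - (s + |z|²) m² - √w |z|² m + |z|⁴` with `q = √w`. -/
def cubic (s : ℝ) (z q m : ℂ) : ℂ :=
  q * m ^ 3 - ((s : ℂ) + (‖z‖ : ℂ) ^ 2) * m ^ 2 - q * (‖z‖ : ℂ) ^ 2 * m + (‖z‖ : ℂ) ^ 4

/-- The function `f(√w, m)`, with `q = √w`. -/
def fFun {N : ℕ} (σ : Fin N → ℝ) (z q m : ℂ) : ℂ :=
  -q + m + (1 / (N : ℂ)) * ∑ i, (σ i : ℂ) * (m * (m ^ 2 - (‖z‖ : ℂ) ^ 2) / cubic (σ i) z q m)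

/-- The boundary value `m_c(x) = √x (1 + m₁c(x))` for `x > 0`. -/
def mc {N : ℕ} (σ : Fin N → ℝ) (z : ℂ) (x : ℝ) : ℂ :=
  (Real.sqrt x : ℂ) * (1 + boundaryValue (m1c σ z) x)

/-- Regularity of a nonzero edge `x`, with parameter `ε`: `m_c(x)` has distance at least `ε` from
the (real) roots of the cubics, and `|∂²f/∂m²| ≥ ε` at `(√x, m_c(x))`. -/
structure IsRegularEdge {N : ℕ} (σ : Fin N → ℝ) (z : ℂ) (ε x : ℝ) : Prop where
  root_dist : ∀ i, ∀ r : ℝ, cubic (σ i) z (Real.sqrt x : ℂ) (r : ℂ) = 0 → ε ≤ ‖mc σ z x - (r : ℂ)‖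
  second_deriv : ε ≤ ‖iteratedDeriv 2 (fun m : ℂ => fFun σ z (Real.sqrt x : ℂ) m) (mc σ z x)‖

/-- Regularity of a bulk component `[a, b]`, with lower bounds `c`: for every `t > 0`, the
density `ρ₁c` is at least `c t` on `[a + t, b - t]`. -/
def IsRegularBulk {N : ℕ} (σ : Fin N → ℝ) (z : ℂ) (c : ℝ → ℝ) (a b : ℝ) : Prop :=
  ∀ t : ℝ, 0 < t → ∀ x ∈ Set.Icc (a + t) (b - t), c t ≤ rho1c σ z x

/-- `a ∼ b` with constant `C`. -/
def SimWith (C a b : ℝ) : Prop := C⁻¹ * b ≤ a ∧ a ≤ C * b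

/-- `ρ` is a probability density on the real line. -/
structure IsProbDensity (ρ : ℝ → ℝ) : Prop where
  nonneg : ∀ x, 0 ≤ ρ x
  integrable : Integrable ρ
  integral_eq_one : ∫ x, ρ x = 1

end SelfConsistent

end

/-!
Throughout, `a = |z|²`, `b = 1 + m₁` and `c = a - w b²`, so that `m₂ = b / c`; the variable `m_c =
√w b` is the natural one for most estimates.

*Existence.* In the variable `√w (1 + m₁)` the self-consistent map is composed of averages,
positive multiples, `x ↦ -1 / x` and translation by `√w`. None of these increases the hyperbolic
distance of the upper half plane, and the translation decreases it by a definite factor on bounded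
sets. The iterates therefore converge locally uniformly (`exists_isM1c`).

*Boundary values.* The equation together with two inequalities, obtained by comparing imaginary
parts, is the predicate `IsSol`. It is stable under limits away from `w = 0` (`IsSol.of_tendsto`);
hence whatever follows from it holds on the real axis as well. Limits exist there because `m₁c` is
bounded and algebraic: near a real point it has only finitely many possible cluster values, and the
image of a half-disc is connected (`exists_tendsto_of_finite_clusterPt`).

*Support.* Let the bulk be the set of `x > 0` with `Im m₁c(x) > 0`. At a positive end point of the
bulk `m₁c(x)` is real, and the two distinct roots `m₁c` and its complex conjugate of a polynomial
relation collide. For a relation of least degree this happens at finitely many points only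
(`Admissible.finite_frontier_bulk`), so the closure of the bulk is a finite union of intervals
(`exists_edges_of_finite_frontier`). The second density is an explicit multiple of the first, by a
factor bounded from both sides uniformly in the dimension (`exists_comparable`), so both have this
closure as their support. Comparing the equation with its conjugate shows that there is no density
for large `x`, nor near the origin if `|z| > 1` (`exists_im_eq_zero_large`,
`exists_im_eq_zero_near_zero`). If `|z| < 1`, then `Re m_c²` is negative and bounded away from zero
near the origin (`exists_re_le_neg`), which is the blow-up `x ^ (-1/2)`.

*Total mass.* Since `m₂c(w) = -1 / w + O(|w| ^ (-3/2))` at infinity, Cauchy's theorem for a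
rectangle computes the mass of `Im m₂c` along horizontal lines (`abs_integral_im_sub_le`), and the
bound `|m₂c| ≤ (τ |w|) ^ (-1/2)` permits the passage to the real axis.

*Regular edges.* The equation is `f(√x, m_c(x)) = 0`. Let `x₀` be a regular edge. Along the
solutions, `f(√x₀, m_c(x)) = (√x - √x₀) E` with `E` bounded and `Re E ≥ 1/2` (`fFun_eq_mul`). The
derivative `∂_m f` vanishes at the edge, because two conjugate zeros merge there
(`Admissible.deriv_fFun_eq_zero`), so by Taylor's formula the left side is `½ ∂_m² f · u² + O(u³)`
with `u = m_c(x) - m_c(x₀)` (`norm_sub_quadratic_le`). Hence `u = O(√|x - x₀|)`, and on the side of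
`x₀` where the sign forces `u² < 0` to leading order, `Im u` is comparable to `√|x - x₀|`. On that
side there is positive density, so the gap is on the other side (`exists_simWith_edge`).
-/

noncomputable section

namespace SelfConsistent

variable {N : ℕ} {σ : Fin N → ℝ} {a τ : ℝ} {w b : ℂ} {z : ℂ}

/-! ### Averages over the spectrum -/

/-- The average `N⁻¹ ∑ fᵢ` of a finite real family. -/
def avg (f : Fin N → ℝ) : ℝ := (1 / (N : ℝ)) * ∑ i, f i

/-- The average `N⁻¹ ∑ fᵢ` of a finite complex family. -/
def cavg (f : Fin N → ℂ) : ℂ := (1 / (N : ℂ)) * ∑ i, f i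

lemma cavg_im (f : Fin N → ℂ) : (cavg f).im = avg fun i => (f i).im := by
  have : (1 / (N : ℂ)) = ((1 / (N : ℝ) : ℝ) : ℂ) := by push_cast; rfl
  rw [cavg, avg, this, Complex.im_ofReal_mul, Complex.im_sum]

lemma cavg_re (f : Fin N → ℂ) : (cavg f).re = avg fun i => (f i).re := by
  have : (1 / (N : ℂ)) = ((1 / (N : ℝ) : ℝ) : ℂ) := by push_cast; rfl
  rw [cavg, avg, this, Complex.re_ofReal_mul, Complex.re_sum]

lemma cavg_ofReal (f : Fin N → ℝ) : cavg (fun i => (f i : ℂ)) = (avg f : ℂ) := by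
  simp [cavg, avg]

lemma avg_mono {f g : Fin N → ℝ} (h : ∀ i, f i ≤ g i) : avg f ≤ avg g :=
  mul_le_mul_of_nonneg_left (Finset.sum_le_sum fun i _ => h i) (by positivity)

lemma avg_nonneg {f : Fin N → ℝ} (h : ∀ i, 0 ≤ f i) : 0 ≤ avg f :=
  mul_nonneg (by positivity) (Finset.sum_nonneg fun i _ => h i)

lemma avg_mul_left (k : ℝ) (f : Fin N → ℝ) : avg (fun i => k * f i) = k * avg f := by
  rw [avg, avg, ← Finset.mul_sum]; ring

lemma cavg_mul_left (k : ℂ) (f : Fin N → ℂ) : cavg (fun i => k * f i) = k * cavg f := by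
  rw [cavg, cavg, ← Finset.mul_sum]; ring

lemma cavg_sub (f g : Fin N → ℂ) : cavg (fun i => f i - g i) = cavg f - cavg g := by
  rw [cavg, cavg, cavg, Finset.sum_sub_distrib]; ring

lemma avg_const (hN : N ≠ 0) (k : ℝ) : avg (fun _ : Fin N => k) = k := by
  have : (N : ℝ) ≠ 0 := by exact_mod_cast hN
  simp [avg]; field_simp

lemma cavg_const (hN : N ≠ 0) (k : ℂ) : cavg (fun _ : Fin N => k) = k := by
  have : (N : ℂ) ≠ 0 := by exact_mod_cast hN
  simp [cavg]; field_simp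

lemma norm_cavg_le (f : Fin N → ℂ) : ‖cavg f‖ ≤ avg fun i => ‖f i‖ := by
  rw [cavg, avg, norm_mul]
  have : ‖(1 / (N : ℂ))‖ = 1 / (N : ℝ) := by simp
  rw [this]
  exact mul_le_mul_of_nonneg_left (norm_sum_le _ _) (by positivity)

/-- The Cauchy–Schwarz inequality for averages. -/
lemma sq_avg_le {r f g : Fin N → ℝ} (hf : ∀ i, 0 ≤ f i) (hg : ∀ i, 0 ≤ g i)
    (h : ∀ i, r i ^ 2 ≤ f i * g i) : avg r ^ 2 ≤ avg f * avg g := by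
  have := Finset.sum_sq_le_sum_mul_sum_of_sq_le_mul Finset.univ (r := r) (f := f) (g := g)
    (fun i _ => hf i) (fun i _ => hg i) (fun i _ => h i)
  rw [avg, avg, avg, mul_pow]
  calc _ ≤ (1 / (N : ℝ)) ^ 2 * ((∑ i, f i) * ∑ i, g i) :=
        mul_le_mul_of_nonneg_left this (by positivity)
    _ = _ := by ring

/-- One summand of an average of nonnegative numbers is at most `N` times the average. -/
lemma le_mul_avg {f : Fin N → ℝ} (h : ∀ i, 0 ≤ f i) (i : Fin N) : f i ≤ N * avg f := by
  have hN : (N : ℝ) ≠ 0 := by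
    have := i.pos
    exact_mod_cast this.ne'
  have : (N : ℝ) * avg f = ∑ j, f j := by rw [avg]; field_simp
  rw [this]
  exact Finset.single_le_sum (fun j _ => h j) (Finset.mem_univ i)

lemma tendsto_cavg {ι : Type*} {l : Filter ι} {f : ι → Fin N → ℂ} {g : Fin N → ℂ}
    (h : ∀ i, Tendsto (fun t => f t i) l (𝓝 (g i))) :
    Tendsto (fun t => cavg (f t)) l (𝓝 (cavg g)) :=
  (tendsto_finsetSum _ fun i _ => h i).const_mul _

lemma tendsto_avg {ι : Type*} {l : Filter ι} {f : ι → Fin N → ℝ} {g : Fin N → ℝ}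
    (h : ∀ i, Tendsto (fun t => f t i) l (𝓝 (g i))) :
    Tendsto (fun t => avg (f t)) l (𝓝 (avg g)) :=
  (tendsto_finsetSum _ fun i _ => h i).const_mul _

lemma Admissible.avg_eq (h : Admissible τ σ z) : avg σ = 1 := h.mean_eq_one

lemma Admissible.ne_zero (h : Admissible τ σ z) : N ≠ 0 := by
  rintro rfl
  simpa using h.mean_eq_one

/-! ### Solutions of the self-consistent equation up to the real axis -/

/-- The denominator `Dᵢ = a - w b - σᵢ y` with `y = w b² / (a - w b²)`, where `b` stands for
`1 + m₁` and `a` for `|z|²`. -/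
def den (a s : ℝ) (w b : ℂ) : ℂ := a - w * b - s * (w * b ^ 2 / (a - w * b ^ 2))

/-- `b = 1 + m₁` solves the self-consistent equation at `w`, where `w` may lie on the real axis.
Both equations and both bounds survive the passage to the boundary, so that estimates derived from
this predicate hold in the upper half plane and on the real axis alike. Here `m₂` has been
eliminated: `m₂ = b / (a - w b²)`. The identity `eq_two` follows from `eq_one` unless `a = w b`, and
is kept as a separate equation since this case is not excluded on the real axis. -/
structure IsSol (σ : Fin N → ℝ) (a : ℝ) (w b : ℂ) : Prop where
  b_ne : b ≠ 0
  c_ne : (a : ℂ) - w * b ^ 2 ≠ 0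
  den_ne : ∀ i, den a (σ i) w b ≠ 0
  eq_one : 1 - b⁻¹ = cavg fun i => (σ i : ℂ) / den a (σ i) w b
  eq_two : ((a : ℂ) - w * b ^ 2)⁻¹ = cavg fun i => (den a (σ i) w b)⁻¹
  bound_one : a * avg (fun i => σ i / ‖den a (σ i) w b‖ ^ 2) ≤ 1
  bound_two : ‖w‖ * ‖b‖ ^ 2 * avg (fun i => σ i / ‖den a (σ i) w b‖ ^ 2) ≤ 1
  im_nonneg : 0 ≤ b.im
  im_mul_nonneg : 0 ≤ (w * (b - 1)).im

lemma im_inv_ge {x : ℂ} {k : ℝ} (h : x.im ≤ -k) : k / ‖x‖ ^ 2 ≤ (x⁻¹).im := by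
  rw [Complex.inv_im, Complex.normSq_eq_norm_sq]
  gcongr; linarith

lemma im_real_div (a : ℝ) (x : ℂ) : ((a : ℂ) / x).im = -(a * x.im / ‖x‖ ^ 2) := by
  rw [div_eq_mul_inv, Complex.im_ofReal_mul, Complex.inv_im, Complex.normSq_eq_norm_sq]; ring

/-- Facts about the denominators in the self-consistent equation when `m₁` lies in the closed
sector `{Im m₁ ≥ 0, Im (w m₁) ≥ 0}`. -/
lemma im_den_facts (ha : 0 ≤ a) (hw : 0 < w.im) {m : ℂ} (hm : 0 ≤ m.im)
    (hwm : 0 ≤ (w * m).im) :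
    (-w * (1 + m) + a / (1 + m)).im ≤ -w.im ∧
    0 < ((-w * (1 + m) + a / (1 + m))⁻¹).im ∧
    0 ≤ (w * (-w * (1 + m) + a / (1 + m))⁻¹).im ∧
    (∀ i, (-w * (1 + σ i * (-w * (1 + m) + a / (1 + m))⁻¹) + a / (1 + m)).im ≤
      -(w.im + σ i * (w * (-w * (1 + m) + a / (1 + m))⁻¹).im + a * m.im / ‖1 + m‖ ^ 2)) ∧
    (∀ i, (w⁻¹ * (-w * (1 + σ i * (-w * (1 + m) + a / (1 + m))⁻¹) + a / (1 + m))).im ≤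
      -(σ i * ((-w * (1 + m) + a / (1 + m))⁻¹).im)) := by
  have hw0 : w ≠ 0 := by rintro rfl; simp at hw
  have h1 : (w * (1 + m)).im = w.im + (w * m).im := by rw [mul_add]; simp
  have e1 : (-w * (1 + m) + a / (1 + m)).im =
      -(w.im + (w * m).im + a * m.im / ‖1 + m‖ ^ 2) := by
    rw [Complex.add_im, im_real_div, neg_mul, Complex.neg_im, h1]; simp; ring
  have p1 : 0 ≤ a * m.im / ‖1 + m‖ ^ 2 := by positivity
  set e := -w * (1 + m) + a / (1 + m) with he
  have he0 : e ≠ 0 := by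
    intro h; rw [h, Complex.zero_im] at e1; linarith
  have hpos : 0 < (e⁻¹).im := by
    have := im_inv_ge (x := e) (k := w.im) (by linarith)
    have h2 : 0 < ‖e‖ ^ 2 := by positivity
    exact lt_of_lt_of_le (by positivity) this
  have hwe : 0 ≤ (w * e⁻¹).im := by
    have h3 : w * e⁻¹ = (w⁻¹ * e)⁻¹ := by rw [mul_inv, inv_inv]
    have h4 : w⁻¹ * e = -(1 + m) + a / (w * (1 + m)) := by
      rw [he]; field_simp
    have h5 : (w⁻¹ * e).im ≤ -0 := by
      rw [h4, Complex.add_im, im_real_div, Complex.neg_im, h1]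
      have : 0 ≤ a * (w.im + (w * m).im) / ‖w * (1 + m)‖ ^ 2 := by positivity
      simp only [Complex.add_im, Complex.one_im]; linarith
    rw [h3]
    simpa using im_inv_ge h5
  refine ⟨by linarith, hpos, hwe, fun i => ?_, fun i => ?_⟩
  · have : -w * (1 + σ i * e⁻¹) + a / (1 + m) = -w - σ i * (w * e⁻¹) + a / (1 + m) := by ring
    rw [this, Complex.add_im, im_real_div, Complex.sub_im, Complex.im_ofReal_mul]
    simp; linarith
  · have : w⁻¹ * (-w * (1 + σ i * e⁻¹) + a / (1 + m)) =
        -(1 + σ i * e⁻¹) + a / (w * (1 + m)) := by field_simp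
    rw [this, Complex.add_im, im_real_div, h1, Complex.neg_im, Complex.add_im,
      Complex.im_ofReal_mul]
    have : 0 ≤ a * (w.im + (w * m).im) / ‖w * (1 + m)‖ ^ 2 := by positivity
    rw [Complex.one_im]; linarith

lemma selfRHS_eq (m : ℂ) : selfRHS σ z w m = cavg fun i => (σ i : ℂ) *
    (-w * (1 + σ i * (-w * (1 + m) + ((‖z‖ ^ 2 : ℝ) : ℂ) / (1 + m))⁻¹) +
      ((‖z‖ ^ 2 : ℝ) : ℂ) / (1 + m))⁻¹ := by
  simp only [selfRHS, m2Of, cavg, Complex.ofReal_pow]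

/-- In the upper half plane the solutions of the self-consistent equation satisfy `IsSol`: the two
bounds come from comparing imaginary parts in the equations for `m₁`, `m₂` and `w m₂`. -/
lemma IsSol.of_im_pos (hN : N ≠ 0) (hσ : ∀ i, 0 < σ i) (hw : 0 < w.im) {m : ℂ} (hm : 0 < m.im)
    (hwm : 0 < (w * m).im) (h : m = selfRHS σ z w m) : IsSol σ (‖z‖ ^ 2) w (1 + m) := by
  rw [selfRHS_eq] at h
  set a : ℝ := ‖z‖ ^ 2 with ha'
  have ha : 0 ≤ a := by positivity
  obtain ⟨f1, f2, f3, f4, f5⟩ := im_den_facts (σ := σ) ha hw hm.le hwm.le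
  have hw0 : w ≠ 0 := by rintro rfl; simp at hw
  have hb0 : 1 + m ≠ 0 := by
    intro h0; have := congrArg Complex.im h0; simp at this; linarith
  have hbim : (1 + m).im = m.im := by simp
  have hwb : (w * (1 + m)).im = w.im + (w * m).im := by rw [mul_add]; simp
  set b := 1 + m with hb
  set e := -w * b + a / b with he
  have he0 : e ≠ 0 := by intro h0; rw [h0] at f1; simp at f1; linarith
  have hc : (a : ℂ) - w * b ^ 2 = b * e := by rw [he]; field_simp; ring
  have hc0 : (a : ℂ) - w * b ^ 2 ≠ 0 := by rw [hc]; exact mul_ne_zero hb0 he0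
  set E : Fin N → ℂ := fun i => -w * (1 + σ i * e⁻¹) + a / b with hE
  have hEim : ∀ i, (E i).im ≤ -(σ i * (w * e⁻¹).im + a * m.im / ‖b‖ ^ 2) := fun i => by
    have := f4 i
    linarith
  have hE0 : ∀ i, E i ≠ 0 := fun i h0 => by
    have h1 := f4 i
    have h2 : (E i).im = 0 := by rw [h0]; simp
    have h3 : 0 ≤ σ i * (w * e⁻¹).im := mul_nonneg (hσ i).le f3
    have h4 : 0 ≤ a * m.im / ‖b‖ ^ 2 := by positivity
    change (E i).im ≤ _ at h1
    linarith
  have hD : ∀ i, den a (σ i) w b = b * E i := fun i => by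
    have h1 : b * E i = -(w * b * (1 + σ i * e⁻¹)) + a := by rw [hE]; field_simp
    rw [den, hc, h1]; field_simp; ring
  have hD0 : ∀ i, den a (σ i) w b ≠ 0 := fun i => by rw [hD]; exact mul_ne_zero hb0 (hE0 i)
  have hDn : ∀ i, ‖den a (σ i) w b‖ ^ 2 = ‖b‖ ^ 2 * ‖E i‖ ^ 2 := fun i => by
    rw [hD, norm_mul, mul_pow]
  have hbn : 0 < ‖b‖ ^ 2 := by positivity
  have hEn : ∀ i, 0 < ‖E i‖ ^ 2 := fun i => by
    have := hE0 i
    positivity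
  have hmE : m = cavg fun i => (σ i : ℂ) * (E i)⁻¹ := h
  have hm_b : m = b - 1 := by rw [hb]; ring
  have eq1 : 1 - b⁻¹ = cavg fun i => (σ i : ℂ) / den a (σ i) w b := by
    have : (fun i => (σ i : ℂ) / den a (σ i) w b) = fun i => b⁻¹ * ((σ i : ℂ) * (E i)⁻¹) := by
      funext i; rw [hD]; field_simp
    rw [this, cavg_mul_left, ← hmE, hm_b]; field_simp
  have eq2 : ((a : ℂ) - w * b ^ 2)⁻¹ = cavg fun i => (den a (σ i) w b)⁻¹ := by
    have h1 : cavg (fun i => (a - w * b) * (den a (σ i) w b)⁻¹ -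
        (w * b ^ 2 / (a - w * b ^ 2)) * ((σ i : ℂ) / den a (σ i) w b)) = 1 := by
      rw [← cavg_const hN 1]
      congr 1; funext i
      have := hD0 i
      rw [div_eq_mul_inv (σ i : ℂ), ← mul_assoc, ← sub_mul]
      have h2 : (a : ℂ) - w * b - w * b ^ 2 / (a - w * b ^ 2) * σ i = den a (σ i) w b := by
        rw [den]; ring
      rw [h2, mul_inv_cancel₀ this]
    rw [cavg_sub, cavg_mul_left, cavg_mul_left, ← eq1] at h1
    have hne : (a : ℂ) - w * b ≠ 0 := by
      intro h0
      have := congrArg Complex.im h0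
      rw [Complex.sub_im, hwb, Complex.ofReal_im, Complex.zero_im] at this; linarith
    have h3 : (a - w * b) * cavg (fun i => (den a (σ i) w b)⁻¹) =
        (a - w * b) * ((a : ℂ) - w * b ^ 2)⁻¹ := by
      have : (a - w * b) * cavg (fun i => (den a (σ i) w b)⁻¹) =
        1 + w * b ^ 2 / (a - w * b ^ 2) * (1 - b⁻¹) := by linear_combination h1
      rw [this]; field_simp; ring
    exact (mul_left_cancel₀ hne h3).symm
  have him : ∀ i, ((σ i : ℂ) * (E i)⁻¹).im = σ i * (E i)⁻¹.im := fun i => by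
    rw [Complex.im_ofReal_mul]
  have bd1 : a * avg (fun i => σ i / ‖den a (σ i) w b‖ ^ 2) ≤ 1 := by
    have h1 : m.im * (a * avg (fun i => σ i / ‖den a (σ i) w b‖ ^ 2)) ≤ m.im * 1 := by
      rw [mul_one]
      conv_rhs => rw [hmE]
      rw [cavg_im, ← avg_mul_left, ← avg_mul_left]
      refine avg_mono fun i => ?_
      rw [him, hDn]
      have h2 : (E i).im ≤ -(a * m.im / ‖b‖ ^ 2) := by
        have := hEim i
        have h3 : 0 ≤ σ i * (w * e⁻¹).im := mul_nonneg (hσ i).le f3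
        linarith
      have := mul_le_mul_of_nonneg_left (im_inv_ge h2) (hσ i).le
      refine le_trans (le_of_eq ?_) this
      have := hEn i
      field_simp
    exact le_of_mul_le_mul_left h1 hm
  have hm2 : e⁻¹ = cavg fun i => (E i)⁻¹ := by
    have h1 : e⁻¹ = b * ((a : ℂ) - w * b ^ 2)⁻¹ := by rw [hc]; field_simp
    rw [h1, eq2, ← cavg_mul_left]
    congr 1; funext i; rw [hD]; field_simp
  set s := avg fun i => σ i / ‖E i‖ ^ 2 with hs
  have hs0 : 0 ≤ s := avg_nonneg fun i => div_nonneg (hσ i).le (hEn i).le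
  have g1 : s * (w * e⁻¹).im ≤ (e⁻¹).im := by
    conv_rhs => rw [hm2]
    rw [cavg_im, hs, mul_comm, ← avg_mul_left]
    refine avg_mono fun i => ?_
    have h2 : (E i).im ≤ -(σ i * (w * e⁻¹).im) := by
      have := hEim i
      have h4 : 0 ≤ a * m.im / ‖b‖ ^ 2 := by positivity
      linarith
    refine le_trans (le_of_eq ?_) (im_inv_ge h2)
    ring
  have g2 : ‖w‖ ^ 2 * s * (e⁻¹).im ≤ (w * e⁻¹).im := by
    conv_rhs => rw [hm2]
    rw [← cavg_mul_left, cavg_im, hs, mul_right_comm, ← avg_mul_left]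
    refine avg_mono fun i => ?_
    have h3 : w * (E i)⁻¹ = (w⁻¹ * E i)⁻¹ := by rw [mul_inv, inv_inv]
    rw [h3]
    refine le_trans (le_of_eq ?_) (im_inv_ge (f5 i))
    rw [norm_mul, norm_inv, mul_pow]
    have := hEn i
    have hwn : ‖w‖ ≠ 0 := by simpa using hw0
    change _ = _ / ((‖w‖⁻¹) ^ 2 * ‖E i‖ ^ 2)
    field_simp
  have bd2 : ‖w‖ * ‖b‖ ^ 2 * avg (fun i => σ i / ‖den a (σ i) w b‖ ^ 2) ≤ 1 := by
    have h1 : ‖w‖ * ‖b‖ ^ 2 * avg (fun i => σ i / ‖den a (σ i) w b‖ ^ 2) = ‖w‖ * s := by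
      rw [mul_assoc, ← avg_mul_left, hs]
      congr 2; funext i; rw [hDn]; have := hEn i; field_simp
    rw [h1]
    have h2 : (‖w‖ * s) ^ 2 * (e⁻¹).im ≤ 1 * (e⁻¹).im := by
      have := mul_le_mul_of_nonneg_left g2 hs0
      nlinarith
    have h3 := le_of_mul_le_mul_right h2 f2
    have h4 : 0 ≤ ‖w‖ * s := by positivity
    nlinarith
  exact ⟨hb0, hc0, hD0, eq1, eq2, bd1, bd2, by rw [hbim]; exact hm.le,
    by rw [← hm_b]; exact hwm.le⟩

/-! ### A priori bounds -/

/-- `|w| |m₁|² ≤ 1`. -/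
lemma IsSol.norm_sub_one_le (h : IsSol σ a w b) (hσ : ∀ i, 0 < σ i) (hav : avg σ = 1) :
    ‖w‖ * ‖b - 1‖ ^ 2 ≤ 1 := by
  have h1 : b - 1 = b * cavg fun i => (σ i : ℂ) / den a (σ i) w b := by
    rw [← h.eq_one]; have := h.b_ne; field_simp
  have h2 : ‖cavg fun i => (σ i : ℂ) / den a (σ i) w b‖ ^ 2 ≤
      avg σ * avg fun i => σ i / ‖den a (σ i) w b‖ ^ 2 := by
    refine le_trans (pow_le_pow_left₀ (norm_nonneg _) (norm_cavg_le _) 2)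
      (sq_avg_le (fun i => (hσ i).le) (fun i => div_nonneg (hσ i).le (by positivity)) fun i => ?_)
    rw [norm_div, Complex.norm_real, Real.norm_eq_abs, abs_of_pos (hσ i)]
    exact le_of_eq (by ring)
  rw [hav, one_mul] at h2
  rw [h1, norm_mul, mul_pow, ← mul_assoc]
  exact le_trans (mul_le_mul_of_nonneg_left h2 (by positivity)) h.bound_two

/-- `|w| |m₂|² ≤ τ⁻¹`, written for `m₂ = b / (a - w b²)`. -/
lemma IsSol.norm_c_ge (h : IsSol σ a w b) (hτ : 0 < τ) (hσ : ∀ i, τ ≤ σ i) :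
    τ * ‖w‖ * ‖b‖ ^ 2 ≤ ‖(a : ℂ) - w * b ^ 2‖ ^ 2 := by
  have hN : N ≠ 0 := by
    rintro rfl
    have h1 := h.eq_two
    have h2 := h.c_ne
    simp [cavg] at h1
    exact h2 h1
  have hσ0 : ∀ i, 0 < σ i := fun i => hτ.trans_le (hσ i)
  set A := avg fun i => σ i / ‖den a (σ i) w b‖ ^ 2 with hA
  have h2 : τ * ‖((a : ℂ) - w * b ^ 2)⁻¹‖ ^ 2 ≤ A := by
    rw [h.eq_two]
    have h3 : ‖cavg fun i => (den a (σ i) w b)⁻¹‖ ^ 2 ≤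
        avg (fun _ : Fin N => τ⁻¹) * A := by
      refine le_trans (pow_le_pow_left₀ (norm_nonneg _) (norm_cavg_le _) 2)
        (sq_avg_le (fun i => by positivity)
          (fun i => div_nonneg (hσ0 i).le (by positivity)) fun i => ?_)
      rw [norm_inv, inv_pow, div_eq_mul_inv, ← mul_assoc]
      refine le_mul_of_one_le_left (by positivity) ?_
      rw [inv_mul_eq_div, one_le_div hτ]; exact hσ i
    rw [avg_const hN] at h3
    calc _ ≤ τ * (τ⁻¹ * A) := by gcongr
      _ = A := by field_simp
  have h4 : 0 < ‖(a : ℂ) - w * b ^ 2‖ ^ 2 := by have := h.c_ne; positivity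
  have h5 := mul_le_mul_of_nonneg_left h2 (by positivity : 0 ≤ ‖w‖ * ‖b‖ ^ 2)
  have h6 := h5.trans h.bound_two
  rw [norm_inv, inv_pow] at h6
  calc τ * ‖w‖ * ‖b‖ ^ 2 = (‖w‖ * ‖b‖ ^ 2 * (τ * (‖(a : ℂ) - w * b ^ 2‖ ^ 2)⁻¹)) *
        ‖(a : ℂ) - w * b ^ 2‖ ^ 2 := by
        rw [mul_assoc (‖w‖ * ‖b‖ ^ 2), mul_assoc τ _ (‖(a : ℂ) - w * b ^ 2‖ ^ 2),
          inv_mul_cancel₀ h4.ne']; ring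
    _ ≤ 1 * ‖(a : ℂ) - w * b ^ 2‖ ^ 2 := by gcongr
    _ = _ := one_mul _

/-- Solutions are stable under limits away from `w = 0`. -/
lemma IsSol.of_tendsto {ι : Type*} {l : Filter ι} [l.NeBot] {u v : ι → ℂ} (ha : 0 ≤ a)
    (hτ : 0 < τ) (hσ : ∀ i, τ ≤ σ i) (hw : w ≠ 0) (hu : Tendsto u l (𝓝 w))
    (hv : Tendsto v l (𝓝 b)) (h : ∀ᶠ t in l, IsSol σ a (u t) (v t)) : IsSol σ a w b := by
  have hσ0 : ∀ i, 0 < σ i := fun i => hτ.trans_le (hσ i)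
  have hwn : 0 < ‖w‖ := by positivity
  have hc : Tendsto (fun t => (a : ℂ) - u t * v t ^ 2) l (𝓝 (a - w * b ^ 2)) :=
    tendsto_const_nhds.sub (hu.mul (hv.pow 2))
  have hF2 : τ * ‖w‖ * ‖b‖ ^ 2 ≤ ‖(a : ℂ) - w * b ^ 2‖ ^ 2 :=
    le_of_tendsto_of_tendsto ((hu.norm.const_mul τ).mul (hv.norm.pow 2)) (hc.norm.pow 2)
      (h.mono fun t ht => ht.norm_c_ge hτ hσ)
  have hdn : (a : ℂ) - w * b ^ 2 ≠ 0 → ∀ i,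
      Tendsto (fun t => den a (σ i) (u t) (v t)) l (𝓝 (den a (σ i) w b)) := fun h0 i =>
    (tendsto_const_nhds.sub (hu.mul hv)).sub (((hu.mul (hv.pow 2)).div hc h0).const_mul _)
  have hb0 : b ≠ 0 := by
    rintro rfl
    -- for `a = 0` the bound on `m₂` keeps `b` away from zero
    have ha0 : 0 < a := by
      rcases ha.lt_or_eq with ha0 | ha0
      · exact ha0
      exfalso
      have h2 : ∀ᶠ t in l, τ ≤ ‖u t‖ * ‖v t‖ ^ 2 := by
        filter_upwards [h, hu.eventually_ne hw] with t ht htw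
        have h3 := ht.norm_c_ge hτ hσ
        rw [← ha0, Complex.ofReal_zero, zero_sub, norm_neg, norm_mul, norm_pow] at h3
        have h4 : 0 < ‖u t‖ * ‖v t‖ ^ 2 := by have := ht.b_ne; positivity
        have h5 : τ * (‖u t‖ * ‖v t‖ ^ 2) ≤ (‖u t‖ * ‖v t‖ ^ 2) * (‖u t‖ * ‖v t‖ ^ 2) := by
          nlinarith
        exact le_of_mul_le_mul_right h5 h4
      have h6 := ge_of_tendsto (hu.norm.mul (hv.norm.pow 2)) h2
      simp at h6; linarith
    have hcc : (a : ℂ) - w * 0 ^ 2 ≠ 0 := by simpa using ha0.ne'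
    have h3 : Tendsto (fun t => v t * cavg fun i => (σ i : ℂ) / den a (σ i) (u t) (v t)) l
        (𝓝 (0 * cavg fun i => (σ i : ℂ) / den a (σ i) w 0)) := by
      refine hv.mul (tendsto_cavg fun i => tendsto_const_nhds.div (hdn hcc i) ?_)
      simpa [den] using ha0.ne'
    have h4 : Tendsto (fun t => v t * cavg fun i => (σ i : ℂ) / den a (σ i) (u t) (v t)) l
        (𝓝 (0 - 1)) := by
      refine (hv.sub tendsto_const_nhds).congr' (h.mono fun t ht => ?_)
      have := ht.b_ne
      change v t - 1 = v t * cavg _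
      rw [← ht.eq_one]; field_simp
    have := tendsto_nhds_unique h3 h4
    simp at this
  have hbn : 0 < ‖b‖ := by positivity
  have hc0 : (a : ℂ) - w * b ^ 2 ≠ 0 := by
    intro h0
    rw [h0] at hF2
    have : 0 < τ * ‖w‖ * ‖b‖ ^ 2 := by positivity
    simp at hF2; linarith
  have hd := hdn hc0
  have hd0 : ∀ i, den a (σ i) w b ≠ 0 := by
    intro i h0
    have h1 : ∀ᶠ t in l, ‖u t‖ * ‖v t‖ ^ 2 * σ i ≤ N * ‖den a (σ i) (u t) (v t)‖ ^ 2 := by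
      filter_upwards [h] with t ht
      have h2 := le_mul_avg (f := fun i => σ i / ‖den a (σ i) (u t) (v t)‖ ^ 2)
        (fun i => div_nonneg (hσ0 i).le (by positivity)) i
      have h3 := ht.bound_two
      have h4 : 0 < ‖den a (σ i) (u t) (v t)‖ ^ 2 := by have := ht.den_ne i; positivity
      have h5 : ‖u t‖ * ‖v t‖ ^ 2 * (σ i / ‖den a (σ i) (u t) (v t)‖ ^ 2) ≤ N := by
        calc _ ≤ ‖u t‖ * ‖v t‖ ^ 2 * (N * avg fun i => σ i / ‖den a (σ i) (u t) (v t)‖ ^ 2) := by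
              gcongr
          _ = N * (‖u t‖ * ‖v t‖ ^ 2 * avg fun i => σ i / ‖den a (σ i) (u t) (v t)‖ ^ 2) := by
              ring
          _ ≤ N * 1 := by gcongr
          _ = N := mul_one _
      rw [← mul_div_assoc, div_le_iff₀ h4] at h5
      exact h5
    have h2 := le_of_tendsto_of_tendsto ((hu.norm.mul (hv.norm.pow 2)).mul_const (σ i))
      (((hd i).norm.pow 2).const_mul (N : ℝ)) h1
    rw [h0] at h2
    have h3 : 0 < ‖w‖ * ‖b‖ ^ 2 * σ i := by have := hσ0 i; positivity
    simp at h2; linarith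
  have hA : Tendsto (fun t => avg fun i => σ i / ‖den a (σ i) (u t) (v t)‖ ^ 2) l
      (𝓝 (avg fun i => σ i / ‖den a (σ i) w b‖ ^ 2)) :=
    tendsto_avg fun i => tendsto_const_nhds.div ((hd i).norm.pow 2)
      (by have := hd0 i; positivity)
  refine ⟨hb0, hc0, hd0, ?_, ?_, ?_, ?_, ?_, ?_⟩
  · exact tendsto_nhds_unique_of_eventuallyEq (tendsto_const_nhds.sub (hv.inv₀ hb0))
      (tendsto_cavg fun i => tendsto_const_nhds.div (hd i) (hd0 i)) (h.mono fun t ht => ht.eq_one)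
  · exact tendsto_nhds_unique_of_eventuallyEq (hc.inv₀ hc0)
      (tendsto_cavg fun i => (hd i).inv₀ (hd0 i)) (h.mono fun t ht => ht.eq_two)
  · exact le_of_tendsto (hA.const_mul a) (h.mono fun t ht => ht.bound_one)
  · exact le_of_tendsto ((hu.norm.mul (hv.norm.pow 2)).mul hA) (h.mono fun t ht => ht.bound_two)
  · exact ge_of_tendsto ((Complex.continuous_im.tendsto _).comp hv)
      (h.mono fun t ht => ht.im_nonneg)
  · exact ge_of_tendsto ((Complex.continuous_im.tendsto _).comp
      (hu.mul (hv.sub tendsto_const_nhds))) (h.mono fun t ht => ht.im_mul_nonneg)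

/-! ### Existence of the solution by hyperbolic contraction -/

/-- The points `x`, `y` of the closed upper half plane have hyperbolic distance at most `d`,
measured by `|x - y| / √(Im x Im y) = 2 sinh (dist / 2)`. If one of the points is real, then the
condition forces them to be equal. -/
structure HypLE (d : ℝ) (x y : ℂ) : Prop where
  im_left : 0 ≤ x.im
  im_right : 0 ≤ y.im
  sq_le : ‖x - y‖ ^ 2 ≤ d ^ 2 * (x.im * y.im)

/-- Hyperbolic balls are stable under addition, by the inequality of arithmetic and geometric means
for the mixed products of imaginary parts. -/
lemma HypLE.add {d : ℝ} {x y x' y' : ℂ} (h : HypLE d x y) (h' : HypLE d x' y') :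
    HypLE d (x + x') (y + y') := by
  obtain ⟨hx, hy, hd⟩ := h
  obtain ⟨hx', hy', hd'⟩ := h'
  refine ⟨by simpa using add_nonneg hx hx', by simpa using add_nonneg hy hy', ?_⟩
  have e : x + x' - (y + y') = (x - y) + (x' - y') := by ring
  rw [e, Complex.add_im, Complex.add_im]
  have t := norm_add_le (x - y) (x' - y')
  set p := ‖x - y‖
  set p' := ‖x' - y'‖
  have hp : 0 ≤ p := norm_nonneg _
  have hp' : 0 ≤ p' := norm_nonneg _
  have h1 : (p * p') ^ 2 ≤ (d ^ 2 * ((x.im * y'.im + x'.im * y.im) / 2)) ^ 2 := by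
    have h2 : p ^ 2 * p' ^ 2 ≤ (d ^ 2 * (x.im * y.im)) * (d ^ 2 * (x'.im * y'.im)) := by gcongr
    have h3 : (x.im * y'.im) * (x'.im * y.im) ≤ ((x.im * y'.im + x'.im * y.im) / 2) ^ 2 := by
      nlinarith [sq_nonneg (x.im * y'.im - x'.im * y.im)]
    have h4 := mul_le_mul_of_nonneg_left h3 (by positivity : 0 ≤ (d ^ 2) ^ 2)
    nlinarith
  have h5 : p * p' ≤ d ^ 2 * ((x.im * y'.im + x'.im * y.im) / 2) :=
    (sq_le_sq₀ (by positivity) (by positivity)).1 h1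
  have h6 : ‖(x - y) + (x' - y')‖ ^ 2 ≤ (p + p') ^ 2 := by gcongr
  nlinarith

lemma HypLE.smul {d k : ℝ} {x y : ℂ} (h : HypLE d x y) (hk : 0 ≤ k) :
    HypLE d (k * x) (k * y) := by
  obtain ⟨hx, hy, hd⟩ := h
  refine ⟨by rw [Complex.im_ofReal_mul]; positivity, by rw [Complex.im_ofReal_mul]; positivity, ?_⟩
  rw [← mul_sub, norm_mul, Complex.im_ofReal_mul, Complex.im_ofReal_mul, mul_pow,
    Complex.norm_real, Real.norm_eq_abs, sq_abs]
  nlinarith [mul_le_mul_of_nonneg_left hd (sq_nonneg k)]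

/-- The map `x ↦ -1 / x` is a hyperbolic isometry. -/
lemma HypLE.neg_inv {d : ℝ} {x y : ℂ} (h : HypLE d x y) : HypLE d (-x⁻¹) (-y⁻¹) := by
  obtain ⟨hx, hy, hd⟩ := h
  have him : ∀ u : ℂ, (-u⁻¹).im = u.im / ‖u‖ ^ 2 := fun u => by
    rw [Complex.neg_im, Complex.inv_im, Complex.normSq_eq_norm_sq]; ring
  refine ⟨by rw [him]; positivity, by rw [him]; positivity, ?_⟩
  by_cases hx0 : x = 0
  · subst hx0
    have : y = 0 := by simpa using hd
    simp [this]
  by_cases hy0 : y = 0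
  · subst hy0
    have : x = 0 := by simpa using hd
    exact absurd this hx0
  have e : -x⁻¹ - -y⁻¹ = (x - y) / (x * y) := by field_simp; ring
  rw [e, norm_div, him, him, norm_mul, div_pow, div_le_iff₀ (by positivity)]
  refine hd.trans (le_of_eq ?_)
  have : ‖x‖ ≠ 0 := by simpa using hx0
  have : ‖y‖ ≠ 0 := by simpa using hy0
  field_simp

lemma HypLE.const_add {d : ℝ} {x y q : ℂ} (h : HypLE d x y) (hq : 0 ≤ q.im) :
    HypLE d (q + x) (q + y) := by
  obtain ⟨hx, hy, hd⟩ := h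
  refine ⟨by simpa using add_nonneg hq hx, by simpa using add_nonneg hq hy, ?_⟩
  rw [add_sub_add_left_eq_sub, Complex.add_im, Complex.add_im]
  refine hd.trans ?_
  gcongr <;> linarith

lemma HypLE.cavg {d : ℝ} {f g : Fin N → ℂ} (h : ∀ i, HypLE d (f i) (g i)) :
    HypLE d (cavg f) (cavg g) := by
  have key : ∀ s : Finset (Fin N), HypLE d (∑ i ∈ s, f i) (∑ i ∈ s, g i) := by
    intro s
    induction s using Finset.induction_on with
    | empty => exact ⟨by simp, by simp, by simp⟩
    | insert i s hi ih => rw [Finset.sum_insert hi, Finset.sum_insert hi]; exact (h i).add ih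
  have := (key Finset.univ).smul (k := 1 / (N : ℝ)) (by positivity)
  simpa [SelfConsistent.cavg] using this

/-- Translation by `q` in the upper half plane is a strict contraction on `{Im ≤ B}`. -/
lemma HypLE.contract {d k B : ℝ} {x y q : ℂ} (h : HypLE d x y) (hk : 0 ≤ k)
    (hq : k * B ≤ q.im) (hq0 : 0 ≤ q.im) (hx : x.im ≤ B) (hy : y.im ≤ B) :
    HypLE (d / (1 + k)) (q + x) (q + y) := by
  obtain ⟨hx0, hy0, hd⟩ := h
  refine ⟨by simpa using add_nonneg hq0 hx0, by simpa using add_nonneg hq0 hy0, ?_⟩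
  rw [add_sub_add_left_eq_sub, Complex.add_im, Complex.add_im]
  have h1 : (1 + k) * x.im ≤ q.im + x.im := by nlinarith
  have h2 : (1 + k) * y.im ≤ q.im + y.im := by nlinarith
  have h3 : ((1 + k) * x.im) * ((1 + k) * y.im) ≤ (q.im + x.im) * (q.im + y.im) := by gcongr
  refine hd.trans ?_
  rw [div_pow, div_mul_eq_mul_div, le_div_iff₀ (by positivity)]
  nlinarith [mul_le_mul_of_nonneg_left h3 (sq_nonneg d)]

/-- In the variable `√w (1 + m₁)` the self-consistent map is composed of sums, averages,
multiplications by nonnegative numbers, `x ↦ -1 / x`, and translation by `√w`, none of which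
increases hyperbolic distances. -/
lemma mul_selfRHS_eq {q m : ℂ} (hq : q ≠ 0) (hw : q ^ 2 = w) :
    q * selfRHS σ z w m = cavg fun i => (σ i : ℂ) * -(q + ((σ i : ℂ) *
      -(q * (1 + m) + ((‖z‖ ^ 2 : ℝ) : ℂ) * -(q * (1 + m))⁻¹)⁻¹ +
        ((‖z‖ ^ 2 : ℝ) : ℂ) * -(q * (1 + m))⁻¹))⁻¹ := by
  rw [selfRHS_eq, ← cavg_mul_left]
  congr 1; funext i
  subst hw
  set a : ℂ := ((‖z‖ ^ 2 : ℝ) : ℂ)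
  set b := 1 + m
  have e1 : -q ^ 2 * b + a / b = -q * (q * b + a * -(q * b)⁻¹) := by
    rw [mul_inv, div_eq_mul_inv]; field_simp; ring
  rw [e1]
  set e := q * b + a * -(q * b)⁻¹
  have e2 : -q ^ 2 * (1 + (σ i : ℂ) * (-q * e)⁻¹) + a / b =
      -q * (q + ((σ i : ℂ) * -e⁻¹ + a * -(q * b)⁻¹)) := by
    rw [mul_inv, mul_inv, div_eq_mul_inv]; field_simp; ring
  rw [e2, mul_inv]; field_simp

/-- The self-consistent map does not increase hyperbolic distances in the variable `√w (1 + m₁)`. -/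
lemma HypLE.selfRHS {d : ℝ} {q m m' : ℂ} (hσ : ∀ i, 0 < σ i) (hq : 0 < q.im) (hw : q ^ 2 = w)
    (h : HypLE d (q * (1 + m)) (q * (1 + m'))) :
    HypLE d (q * selfRHS σ z w m) (q * selfRHS σ z w m') := by
  have hq0 : q ≠ 0 := by rintro rfl; simp at hq
  rw [mul_selfRHS_eq hq0 hw, mul_selfRHS_eq hq0 hw]
  have ha : 0 ≤ ‖z‖ ^ 2 := by positivity
  have h1 := h.neg_inv.smul ha
  exact HypLE.cavg fun i =>
    (((((h.add h1).neg_inv.smul (hσ i).le).add h1).const_add hq.le).neg_inv.smul (hσ i).le)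

lemma avg_pos (hN : N ≠ 0) {f : Fin N → ℝ} (h : ∀ i, 0 < f i) : 0 < avg f := by
  have : Nonempty (Fin N) := ⟨⟨0, Nat.pos_of_ne_zero hN⟩⟩
  have h1 : (0 : ℝ) < N := by exact_mod_cast Nat.pos_of_ne_zero hN
  exact mul_pos (by positivity) (Finset.sum_pos (fun i _ => h i) Finset.univ_nonempty)

/-- The self-consistent map sends the closed sector into the open one and is bounded there. -/
lemma selfRHS_mem (hN : N ≠ 0) (hσ : ∀ i, 0 < σ i) (hav : avg σ = 1) (hw : 0 < w.im) {m : ℂ}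
    (hm : 0 ≤ m.im) (hwm : 0 ≤ (w * m).im) :
    0 < (selfRHS σ z w m).im ∧ 0 < (w * selfRHS σ z w m).im ∧
      ‖selfRHS σ z w m‖ ≤ (w.im)⁻¹ := by
  have hw0 : w ≠ 0 := by rintro rfl; simp at hw
  rw [selfRHS_eq]
  set a : ℝ := ‖z‖ ^ 2 with ha'
  have ha : 0 ≤ a := by positivity
  obtain ⟨f1, f2, f3, f4, f5⟩ := im_den_facts (σ := σ) ha hw hm hwm
  set e := (-w * (1 + m) + a / (1 + m))⁻¹
  set E : Fin N → ℂ := fun i => -w * (1 + σ i * e) + a / (1 + m) with hE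
  have hEim : ∀ i, (E i).im ≤ -w.im := fun i => by
    have h3 : 0 ≤ σ i * (w * e).im := mul_nonneg (hσ i).le f3
    have h4 : 0 ≤ a * m.im / ‖1 + m‖ ^ 2 := by positivity
    have := f4 i
    change (E i).im ≤ _ at this
    linarith
  have hE0 : ∀ i, E i ≠ 0 := fun i h0 => by
    have := hEim i; rw [h0, Complex.zero_im] at this; linarith
  refine ⟨?_, ?_, ?_⟩
  · rw [cavg_im]
    refine avg_pos hN fun i => ?_
    rw [Complex.im_ofReal_mul]
    have h1 := hE0 i
    have h2 : 0 < w.im / ‖E i‖ ^ 2 := div_pos hw (pow_pos (norm_pos_iff.2 h1) 2)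
    exact mul_pos (hσ i) (h2.trans_le (im_inv_ge (hEim i)))
  · rw [← cavg_mul_left, cavg_im]
    refine avg_pos hN fun i => ?_
    have h3 : w * ((σ i : ℂ) * (E i)⁻¹) = σ i * (w⁻¹ * E i)⁻¹ := by rw [mul_inv, inv_inv]; ring
    change 0 < (w * ((σ i : ℂ) * (E i)⁻¹)).im
    rw [h3, Complex.im_ofReal_mul]
    have h1 := hE0 i
    have h2 : 0 < σ i * e.im / ‖w⁻¹ * E i‖ ^ 2 := div_pos (mul_pos (hσ i) f2)
      (pow_pos (norm_pos_iff.2 (mul_ne_zero (inv_ne_zero hw0) h1)) 2)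
    exact mul_pos (hσ i) (h2.trans_le (im_inv_ge (f5 i)))
  · refine (norm_cavg_le _).trans ?_
    have : avg (fun i => (w.im)⁻¹ * σ i) = (w.im)⁻¹ := by rw [avg_mul_left, hav, mul_one]
    rw [← this]
    refine avg_mono fun i => ?_
    change ‖(σ i : ℂ) * (E i)⁻¹‖ ≤ _
    rw [norm_mul, Complex.norm_real, Real.norm_eq_abs, abs_of_pos (hσ i), mul_comm, norm_inv]
    refine mul_le_mul_of_nonneg_right (inv_anti₀ hw ?_) (hσ i).le
    have := Complex.abs_im_le_norm (E i)
    rw [abs_of_nonpos (by linarith [hEim i])] at this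
    linarith [hEim i]

lemma exists_sqrt (hw : 0 < w.im) : ∃ q : ℂ, q ^ 2 = w ∧ 0 < q.re ∧ 0 < q.im := by
  obtain ⟨q, hq⟩ := IsAlgClosed.exists_pow_nat_eq w (n := 2) (by norm_num)
  have h1 : w.im = 2 * (q.re * q.im) := by rw [← hq, sq, Complex.mul_im]; ring
  have h2 : 0 < q.re * q.im := by linarith
  rcases mul_pos_iff.1 h2 with h | h
  · exact ⟨q, hq, h⟩
  · exact ⟨-q, by rw [neg_sq, hq], by simpa using h.1, by simpa using h.2⟩

/-- The iterates of the self-consistent map, started at zero. -/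
def iter (σ : Fin N → ℝ) (z : ℂ) : ℕ → ℂ → ℂ
  | 0, _ => 0
  | n + 1, w => selfRHS σ z w (iter σ z n w)

lemma iter_mem (hN : N ≠ 0) (hσ : ∀ i, 0 < σ i) (hav : avg σ = 1) (hw : 0 < w.im) (n : ℕ) :
    0 ≤ (iter σ z n w).im ∧ 0 ≤ (w * iter σ z n w).im ∧ ‖iter σ z n w‖ ≤ (w.im)⁻¹ := by
  induction n with
  | zero => simp [iter, hw.le]
  | succ n ih =>
    obtain ⟨h1, h2, h3⟩ := selfRHS_mem (z := z) hN hσ hav hw ih.1 ih.2.1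
    exact ⟨h1.le, h2.le, h3⟩

/-- Successive iterates converge geometrically, with rate `1 / (1 + k)`,
`k = (Im w)² / (2 |w|)`. -/
lemma norm_iter_sub_le (hN : N ≠ 0) (hσ : ∀ i, 0 < σ i) (hav : avg σ = 1) (hw : 0 < w.im) {k : ℝ}
    (hk : 0 < k) (hkw : k ≤ w.im ^ 2 / (2 * ‖w‖)) (n : ℕ) :
    ‖iter σ z (n + 2) w - iter σ z (n + 1) w‖ ≤ k⁻¹ * (1 / (1 + k)) ^ n * (w.im)⁻¹ := by
  obtain ⟨q, hq, hq1, hq2⟩ := exists_sqrt hw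
  have hq0 : q ≠ 0 := by rintro rfl; simp at hq1
  have hqn : 0 < ‖q‖ := by positivity
  have hwn : ‖w‖ = ‖q‖ ^ 2 := by rw [← hq, norm_pow]
  have hwim : w.im = 2 * (q.re * q.im) := by rw [← hq, sq, Complex.mul_im]; ring
  have hwle : w.im ≤ 2 * ‖q‖ * q.im := by
    have := mul_le_mul_of_nonneg_right (Complex.re_le_norm q) hq2.le
    rw [hwim]; nlinarith
  have hkB : k * (‖q‖ * (w.im)⁻¹) ≤ q.im := by
    calc k * (‖q‖ * (w.im)⁻¹) ≤ w.im ^ 2 / (2 * ‖w‖) * (‖q‖ * (w.im)⁻¹) := by gcongr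
      _ = w.im / (2 * ‖q‖) := by rw [hwn]; field_simp
      _ ≤ q.im := by rw [div_le_iff₀ (by positivity)]; linarith
  have him : ∀ n, 0 ≤ (q * iter σ z n w).im := fun n => by
    obtain ⟨h1, h2, -⟩ := iter_mem (z := z) hN hσ hav hw n
    set m := iter σ z n w
    have e : (w * m).im + ‖q‖ ^ 2 * m.im = 2 * q.re * (q * m).im := by
      rw [← hq, ← Complex.normSq_eq_norm_sq, Complex.normSq_apply, sq]
      simp only [Complex.mul_im, Complex.mul_re]; ring
    have h3 : 0 ≤ 2 * q.re * (q * m).im := by rw [← e]; positivity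
    exact nonneg_of_mul_nonneg_right h3 (by positivity)
  have himB : ∀ n, (q * iter σ z n w).im ≤ ‖q‖ * (w.im)⁻¹ := fun n => by
    refine (Complex.im_le_norm _).trans ?_
    rw [norm_mul]
    exact mul_le_mul_of_nonneg_left (iter_mem hN hσ hav hw n).2.2 hqn.le
  have hyp : ∀ n, HypLE (k⁻¹ * (1 / (1 + k)) ^ n) (q * (1 + iter σ z n w))
      (q * (1 + iter σ z (n + 1) w)) := by
    intro n
    induction n with
    | zero =>
      have h1 := him 1
      have h2 := (iter_mem (z := z) hN hσ hav hw 1).2.2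
      have h0 : iter σ z 0 w = 0 := rfl
      rw [h0, zero_add, pow_zero, mul_one, add_zero, mul_one]
      refine ⟨hq2.le, ?_, ?_⟩
      · rw [mul_add, mul_one, Complex.add_im]; linarith
      · rw [mul_add, mul_one, sub_add_cancel_left, norm_neg, norm_mul, Complex.add_im]
        have h3 : ‖q‖ * ‖iter σ z 1 w‖ ≤ k⁻¹ * q.im := by
          rw [inv_mul_eq_div, le_div_iff₀ hk, mul_comm]
          exact le_trans (by gcongr) hkB
        calc (‖q‖ * ‖iter σ z 1 w‖) ^ 2 ≤ (k⁻¹ * q.im) ^ 2 := by gcongr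
          _ = (k⁻¹) ^ 2 * (q.im * q.im) := by ring
          _ ≤ _ := by gcongr; linarith
    | succ n ih =>
      have h1 : HypLE _ (q * iter σ z (n + 1) w) (q * iter σ z (n + 1 + 1) w) :=
        HypLE.selfRHS (z := z) hσ hq2 hq ih
      have h2 := h1.contract hk.le hkB hq2.le (himB _) (himB _)
      rw [mul_add, mul_add, mul_one]
      have e : k⁻¹ * (1 / (1 + k)) ^ n / (1 + k) = k⁻¹ * (1 / (1 + k)) ^ (n + 1) := by
        rw [pow_succ]; ring
      rwa [e] at h2
  have h1 : HypLE _ (q * iter σ z (n + 1) w) (q * iter σ z (n + 1 + 1) w) :=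
    HypLE.selfRHS (z := z) hσ hq2 hq (hyp n)
  have h2 := h1.sq_le
  set d := k⁻¹ * (1 / (1 + k)) ^ n with hd
  have hd0 : 0 ≤ d := by positivity
  have h3 : (‖q‖ * ‖iter σ z (n + 2) w - iter σ z (n + 1) w‖) ^ 2 ≤
      (‖q‖ * (d * (w.im)⁻¹)) ^ 2 := by
    calc _ = ‖q * iter σ z (n + 1) w - q * iter σ z (n + 1 + 1) w‖ ^ 2 := by
          rw [← norm_mul, mul_sub, norm_sub_rev]
      _ ≤ d ^ 2 * ((‖q‖ * (w.im)⁻¹) * (‖q‖ * (w.im)⁻¹)) :=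
          h2.trans (mul_le_mul_of_nonneg_left
            (mul_le_mul (himB _) (himB _) (him _) (by positivity)) (sq_nonneg _))
      _ = _ := by ring
  have h4 := (sq_le_sq₀ (by positivity) (by positivity)).1 h3
  exact le_of_mul_le_mul_left h4 hqn

/-- The self-consistent map preserves analyticity, as its denominators do not vanish on the closed
sector. -/
lemma differentiableAt_selfRHS (hw : 0 < w.im) {m : ℂ → ℂ} (hd : DifferentiableAt ℂ m w)
    (hσ : ∀ i, 0 < σ i) (hm : 0 ≤ (m w).im) (hwm : 0 ≤ (w * m w).im) :
    DifferentiableAt ℂ (fun w => selfRHS σ z w (m w)) w := by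
  simp only [selfRHS_eq]
  have ha : 0 ≤ ‖z‖ ^ 2 := by positivity
  obtain ⟨f1, f2, f3, f4, f5⟩ := im_den_facts (σ := σ) ha hw hm hwm
  have h1 : 1 + m w ≠ 0 := by
    intro h0
    have : w * m w = -w := by linear_combination w * h0
    rw [this] at hwm; simp at hwm; linarith
  have h2 : -w * (1 + m w) + ((‖z‖ ^ 2 : ℝ) : ℂ) / (1 + m w) ≠ 0 := by
    intro h0; rw [h0, Complex.zero_im] at f1; linarith
  have h3 : ∀ i, -w * (1 + σ i * (-w * (1 + m w) + ((‖z‖ ^ 2 : ℝ) : ℂ) / (1 + m w))⁻¹) +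
      ((‖z‖ ^ 2 : ℝ) : ℂ) / (1 + m w) ≠ 0 := by
    intro i h0
    have h4 := f4 i
    have h5 : 0 ≤ ‖z‖ ^ 2 * (m w).im / ‖1 + m w‖ ^ 2 := by positivity
    have h6 := mul_nonneg (hσ i).le f3
    rw [h0, Complex.zero_im] at h4
    linarith
  have d0 : DifferentiableAt ℂ (fun w : ℂ => w) w := differentiableAt_id
  have d1 : DifferentiableAt ℂ (fun w => 1 + m w) w := hd.const_add 1
  have d2 : DifferentiableAt ℂ (fun w => ((‖z‖ ^ 2 : ℝ) : ℂ) / (1 + m w)) w :=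
    (differentiableAt_const _).div d1 h1
  have d3 := ((d0.neg.mul d1).add d2).inv h2
  unfold cavg
  exact (DifferentiableAt.fun_sum fun i _ => ((((d0.neg.mul ((d3.const_mul (σ i : ℂ)).const_add
    1)).add d2).inv (h3 i)).const_mul (σ i : ℂ))).const_mul _

lemma differentiableAt_iter (hN : N ≠ 0) (hσ : ∀ i, 0 < σ i) (hav : avg σ = 1) (n : ℕ)
    (hw : 0 < w.im) : DifferentiableAt ℂ (iter σ z n) w := by
  induction n with
  | zero => exact differentiableAt_const 0
  | succ n ih =>
    obtain ⟨h1, h2, -⟩ := iter_mem (z := z) hN hσ hav hw n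
    exact differentiableAt_selfRHS hw ih hσ h1 h2

/-- The function `m₁c` exists: the iterates converge locally uniformly in the upper half plane. -/
theorem exists_isM1c (hN : N ≠ 0) (hσ : ∀ i, 0 < σ i) (hav : avg σ = 1) :
    ∃ m, IsM1c σ z m := by
  set g : ℕ → ℂ → ℂ := fun n w => iter σ z (n + 2) w - iter σ z (n + 1) w with hg
  set m : ℂ → ℂ := fun w => iter σ z 1 w + ∑' n, g n w with hm
  -- locally uniform geometric bounds
  have loc : ∀ w₀ : ℂ, 0 < w₀.im → ∃ u : ℕ → ℝ, Summable u ∧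
      ∀ n, ∀ w ∈ Metric.ball w₀ (w₀.im / 2), 0 < w.im ∧ ‖g n w‖ ≤ u n := by
    intro w₀ h₀
    set k : ℝ := (w₀.im / 2) ^ 2 / (2 * (‖w₀‖ + w₀.im)) with hk
    have hk0 : 0 < k := by positivity
    refine ⟨fun n => k⁻¹ * (1 / (1 + k)) ^ n * (w₀.im / 2)⁻¹, ?_, fun n w hw => ?_⟩
    · refine ((summable_geometric_of_lt_one (by positivity) ?_).mul_left _).mul_right _
      rw [div_lt_one (by positivity)]; linarith
    · rw [Metric.mem_ball, dist_eq_norm] at hw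
      have h1 : w₀.im / 2 ≤ w.im := by
        have := Complex.abs_im_le_norm (w - w₀)
        rw [Complex.sub_im] at this
        have := abs_le.1 this
        linarith [this.1]
      have hwi : 0 < w.im := by linarith
      have h2 : ‖w‖ ≤ ‖w₀‖ + w₀.im := by
        have := norm_le_norm_add_norm_sub' w w₀
        linarith
      have hwn : 0 < ‖w‖ := by
        have : w ≠ 0 := by rintro rfl; simp at hwi
        positivity
      refine ⟨hwi, (norm_iter_sub_le hN hσ hav hwi hk0 ?_ n).trans ?_⟩
      · rw [hk]; gcongr
      · beta_reduce; gcongr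
  have hmd : ∀ w₀ : ℂ, 0 < w₀.im → DifferentiableAt ℂ m w₀ := by
    intro w₀ h₀
    obtain ⟨u, hu, hb⟩ := loc w₀ h₀
    have h1 : DifferentiableOn ℂ (fun w => ∑' n, g n w) (Metric.ball w₀ (w₀.im / 2)) :=
      Complex.differentiableOn_tsum_of_summable_norm hu
        (fun n w hw => ((differentiableAt_iter hN hσ hav (n + 2) (hb n w hw).1).sub
          (differentiableAt_iter hN hσ hav (n + 1) (hb n w hw).1)).differentiableWithinAt)
        Metric.isOpen_ball (fun n w hw => (hb n w hw).2)
    exact (differentiableAt_iter hN hσ hav 1 h₀).add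
      (h1.differentiableAt (Metric.ball_mem_nhds _ (by positivity)))
  have hlim : ∀ w : ℂ, 0 < w.im → Tendsto (fun n => iter σ z (n + 1) w) atTop (𝓝 (m w)) := by
    intro w hw
    obtain ⟨u, hu, hb⟩ := loc w hw
    have hs : Summable fun n => g n w := Summable.of_norm_bounded hu
      fun n => (hb n w (Metric.mem_ball_self (by positivity))).2
    have h1 := hs.hasSum.tendsto_sum_nat.const_add (iter σ z 1 w)
    refine h1.congr fun n => ?_
    have := Finset.sum_range_sub (fun n => iter σ z (n + 1) w) n
    simp only [hg]
    change _ + ∑ i ∈ Finset.range n, (iter σ z (i + 1 + 1) w - iter σ z (i + 1) w) = _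
    rw [this]; ring
  have hcl : ∀ w : ℂ, 0 < w.im → 0 ≤ (m w).im ∧ 0 ≤ (w * m w).im := by
    intro w hw
    refine ⟨ge_of_tendsto ((Complex.continuous_im.tendsto _).comp (hlim w hw))
      (Eventually.of_forall fun n => (iter_mem hN hσ hav hw (n + 1)).1),
      ge_of_tendsto ((Complex.continuous_im.tendsto _).comp ((hlim w hw).const_mul w))
      (Eventually.of_forall fun n => (iter_mem hN hσ hav hw (n + 1)).2.1)⟩
  have heq : ∀ w : ℂ, 0 < w.im → m w = selfRHS σ z w (m w) := by
    intro w hw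
    have h1 : ContinuousAt (fun m' => selfRHS σ z w m') (m w) := by
      simp only [selfRHS_eq]
      have ha : 0 ≤ ‖z‖ ^ 2 := by positivity
      obtain ⟨f1, f2, f3, f4, f5⟩ := im_den_facts (σ := σ) ha hw (hcl w hw).1 (hcl w hw).2
      have h1 : 1 + m w ≠ 0 := by
        intro h0
        have h3 : w * m w = -w := by linear_combination w * h0
        have h4 := (hcl w hw).2
        rw [h3] at h4; simp at h4; linarith
      have h2 : -w * (1 + m w) + ((‖z‖ ^ 2 : ℝ) : ℂ) / (1 + m w) ≠ 0 := by
        intro h0; rw [h0, Complex.zero_im] at f1; linarith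
      have h3 : ∀ i, -w * (1 + σ i * (-w * (1 + m w) + ((‖z‖ ^ 2 : ℝ) : ℂ) / (1 + m w))⁻¹) +
          ((‖z‖ ^ 2 : ℝ) : ℂ) / (1 + m w) ≠ 0 := by
        intro i h0
        have h4 := f4 i
        have h5 : 0 ≤ ‖z‖ ^ 2 * (m w).im / ‖1 + m w‖ ^ 2 := by
          have := (hcl w hw).1; positivity
        have h6 := mul_nonneg (hσ i).le f3
        rw [h0, Complex.zero_im] at h4
        linarith
      have d1 : ContinuousAt (fun m' : ℂ => 1 + m') (m w) := by fun_prop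
      have d2 : ContinuousAt (fun m' : ℂ => ((‖z‖ ^ 2 : ℝ) : ℂ) / (1 + m')) (m w) :=
        continuousAt_const.div d1 h1
      have d3 := ((continuousAt_const (y := -w)).mul d1 |>.add d2).inv₀ h2
      refine tendsto_cavg fun i => ?_
      exact (((continuousAt_const (y := -w)).mul (continuousAt_const.add
        (continuousAt_const.mul d3)) |>.add d2).inv₀ (h3 i)).const_mul (σ i : ℂ)
    have h2 := h1.tendsto.comp (hlim w hw)
    exact tendsto_nhds_unique ((hlim w hw).comp (tendsto_add_atTop_nat 1)) h2
  have hopen : IsOpen {w : ℂ | 0 < w.im} := isOpen_lt continuous_const Complex.continuous_im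
  refine ⟨m, ?_, fun w hw => ?_, fun w hw => ?_, heq⟩
  · exact DifferentiableOn.analyticOnNhd (fun w hw => (hmd w hw).differentiableWithinAt) hopen
  · rw [heq w hw]; exact (selfRHS_mem hN hσ hav hw (hcl w hw).1 (hcl w hw).2).1
  · rw [heq w hw]; exact (selfRHS_mem hN hσ hav hw (hcl w hw).1 (hcl w hw).2).2.1

lemma Admissible.pos (h : Admissible τ σ z) (hτ : 0 < τ) (i : Fin N) : 0 < σ i :=
  hτ.trans_le (h.le_eig i)

theorem Admissible.isM1c (h : Admissible τ σ z) (hτ : 0 < τ) : IsM1c σ z (m1c σ z) := by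
  have h1 := exists_isM1c (z := z) h.ne_zero (h.pos hτ) h.avg_eq
  rw [m1c, dif_pos h1]
  exact h1.choose_spec

/-! ### The algebraic equation and the boundary values of `m₁c` -/

open Polynomial in
/-- Evaluation of a real polynomial in two variables at `(w, b)`. -/
def ev (w b : ℂ) : ℝ[X][X] →+* ℂ := eval₂RingHom ((aeval w : ℝ[X] →ₐ[ℝ] ℂ) : ℝ[X] →+* ℂ) b

open Polynomial in
lemma ev_X : ev w b X = b := by simp [ev]

open Polynomial in
lemma ev_C (p : ℝ[X]) : ev w b (C p) = aeval w p := by simp [ev]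

open Polynomial in
/-- The cubic `w² b³ - (s + a) w b² - a w b + a²` in `b`, that is, `p(√w, m)` at `m = √w b`. -/
def cubicPoly (a s : ℝ) : ℝ[X][X] :=
  C (X ^ 2) * X ^ 3 + C (-(C (s + a) * X)) * X ^ 2 + C (-(C a * X)) * X + C (C (a ^ 2))

lemma ev_cubicPoly (a s : ℝ) (w b : ℂ) : ev w b (cubicPoly a s) =
    ((a : ℂ) - w * b ^ 2) * (a - w * b) - s * (w * b ^ 2) := by
  simp only [cubicPoly, map_add, map_mul, map_pow, ev_C, ev_X, map_neg, Polynomial.aeval_C,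
    Polynomial.aeval_X, Complex.coe_algebraMap]
  ring

lemma ev_cubicPoly_eq_den (s : ℝ) (hc : (a : ℂ) - w * b ^ 2 ≠ 0) :
    ev w b (cubicPoly a s) = (a - w * b ^ 2) * den a s w b := by
  rw [ev_cubicPoly, den]; field_simp

open Polynomial in
/-- The polynomial obtained from the equation for `b = 1 + m₁` by clearing denominators. -/
def solPoly (σ : Fin N → ℝ) (a : ℝ) : ℝ[X][X] :=
  (X - C 1) * ∏ i, cubicPoly a (σ i) -
    ∑ i, C (C (σ i / N)) * (X * (C (C a) - C X * X ^ 2)) *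
      ∏ j ∈ Finset.univ.erase i, cubicPoly a (σ j)

lemma IsSol.ev_solPoly (h : IsSol σ a w b) : ev w b (solPoly σ a) = 0 := by
  have hp : ∀ i, ev w b (cubicPoly a (σ i)) ≠ 0 := fun i => by
    rw [ev_cubicPoly_eq_den _ h.c_ne]; exact mul_ne_zero h.c_ne (h.den_ne i)
  have h1 : b - 1 =
      ∑ i, ((σ i / N : ℝ) : ℂ) * (b * (a - w * b ^ 2)) / ev w b (cubicPoly a (σ i)) := by
    have h2 : b - 1 = b * cavg fun i => (σ i : ℂ) / den a (σ i) w b := by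
      rw [← h.eq_one]; have := h.b_ne; field_simp
    rw [h2, cavg, Finset.mul_sum, Finset.mul_sum]
    refine Finset.sum_congr rfl fun i _ => ?_
    rw [ev_cubicPoly_eq_den _ h.c_ne]
    have h3 := h.c_ne
    have h4 := h.den_ne i
    rw [mul_comm (a - w * b ^ 2 : ℂ), ← mul_assoc ((σ i / N : ℝ) : ℂ), mul_div_mul_right _ _ h3]
    push_cast; ring
  simp only [solPoly, map_sub, map_mul, map_sum, map_prod, ev_C, ev_X, map_one, map_pow,
    Polynomial.aeval_C, Polynomial.aeval_X, Complex.coe_algebraMap]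
  rw [h1, Finset.sum_mul, sub_eq_zero]
  refine Finset.sum_congr rfl fun i _ => ?_
  rw [← Finset.mul_prod_erase _ _ (Finset.mem_univ i)]
  have := hp i
  field_simp

open Polynomial in
/-- The leading coefficient of `solPoly` is a power of `w`; hence `solPoly` does not vanish
identically at any `w ≠ 0`. -/
lemma coeff_solPoly (σ : Fin N → ℝ) (a : ℝ) :
    (solPoly σ a).coeff (3 * N + 1) = X ^ (2 * N) := by
  have hX : (X ^ 2 : ℝ[X]) ≠ 0 := pow_ne_zero _ X_ne_zero
  have hd : ∀ s : ℝ, (cubicPoly a s).natDegree = 3 := fun s => natDegree_cubic hX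
  have hl : ∀ s : ℝ, (cubicPoly a s).leadingCoeff = X ^ 2 := fun s => leadingCoeff_cubic hX
  have h0 : ∀ s : ℝ, cubicPoly a s ≠ 0 := fun s h => by have := hd s; rw [h] at this; simp at this
  have hprod : (∏ i, cubicPoly a (σ i)).natDegree = 3 * N := by
    rw [natDegree_prod _ _ fun i _ => h0 _]; simp [hd, mul_comm]
  have hprod0 : (∏ i, cubicPoly a (σ i)) ≠ 0 := Finset.prod_ne_zero_iff.2 fun i _ => h0 _
  have h1 : ((X - C 1) * ∏ i, cubicPoly a (σ i)).coeff (3 * N + 1) = X ^ (2 * N) := by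
    have e : ((X - C 1) * ∏ i, cubicPoly a (σ i)).natDegree = 3 * N + 1 := by
      rw [natDegree_mul (X_sub_C_ne_zero 1) hprod0, natDegree_X_sub_C, hprod]; ring
    rw [← e, coeff_natDegree, leadingCoeff_mul, leadingCoeff_X_sub_C, leadingCoeff_prod]
    simp [hl, pow_mul]
  rw [solPoly, coeff_sub, h1, sub_eq_self]
  refine coeff_eq_zero_of_natDegree_lt (lt_of_le_of_lt ?_ (Nat.lt_succ_self (3 * N)))
  refine natDegree_sum_le_of_forall_le _ _ fun i _ => ?_
  have hN : 0 < N := i.pos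
  have e : (∏ j ∈ Finset.univ.erase i, cubicPoly a (σ j)).natDegree = 3 * (N - 1) := by
    rw [natDegree_prod _ _ fun i _ => h0 _]
    simp [hd, mul_comm]
  have e2 : (C (C (σ i / N)) * (X * (C (C a) - C X * X ^ 2)) : ℝ[X][X]).natDegree ≤ 3 := by
    compute_degree
  refine natDegree_mul_le.trans ?_
  rw [e]; omega

open Polynomial in
lemma ev_eq_eval_map (P : ℝ[X][X]) : ev w b P =
    (P.map ((aeval w : ℝ[X] →ₐ[ℝ] ℂ) : ℝ[X] →+* ℂ)).eval b := by
  rw [ev, coe_eval₂RingHom, eval₂_eq_eval_map]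

lemma finite_roots_solPoly (σ : Fin N → ℝ) (a : ℝ) (hw : w ≠ 0) :
    {b | ev w b (solPoly σ a) = 0}.Finite := by
  set p := (solPoly σ a).map ((Polynomial.aeval w : Polynomial ℝ →ₐ[ℝ] ℂ) : Polynomial ℝ →+* ℂ)
    with hp
  have hp0 : p ≠ 0 := by
    intro h
    have h1 : p.coeff (3 * N + 1) = w ^ (2 * N) := by
      rw [hp, Polynomial.coeff_map, coeff_solPoly]; simp
    rw [h] at h1
    exact pow_ne_zero _ hw h1.symm
  refine p.roots.toFinset.finite_toSet.subset fun b hb => ?_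
  rw [Set.mem_ofPred_eq, ev_eq_eval_map] at hb
  simpa [hp0] using hb

open Polynomial in
lemma ev_eq_sum (P : ℝ[X][X]) : ev w b P =
    ∑ i ∈ Finset.range (P.natDegree + 1), aeval w (P.coeff i) * b ^ i := by
  rw [ev, coe_eval₂RingHom, eval₂_eq_sum_range]; rfl

lemma continuous_ev (P : Polynomial (Polynomial ℝ)) :
    Continuous fun p : ℂ × ℂ => ev p.1 p.2 P := by
  simp only [ev_eq_sum]
  exact continuous_finsetSum _ fun i _ =>
    ((Polynomial.continuous_aeval _).comp continuous_fst).mul (continuous_snd.pow i)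

/-- The open upper half plane. -/
abbrev upper : Set ℂ := {w | 0 < w.im}

lemma isOpen_upper : IsOpen upper := isOpen_lt continuous_const Complex.continuous_im

lemma mem_closure_upper (x : ℝ) : (x : ℂ) ∈ closure upper := by
  rw [upper, Complex.closure_setOfPred_lt_im]; simp

lemma convex_upper : Convex ℝ upper := convex_halfSpace_im_gt 0

instance (x : ℝ) : (𝓝[upper] (x : ℂ)).NeBot :=
  mem_closure_iff_nhdsWithin_neBot.1 (mem_closure_upper x)

/-- A bounded continuous function on the upper half plane with finitely many cluster values at a
real point has a limit there: half-discs are connected. -/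
lemma exists_tendsto_of_finite_clusterPt {g : ℂ → ℂ} {x : ℝ} {B : ℝ} {S : Set ℂ}
    (hg : ContinuousOn g upper) (hB : ∀ᶠ w in 𝓝[upper] (x : ℂ), ‖g w‖ ≤ B) (hS : S.Finite)
    (hcl : ∀ s, MapClusterPt s (𝓝[upper] (x : ℂ)) g → s ∈ S) :
    ∃ s, Tendsto g (𝓝[upper] (x : ℂ)) (𝓝 s) := by
  set l := 𝓝[upper] (x : ℂ) with hl
  have hle : map g l ≤ 𝓟 (Metric.closedBall 0 B) := by
    rw [le_principal_iff]; exact hB.mono fun w hw => by simpa using hw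
  obtain ⟨s, -, hs⟩ := (isCompact_closedBall (0 : ℂ) B).exists_clusterPt hle
  refine ⟨s, ?_⟩
  obtain ⟨r, hr, hrS⟩ : ∃ r > 0, ∀ t ∈ S, t ≠ s → r < dist t s := by
    have h1 : (S \ {s})ᶜ ∈ 𝓝 s := (hS.sdiff.isClosed.isOpen_compl).mem_nhds (by simp)
    obtain ⟨r, hr, hsub⟩ := Metric.mem_nhds_iff.1 h1
    refine ⟨r / 2, by positivity, fun t ht hts => ?_⟩
    by_contra hcon
    have : t ∈ Metric.ball s r := by rw [Metric.mem_ball]; linarith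
    exact hsub this ⟨ht, hts⟩
  rw [Metric.tendsto_nhds]
  intro ε hε
  set ρ := min ε r with hρ
  have hρ0 : 0 < ρ := lt_min hε hr
  have hsph : ∀ᶠ w in l, g w ∉ Metric.sphere s ρ := by
    by_contra hcon
    have hfr : ∃ᶠ w in l, g w ∈ Metric.sphere s ρ := hcon
    obtain ⟨t, ht, htc⟩ := (isCompact_sphere s ρ).exists_mapClusterPt_of_frequently hfr
    have htS := hcl t htc
    rw [Metric.mem_sphere] at ht
    have hts : t ≠ s := by rintro rfl; simp at ht; linarith
    have := hrS t htS hts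
    have := min_le_right ε r
    linarith
  obtain ⟨δ, hδ, hsub⟩ := Metric.mem_nhdsWithin_iff.1 hsph
  set V := Metric.ball (x : ℂ) δ ∩ upper with hV
  have hVl : V ∈ l :=
    inter_mem (mem_nhdsWithin_of_mem_nhds (Metric.ball_mem_nhds _ hδ)) self_mem_nhdsWithin
  have hVc : IsPreconnected V := ((convex_ball _ _).inter convex_upper).isPreconnected
  have himg : IsPreconnected (g '' V) := hVc.image _ (hg.mono Set.inter_subset_right)
  have hcov : g '' V ⊆ Metric.ball s ρ ∪ (Metric.closedBall s ρ)ᶜ := by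
    rintro _ ⟨w, hw, rfl⟩
    have h1 : g w ∉ Metric.sphere s ρ := hsub hw
    rw [Metric.mem_sphere] at h1
    rcases lt_or_gt_of_ne h1 with h | h
    · exact Or.inl h
    · right; simpa using h
  have hne : (g '' V ∩ Metric.ball s ρ).Nonempty := by
    have := (mapClusterPt_iff_frequently.1 hs) _ (Metric.ball_mem_nhds s hρ0)
    obtain ⟨w, hw1, hw2⟩ := (this.and_eventually hVl).exists
    exact ⟨g w, ⟨w, hw2, rfl⟩, hw1⟩
  have := himg.subset_left_of_subset_union Metric.isOpen_ball
    Metric.isClosed_closedBall.isOpen_compl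
    (Set.disjoint_compl_right_iff_subset.2 Metric.ball_subset_closedBall) hcov hne
  filter_upwards [hVl] with w hw
  have := this ⟨w, hw, rfl⟩
  exact lt_of_lt_of_le this (min_le_left _ _)

/-- The function `1 + m₁c`, extended to the real axis by its limits from the upper half plane. -/
def bval (σ : Fin N → ℝ) (z : ℂ) : ℂ → ℂ := extendFrom upper fun w => 1 + m1c σ z w

lemma Admissible.isSol_upper (h : Admissible τ σ z) (hτ : 0 < τ) (hw : 0 < w.im) :
    IsSol σ (‖z‖ ^ 2) w (1 + m1c σ z w) :=
  have hm := h.isM1c hτ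
  IsSol.of_im_pos h.ne_zero (h.pos hτ) hw (hm.im_pos w hw) (hm.im_mul_pos w hw) (hm.eq w hw)

lemma Admissible.continuousOn_m1c (h : Admissible τ σ z) (hτ : 0 < τ) :
    ContinuousOn (m1c σ z) upper :=
  (h.isM1c hτ).analytic.continuousOn

/-- The limits of `m₁c` at real points other than zero exist: near such a point `m₁c` is bounded,
and its cluster values are roots of `solPoly`. -/
lemma Admissible.exists_tendsto (h : Admissible τ σ z) (hτ : 0 < τ) {x : ℝ} (hx : x ≠ 0) :
    ∃ s, Tendsto (fun w => 1 + m1c σ z w) (𝓝[upper] (x : ℂ)) (𝓝 s) := by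
  have hxc : (x : ℂ) ≠ 0 := by exact_mod_cast hx
  have hx0 : 0 < |x| := abs_pos.2 hx
  have hev : ∀ᶠ w in 𝓝[upper] (x : ℂ), |x| / 2 < ‖w‖ ∧ w ∈ upper := by
    refine Filter.Eventually.and (mem_nhdsWithin_of_mem_nhds ?_) self_mem_nhdsWithin
    refine continuous_norm.continuousAt.eventually (lt_mem_nhds ?_)
    beta_reduce; rw [Complex.norm_real, Real.norm_eq_abs]; linarith
  refine exists_tendsto_of_finite_clusterPt (B := 1 + (1 + 2 / |x|))
    (continuousOn_const.add (h.continuousOn_m1c hτ)) ?_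
    (finite_roots_solPoly σ (‖z‖ ^ 2) hxc) fun s hs => ?_
  · filter_upwards [hev] with w ⟨hw1, hw2⟩
    have h1 := (h.isSol_upper hτ hw2).norm_sub_one_le (h.pos hτ) h.avg_eq
    rw [add_sub_cancel_left] at h1
    have h2 : ‖m1c σ z w‖ ^ 2 ≤ 2 / |x| := by
      rw [le_div_iff₀ hx0]
      nlinarith [sq_nonneg ‖m1c σ z w‖]
    refine (norm_add_le _ _).trans ?_
    rw [norm_one]
    have : ‖m1c σ z w‖ ≤ 1 + 2 / |x| := by nlinarith [sq_nonneg (‖m1c σ z w‖ - 1)]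
    linarith
  · have hcont := continuous_ev (solPoly σ (‖z‖ ^ 2))
    obtain ⟨U, hU, hUs⟩ := mapClusterPt_iff_ultrafilter.1 hs
    have h1 : Tendsto (fun w : ℂ => (w, 1 + m1c σ z w)) U (𝓝 ((x : ℂ), s)) :=
      ((tendsto_id'.2 (hU.trans nhdsWithin_le_nhds)).prodMk_nhds hUs)
    have h2 := (hcont.tendsto _).comp h1
    have h3 : ∀ᶠ w in (U : Filter ℂ), ev w (1 + m1c σ z w) (solPoly σ (‖z‖ ^ 2)) = 0 :=
      mem_of_superset (hU self_mem_nhdsWithin) fun w hw => (h.isSol_upper hτ hw).ev_solPoly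
    exact tendsto_nhds_unique_of_eventuallyEq h2 tendsto_const_nhds h3

lemma Admissible.tendsto_bval (h : Admissible τ σ z) (hτ : 0 < τ) {x : ℝ} (hx : x ≠ 0) :
    Tendsto (fun w => 1 + m1c σ z w) (𝓝[upper] (x : ℂ)) (𝓝 (bval σ z x)) :=
  tendsto_extendFrom (h.exists_tendsto hτ hx)

lemma Admissible.isSol_real (h : Admissible τ σ z) (hτ : 0 < τ) {x : ℝ} (hx : x ≠ 0) :
    IsSol σ (‖z‖ ^ 2) x (bval σ z x) :=
  IsSol.of_tendsto (by positivity) hτ h.le_eig (by exact_mod_cast hx)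
    (tendsto_id'.2 nhdsWithin_le_nhds) (h.tendsto_bval hτ hx)
    (eventually_nhdsWithin_of_forall fun w hw => h.isSol_upper hτ hw)

lemma Admissible.continuousOn_bval_closed (h : Admissible τ σ z) (hτ : 0 < τ) :
    ContinuousOn (bval σ z) (upper ∪ {w | w.im = 0 ∧ w ≠ 0}) := by
  refine continuousOn_extendFrom ?_ ?_
  · rintro w (hw | ⟨hw, -⟩)
    · exact subset_closure hw
    · have : w = (w.re : ℂ) := Complex.ext rfl (by simp [hw])
      rw [this]; exact mem_closure_upper _
  · rintro w (hw | ⟨hw, hw0⟩)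
    · exact ⟨_, (continuousOn_const.add (h.continuousOn_m1c hτ)) w hw⟩
    · have e : w = (w.re : ℂ) := Complex.ext rfl (by simp [hw])
      rw [e] at hw0 ⊢
      exact h.exists_tendsto hτ (by exact_mod_cast hw0)

lemma Admissible.continuousOn_bval (h : Admissible τ σ z) (hτ : 0 < τ) :
    ContinuousOn (fun x : ℝ => bval σ z x) {0}ᶜ :=
  (h.continuousOn_bval_closed hτ).comp Complex.continuous_ofReal.continuousOn
    fun x hx => Or.inr ⟨by simp, by simpa using hx⟩

/-! ### The positivity set of the density has finitely many end points -/

lemma analyticOnNhd_ev {g : ℂ → ℂ} (hg : AnalyticOnNhd ℂ g upper)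
    (P : Polynomial (Polynomial ℝ)) : AnalyticOnNhd ℂ (fun w => ev w (g w) P) upper := by
  simp only [ev_eq_sum]
  refine Finset.analyticOnNhd_fun_sum _ fun i _ => AnalyticOnNhd.mul ?_ (hg.pow i)
  exact DifferentiableOn.analyticOnNhd (Polynomial.differentiable_aeval _).differentiableOn
    isOpen_upper

lemma eq_zero_of_aeval_upper {p : Polynomial ℝ} (hp : ∀ w ∈ upper, Polynomial.aeval w p = 0) :
    p = 0 := by
  by_contra h0
  have h1 : (upper : Set ℂ).Infinite := by
    refine Set.infinite_of_injective_forall_mem (f := fun n : ℕ => ((n : ℝ) : ℂ) + Complex.I) ?_ ?_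
    · intro m n hmn
      simpa using hmn
    · intro n; simp [upper]
  exact h1 ((p.rootSet_finite ℂ).subset fun w hw => by
    rw [Polynomial.mem_rootSet]; exact ⟨h0, hp w hw⟩)

open Polynomial in
/-- If `I` is a prime ideal of `R[X]` which meets `R` in zero only, then for some `Q ∈ I` the
derivative of `Q` divides a nonzero constant modulo `I`: one takes `Q` of least degree. -/
lemma exists_derivative_dvd {R : Type*} [CommRing R] [IsDomain R] [CharZero R] (I : Ideal R[X])
    [I.IsPrime] (hC : ∀ p : R, C p ∈ I → p = 0) {P : R[X]} (hP : P ∈ I) (hP0 : P ≠ 0) :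
    ∃ (Q A : R[X]) (r : R), r ≠ 0 ∧ Q ∈ I ∧ C r - derivative Q * A ∈ I := by
  obtain ⟨Q, ⟨hQI, hQ0⟩, hmin⟩ := WellFounded.has_min (measure (natDegree (R := R))).wf
    {P | P ∈ I ∧ P ≠ 0} ⟨P, hP, hP0⟩
  have hdeg : Q.natDegree ≠ 0 := by
    intro h
    obtain ⟨p, hp⟩ := natDegree_eq_zero.1 h
    rw [← hp] at hQI hQ0
    exact hQ0 (by rw [hC p hQI, C_0])
  have hQ' : derivative Q ∉ I := by
    intro h
    have h1 : derivative Q ≠ 0 := fun h1 => hdeg (derivative_eq_zero.1 h1)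
    exact hmin _ ⟨h, h1⟩ (natDegree_derivative_lt hdeg)
  set π := Ideal.Quotient.mkₐ R I with hπ
  have hπ0 : ∀ p, π p = 0 ↔ p ∈ I := fun p => Ideal.Quotient.eq_zero_iff_mem
  have hX : IsAlgebraic R (π X) := by
    refine ⟨P, hP0, ?_⟩
    rw [aeval_algHom_apply, aeval_X_left_apply, hπ0]
    exact hP
  have hCalg : ∀ p : R, IsAlgebraic R (π (C p)) := fun p => by
    have : π (C p) = algebraMap R (R[X] ⧸ I) p := π.commutes p
    rw [this]; exact isAlgebraic_algebraMap p
  have halg : ∀ p : R[X], IsAlgebraic R (π p) := by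
    intro p
    induction p using Polynomial.induction_on with
    | C a => exact hCalg a
    | add p q hp hq => rw [map_add]; exact hp.add hq
    | monomial n a _ =>
      rw [map_mul, map_pow]
      exact (hCalg a).mul (hX.pow _)
  have hne : π (derivative Q) ≠ 0 := fun h => hQ' ((hπ0 _).1 h)
  obtain ⟨r, hr0, y, hy⟩ := (halg (derivative Q)).exists_nonzero_dvd
    (mem_nonZeroDivisors_of_ne_zero hne)
  obtain ⟨A, rfl⟩ := Ideal.Quotient.mk_surjective y
  refine ⟨Q, A, r, hr0, hQI, ?_⟩
  rw [← hπ0, map_sub, map_mul, sub_eq_zero]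
  exact hy

open Polynomial in
/-- An analytic function `g` on the upper half plane which is algebraic over `ℝ(w)` is a root of
some `Q ∈ ℝ[w][X]` whose derivative `Q'(w, g(w))` divides a nonzero polynomial in `w` alone. -/
lemma exists_separable_relation {g : ℂ → ℂ} (hg : AnalyticOnNhd ℂ g upper) {P : ℝ[X][X]}
    (hP0 : P ≠ 0) (hP : ∀ w ∈ upper, ev w (g w) P = 0) :
    ∃ (Q A : ℝ[X][X]) (r : ℝ[X]), r ≠ 0 ∧ ∀ w ∈ upper, ev w (g w) Q = 0 ∧
      aeval w r = ev w (g w) (derivative Q) * ev w (g w) A := by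
  set I : Ideal ℝ[X][X] := RingHom.ker (RingHom.pi fun w : upper => ev w.1 (g w.1)) with hI
  have hmem : ∀ P, P ∈ I ↔ ∀ w ∈ upper, ev w (g w) P = 0 := fun P => by
    rw [hI, RingHom.mem_ker, funext_iff]
    simp [RingHom.pi_apply]
  have hprime : I.IsPrime := by
    refine ⟨fun htop => ?_, fun {p q} hpq => ?_⟩
    · have h1 : (1 : ℝ[X][X]) ∈ I := by rw [htop]; trivial
      have := (hmem 1).1 h1 Complex.I (by simp [upper])
      simp at this
    · rw [hmem] at hpq
      simp only [map_mul] at hpq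
      rcases (analyticOnNhd_ev hg p).eq_zero_or_eq_zero_of_mul_eq_zero (analyticOnNhd_ev hg q) hpq
        convex_upper.isPreconnected with h | h
      · exact Or.inl ((hmem p).2 h)
      · exact Or.inr ((hmem q).2 h)
  have hC : ∀ p : ℝ[X], C p ∈ I → p = 0 := fun p hp =>
    eq_zero_of_aeval_upper fun w hw => by have := (hmem _).1 hp w hw; rwa [ev_C] at this
  obtain ⟨Q, A, r, hr0, hQI, h1⟩ := exists_derivative_dvd I hC ((hmem P).2 hP) hP0
  refine ⟨Q, A, r, hr0, fun w hw => ⟨(hmem Q).1 hQI w hw, ?_⟩⟩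
  have h2 := (hmem _).1 h1 w hw
  rw [map_sub, map_mul, ev_C, sub_eq_zero] at h2
  exact h2

lemma ev_conj (x : ℝ) (b : ℂ) (P : Polynomial (Polynomial ℝ)) :
    ev x (starRingEnd ℂ b) P = starRingEnd ℂ (ev x b P) := by
  have h1 : ∀ p : Polynomial ℝ, starRingEnd ℂ (Polynomial.aeval (x : ℂ) p) =
      Polynomial.aeval (x : ℂ) p := fun p => by
    have : Polynomial.aeval (x : ℂ) p = ((Polynomial.aeval x p : ℝ) : ℂ) :=
      Polynomial.aeval_algebraMap_apply ℂ x p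
    rw [this, Complex.conj_ofReal]
  simp only [ev_eq_sum, map_sum, map_mul, map_pow, h1]

/-- If two distinct roots of `Q(x, ·)` collide, then the derivative of `Q` vanishes there. -/
lemma ev_derivative_eq_zero {ι : Type*} {l : Filter ι} [l.NeBot] {u v v' : ι → ℂ} {x b : ℂ}
    {Q : Polynomial (Polynomial ℝ)} (hu : Tendsto u l (𝓝 x)) (hv : Tendsto v l (𝓝 b))
    (hv' : Tendsto v' l (𝓝 b)) (hne : ∀ᶠ t in l, v t ≠ v' t)
    (h : ∀ᶠ t in l, ev (u t) (v t) Q = 0) (h' : ∀ᶠ t in l, ev (u t) (v' t) Q = 0) :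
    ev x b (Polynomial.derivative Q) = 0 := by
  set G : ℂ × ℂ → ℂ := fun p => ev p.1 p.2 Q with hG
  have hGd : ContDiff ℂ 1 G := by
    simp only [hG, ev_eq_sum]
    exact ContDiff.sum fun i _ =>
      (((Q.coeff i).contDiff_aeval 1).comp contDiff_fst).mul (contDiff_snd.pow i)
  have hs := (hGd.contDiffAt (x := (x, b))).hasStrictFDerivAt one_ne_zero
  set G' := fderiv ℂ G (x, b)
  have hd : G' (0, 1) = ev x b (Polynomial.derivative Q) := by
    have h1 : HasDerivAt (fun t => G (x, t)) (G' (0, 1)) b :=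
      hs.hasFDerivAt.comp_hasDerivAt b ((hasDerivAt_const b x).prodMk (hasDerivAt_id b))
    have h2 : HasDerivAt (fun t => G (x, t)) (ev x b (Polynomial.derivative Q)) b := by
      simp only [hG, ev_eq_eval_map, ← Polynomial.derivative_map]
      exact Polynomial.hasDerivAt _ _
    exact h1.unique h2
  have ht : Tendsto (fun t => ((u t, v t), (u t, v' t))) l (𝓝 ((x, b), (x, b))) :=
    (hu.prodMk_nhds hv).prodMk_nhds (hu.prodMk_nhds hv')
  have ho := hs.isLittleO.comp_tendsto ht
  rw [← hd]
  by_contra hcon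
  have hpos : 0 < ‖G' (0, 1)‖ := norm_pos_iff.2 hcon
  have hb := ho.def (half_pos hpos)
  obtain ⟨t, h1, h2, h3, h4⟩ := (hb.and (hne.and (h.and h'))).exists
  simp only [Function.comp_apply, hG, h3, h4, Prod.mk_sub_mk, sub_self, zero_sub, norm_neg] at h1
  have e : ((0 : ℂ), v t - v' t) = (v t - v' t) • ((0 : ℂ), (1 : ℂ)) := by simp
  rw [e, map_smul, norm_smul, norm_smul] at h1
  have h5 : 0 < ‖v t - v' t‖ := norm_pos_iff.2 (sub_ne_zero.2 h2)
  have h6 : ‖((0 : ℂ), (1 : ℂ))‖ = 1 := by simp [Prod.norm_def]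
  rw [h6] at h1
  nlinarith

/-- The part of the positive half line where the boundary value of `m₁c` is not real. -/
def bulk (σ : Fin N → ℝ) (z : ℂ) : Set ℝ := {x | 0 < x ∧ 0 < (bval σ z x).im}

lemma Admissible.isOpen_bulk (h : Admissible τ σ z) (hτ : 0 < τ) : IsOpen (bulk σ z) := by
  have h1 : ContinuousOn (fun x : ℝ => (bval σ z x).im) (Set.Ioi 0) :=
    Complex.continuous_im.comp_continuousOn
      ((h.continuousOn_bval hτ).mono fun x hx => by simpa using (ne_of_gt hx))
  exact h1.isOpen_inter_preimage isOpen_Ioi isOpen_Ioi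

lemma Admissible.tendsto_bval_real (h : Admissible τ σ z) (hτ : 0 < τ) {x : ℝ} (hx : x ≠ 0) :
    Tendsto (fun x : ℝ => bval σ z x) (𝓝 x) (𝓝 (bval σ z x)) :=
  (h.continuousOn_bval hτ).continuousAt (isOpen_compl_singleton.mem_nhds hx)

lemma solPoly_ne_zero (σ : Fin N → ℝ) (a : ℝ) : solPoly σ a ≠ 0 := fun h0 => by
  have := coeff_solPoly σ a
  rw [h0, Polynomial.coeff_zero] at this
  exact pow_ne_zero _ Polynomial.X_ne_zero this.symm

lemma Admissible.tendsto_ev (h : Admissible τ σ z) (hτ : 0 < τ) {x : ℝ} (hx : x ≠ 0)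
    (P : Polynomial (Polynomial ℝ)) : Tendsto (fun w => ev w (1 + m1c σ z w) P)
      (𝓝[upper] (x : ℂ)) (𝓝 (ev x (bval σ z x) P)) := by
  have h1 : Tendsto (fun w : ℂ => (w, 1 + m1c σ z w)) (𝓝[upper] (x : ℂ))
      (𝓝 ((x : ℂ), bval σ z x)) :=
    (tendsto_id'.2 nhdsWithin_le_nhds).prodMk_nhds (h.tendsto_bval hτ hx)
  have h2 : Tendsto (fun p : ℂ × ℂ => ev p.1 p.2 P) (𝓝 ((x : ℂ), bval σ z x))
      (𝓝 (ev x (bval σ z x) P)) := (continuous_ev P).continuousAt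
  simpa only [Function.comp_def] using h2.comp h1

lemma Admissible.exists_real_relation (h : Admissible τ σ z) (hτ : 0 < τ) :
    ∃ (Q A : Polynomial (Polynomial ℝ)) (r : Polynomial ℝ), r ≠ 0 ∧ ∀ x : ℝ, x ≠ 0 →
      ev x (bval σ z x) Q = 0 ∧ Polynomial.aeval (x : ℂ) r =
        ev x (bval σ z x) (Polynomial.derivative Q) * ev x (bval σ z x) A := by
  obtain ⟨Q, A, r, hr0, hrel⟩ := exists_separable_relation (g := fun w => 1 + m1c σ z w)
    (analyticOnNhd_const.add (h.isM1c hτ).analytic) (solPoly_ne_zero σ (‖z‖ ^ 2))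
    fun w hw => (h.isSol_upper hτ hw).ev_solPoly
  refine ⟨Q, A, r, hr0, fun x hx => ⟨?_, ?_⟩⟩
  · exact tendsto_nhds_unique_of_eventuallyEq (h.tendsto_ev hτ hx Q) tendsto_const_nhds
      (eventually_nhdsWithin_of_forall fun w hw => (hrel w hw).1)
  · exact tendsto_nhds_unique_of_eventuallyEq
      (((Polynomial.continuous_aeval r).tendsto _).mono_left nhdsWithin_le_nhds)
      ((h.tendsto_ev hτ hx _).mul (h.tendsto_ev hτ hx A))
      (eventually_nhdsWithin_of_forall fun w hw => (hrel w hw).2)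

lemma Admissible.im_eq_zero_of_notMem_bulk (h : Admissible τ σ z) (hτ : 0 < τ) {x : ℝ} (hx : 0 < x)
    (hxb : x ∉ bulk σ z) : (bval σ z x).im = 0 := by
  have h1 := (h.isSol_real hτ hx.ne').im_nonneg
  by_contra hne
  exact hxb ⟨hx, lt_of_le_of_ne h1 (Ne.symm hne)⟩

/-- The end points of the bulk are finite in number, since `m₁c` is an algebraic function: there a
solution and its complex conjugate collide. -/
lemma Admissible.finite_frontier_bulk (h : Admissible τ σ z) (hτ : 0 < τ) :
    (frontier (bulk σ z)).Finite := by
  obtain ⟨Q, A, r, hr0, hrel⟩ := h.exists_real_relation hτ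
  have hfin : (r.rootSet ℝ).Finite := r.rootSet_finite ℝ
  refine (hfin.insert 0).subset fun x hx => ?_
  rw [(h.isOpen_bulk hτ).frontier_eq] at hx
  by_cases hx0 : x = 0
  · exact Or.inl hx0
  right
  have hxpos : 0 < x := by
    have h1 : x ∈ closure (Set.Ici (0 : ℝ)) :=
      closure_mono (fun y hy => hy.1.le) hx.1
    rw [isClosed_Ici.closure_eq] at h1
    exact lt_of_le_of_ne h1 (Ne.symm hx0)
  have hreal : starRingEnd ℂ (bval σ z x) = bval σ z x :=
    Complex.conj_eq_iff_im.2 (h.im_eq_zero_of_notMem_bulk hτ hxpos hx.2)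
  have : (𝓝[bulk σ z] x).NeBot := mem_closure_iff_nhdsWithin_neBot.1 hx.1
  have hv : Tendsto (fun x : ℝ => bval σ z x) (𝓝[bulk σ z] x) (𝓝 (bval σ z x)) :=
    (h.tendsto_bval_real hτ hx0).mono_left nhdsWithin_le_nhds
  have hv' : Tendsto (fun x : ℝ => starRingEnd ℂ (bval σ z x)) (𝓝[bulk σ z] x)
      (𝓝 (bval σ z x)) := by
    have := (Complex.continuous_conj.tendsto _).comp hv
    rwa [hreal] at this
  have hd : ev x (bval σ z x) (Polynomial.derivative Q) = 0 := by
    refine ev_derivative_eq_zero (u := fun x : ℝ => (x : ℂ))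
      ((Complex.continuous_ofReal.tendsto x).mono_left nhdsWithin_le_nhds) hv hv'
      (eventually_nhdsWithin_of_forall fun y hy heq => ?_)
      (eventually_nhdsWithin_of_forall fun y hy => (hrel y hy.1.ne').1)
      (eventually_nhdsWithin_of_forall fun y hy => ?_)
    · exact hy.2.ne' (Complex.conj_eq_iff_im.1 heq.symm)
    · rw [ev_conj, (hrel y hy.1.ne').1, map_zero]
  have h1 := (hrel x hx0).2
  rw [hd, zero_mul] at h1
  have h2 : Polynomial.aeval (x : ℂ) r = ((Polynomial.aeval x r : ℝ) : ℂ) :=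
    Polynomial.aeval_algebraMap_apply ℂ x r
  rw [h2, Complex.ofReal_eq_zero] at h1
  rw [Polynomial.mem_rootSet]
  exact ⟨hr0, h1⟩

/-! ### Closed sets with finite frontier are finite unions of intervals -/

lemma exists_Ioo_inter_finite {F : Set ℝ} (hF : F.Finite) (l : ℝ) :
    ∃ p < l, ∀ x ∈ Set.Ioo p l, x ∉ F := by
  have h1 : (F \ {l})ᶜ ∈ 𝓝 l := (hF.sdiff.isClosed.isOpen_compl).mem_nhds (by simp)
  obtain ⟨p, q, ⟨hp, hq⟩, hsub⟩ := mem_nhds_iff_exists_Ioo_subset.1 h1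
  exact ⟨p, hp, fun x hx hxF => hsub ⟨hx.1, hx.2.trans hq⟩ ⟨hxF, hx.2.ne⟩⟩

lemma subset_interior_or_compl {K J : Set ℝ} (hK : IsClosed K) (hJ : IsPreconnected J)
    (hJF : ∀ x ∈ J, x ∉ frontier K) : J ⊆ interior K ∨ J ⊆ Kᶜ := by
  refine hJ.subset_or_subset isOpen_interior hK.isOpen_compl
    (Set.disjoint_left.2 fun x hx hx' => hx' (interior_subset hx)) fun x hx => ?_
  by_cases hxK : x ∈ K
  · left
    by_contra hxi
    exact hJF x hx (by rw [hK.frontier_eq]; exact ⟨hxK, hxi⟩)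
  · exact Or.inr hxK

/-- A bounded closed set of reals which is the closure of its interior and has finite frontier is
a finite union of disjoint nondegenerate intervals, listed from right to left. -/
lemma exists_edges_of_finite_frontier (n : ℕ) : ∀ K : Set ℝ, IsClosed K →
    K ⊆ closure (interior K) → Bornology.IsBounded K → (frontier K).Finite →
    (frontier K).ncard ≤ n → ∃ (L : ℕ) (e : ℕ → ℝ), StrictAntiOn e (Set.Icc 1 (2 * L)) ∧
      (∀ j ∈ Set.Icc 1 (2 * L), e j ∈ K) ∧
      K = ⋃ k ∈ Set.Icc 1 L, Set.Icc (e (2 * k)) (e (2 * k - 1)) := by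
  induction n with
  | zero =>
    intro K hK hreg hbd hfin hcard
    have h0 : frontier K = ∅ := (Set.ncard_eq_zero hfin).1 (Nat.le_zero.1 hcard)
    have hKe : K = ∅ := by
      rcases subset_interior_or_compl hK isPreconnected_univ (by simp [h0]) with h | h
      · exfalso
        have h1 : K = Set.univ := Set.eq_univ_of_univ_subset (h.trans interior_subset)
        rw [h1] at hbd
        exact NoncompactSpace.noncompact_univ (X := ℝ)
          (Metric.isCompact_of_isClosed_isBounded isClosed_univ hbd)
      · exact Set.eq_empty_of_forall_notMem fun x hx => h trivial hx
    refine ⟨0, fun _ => 0, fun i hi => ?_, fun j hj => ?_, ?_⟩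
    · exfalso; have := hi.1; have := hi.2; omega
    · exfalso; have := hj.1; have := hj.2; omega
    · rw [hKe]; ext x; simp
  | succ n ih =>
    intro K hK hreg hbd hfin hcard
    rcases K.eq_empty_or_nonempty with hKe | hne
    · exact ih K hK hreg hbd hfin (by rw [hKe]; simp)
    -- the right end point `t` and the next frontier point `l` below it
    set t := sSup K with ht
    have htK : t ∈ K := hK.csSup_mem hne hbd.bddAbove
    have htle : ∀ x ∈ K, x ≤ t := fun x hx => le_csSup hbd.bddAbove hx
    have htF : t ∈ frontier K := by
      rw [hK.frontier_eq]
      refine ⟨htK, fun hti => ?_⟩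
      obtain ⟨p, q, ⟨hp, hq⟩, hsub⟩ := mem_nhds_iff_exists_Ioo_subset.1
        (mem_interior_iff_mem_nhds.1 hti)
      have := htle ((t + q) / 2) (hsub ⟨by linarith, by linarith⟩)
      linarith
    have hSne : (frontier K ∩ Set.Iio t).Nonempty := by
      by_contra hcon
      rw [Set.not_nonempty_iff_eq_empty] at hcon
      have h1 : ∀ x ∈ Set.Iio t, x ∉ frontier K := fun x hx hxF => by
        have : x ∈ frontier K ∩ Set.Iio t := ⟨hxF, hx⟩
        rw [hcon] at this; exact this
      rcases subset_interior_or_compl hK isPreconnected_Iio h1 with h | h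
      · obtain ⟨B, hB⟩ := hbd.bddBelow
        have h2 := hB (interior_subset (h (show min (B - 1) (t - 1) ∈ Set.Iio t from
          lt_of_le_of_lt (min_le_right _ _) (sub_one_lt t))))
        have := min_le_left (B - 1) (t - 1)
        beta_reduce at h2
        linarith
      · obtain ⟨x, hx1, hx2⟩ := mem_closure_iff.1 (hreg htK) Set.univ isOpen_univ trivial
        have hxt : x ≠ t := by
          rintro rfl; rw [hK.frontier_eq] at htF; exact htF.2 hx2
        exact h (lt_of_le_of_ne (htle x (interior_subset hx2)) hxt) (interior_subset hx2)
    obtain ⟨l, ⟨hlF, hlt⟩, hlmax⟩ := Set.exists_max_image (frontier K ∩ Set.Iio t) id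
      (hfin.inter_of_left _) hSne
    have hlt : l < t := hlt
    have hlK : l ∈ K := by rw [hK.frontier_eq] at hlF; exact hlF.1
    have hmid : Set.Ioo l t ⊆ interior K := by
      rcases subset_interior_or_compl hK isPreconnected_Ioo (J := Set.Ioo l t)
        (fun x hx hxF => by have := hlmax x ⟨hxF, hx.2⟩; exact absurd this (not_le.2 hx.1))
        with h | h
      · exact h
      · exfalso
        obtain ⟨x, hx1, hx2⟩ := mem_closure_iff.1 (hreg htK) (Set.Ioi l) isOpen_Ioi hlt
        have hxt : x ≠ t := by
          rintro rfl; rw [hK.frontier_eq] at htF; exact htF.2 hx2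
        exact h ⟨hx1, lt_of_le_of_ne (htle x (interior_subset hx2)) hxt⟩ (interior_subset hx2)
    have hIcc : Set.Icc l t ⊆ K := by
      rw [← closure_Ioo hlt.ne]
      exact closure_minimal (hmid.trans interior_subset) hK
    -- a gap below `l`
    obtain ⟨p₀, hp₀, hgapF⟩ := exists_Ioo_inter_finite hfin l
    have hgap : Set.Ioo p₀ l ⊆ Kᶜ := by
      rcases subset_interior_or_compl hK isPreconnected_Ioo hgapF with h | h
      · exfalso
        rw [hK.frontier_eq] at hlF
        refine hlF.2 (mem_interior_iff_mem_nhds.2 ?_)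
        refine mem_of_superset (Ioo_mem_nhds hp₀ hlt) fun x hx => ?_
        rcases lt_or_ge x l with hxl | hxl
        · exact interior_subset (h ⟨hx.1, hxl⟩)
        · exact hIcc ⟨hxl, hx.2.le⟩
      · exact h
    set p := (p₀ + l) / 2 with hp
    have hpl : p < l := by rw [hp]; linarith
    have hpp : p₀ < p := by rw [hp]; linarith
    have hgt : ∀ x ∈ K, x < l → x < p := fun x hx hxl => by
      by_contra hcon
      exact hgap ⟨hpp.trans_le (not_lt.1 hcon), hxl⟩ hx
    set K' := K ∩ Set.Iic p with hK'
    have hlt' : ∀ x ∈ K', x < p := fun x hx => hgt x hx.1 (lt_of_le_of_lt hx.2 hpl)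
    have hint : interior K ∩ Set.Iio p ⊆ interior K' :=
      interior_maximal (fun x hx => ⟨interior_subset hx.1, (show x < p from hx.2).le⟩)
        (isOpen_interior.inter isOpen_Iio)
    have hK'c : IsClosed K' := hK.inter isClosed_Iic
    have hreg' : K' ⊆ closure (interior K') := fun x hx => by
      refine closure_mono hint ?_
      rw [mem_closure_iff]
      intro o ho hxo
      obtain ⟨y, ⟨hy1, hy2⟩, hy3⟩ := mem_closure_iff.1 (hreg hx.1) (o ∩ Set.Iio p)
        (ho.inter isOpen_Iio) ⟨hxo, hlt' x hx⟩
      exact ⟨y, hy1, hy3, hy2⟩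
    have hFsub : frontier K' ⊆ frontier K \ {t} := fun x hx => by
      rw [hK'c.frontier_eq] at hx
      rw [hK.frontier_eq]
      refine ⟨⟨hx.1.1, fun hxi => hx.2 (hint ⟨hxi, hlt' x hx.1⟩)⟩, ?_⟩
      rintro rfl
      have := hlt' _ hx.1
      linarith
    obtain ⟨L, e, he, heK, hU⟩ := ih K' hK'c hreg' (hbd.subset Set.inter_subset_left)
      (hfin.subset (hFsub.trans Set.sdiff_subset)) (by
        have h1 := Set.ncard_le_ncard hFsub hfin.sdiff
        have h2 := Set.ncard_sdiff_singleton_add_one htF hfin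
        omega)
    set e' : ℕ → ℝ := fun j => if j ≤ 1 then t else if j = 2 then l else e (j - 2) with he'
    have e1 : e' 1 = t := by simp [he']
    have e2 : e' 2 = l := by simp [he']
    have e3 : ∀ j, 3 ≤ j → e' j = e (j - 2) := fun j hj => by
      rw [he']; simp only; rw [if_neg (by omega), if_neg (by omega)]
    have hel : ∀ j ∈ Set.Icc 3 (2 * (L + 1)), e' j < l := fun j hj => by
      rw [e3 j hj.1]
      exact (hlt' _ (heK (j - 2) ⟨by have := hj.1; omega, by have := hj.2; omega⟩)).trans hpl
    refine ⟨L + 1, e', ?_, ?_, ?_⟩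
    · intro i hi j hj hij
      have hi1 := hi.1
      have hj2 := hj.2
      rcases Nat.lt_or_ge i 3 with hi3 | hi3
      · have hil : i = 1 ∨ i = 2 := by omega
        rcases Nat.lt_or_ge j 3 with hj3 | hj3
        · have : i = 1 := by omega
          have : j = 2 := by omega
          subst i j
          rw [e1, e2]; exact hlt
        · have := hel j ⟨hj3, hj2⟩
          rcases hil with rfl | rfl
          · rw [e1]; linarith
          · rw [e2]; exact this
      · rw [e3 i hi3, e3 j (by omega)]
        exact he ⟨by omega, by omega⟩ ⟨by omega, by omega⟩ (by omega)
    · intro j hj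
      have h1 := hj.1
      have h2 := hj.2
      rcases Nat.lt_or_ge j 3 with hj3 | hj3
      · have : j = 1 ∨ j = 2 := by omega
        rcases this with rfl | rfl
        · rw [e1]; exact htK
        · rw [e2]; exact hlK
      · rw [e3 j hj3]; exact (heK _ ⟨by omega, by omega⟩).1
    · have hsplit : K = K' ∪ Set.Icc l t := by
        refine Set.Subset.antisymm (fun x hx => ?_)
          (Set.union_subset Set.inter_subset_left hIcc)
        rcases lt_or_ge x l with hxl | hxl
        · exact Or.inl ⟨hx, (hgt x hx hxl).le⟩
        · exact Or.inr ⟨hxl, htle x hx⟩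
      conv_lhs => rw [hsplit, hU]
      ext x
      simp only [Set.mem_union, Set.mem_iUnion, exists_prop]
      constructor
      · rintro (⟨k, hk, hx⟩ | hx)
        · have hk1 := hk.1
          have hk2 := hk.2
          refine ⟨k + 1, ⟨by omega, by omega⟩, ?_⟩
          rw [e3 _ (by omega), e3 _ (by omega)]
          have a1 : 2 * (k + 1) - 2 = 2 * k := by omega
          have a2 : 2 * (k + 1) - 1 - 2 = 2 * k - 1 := by omega
          rwa [a1, a2]
        · exact ⟨1, ⟨le_refl _, by omega⟩, by
            rw [show 2 * 1 = 2 from rfl, show 2 - 1 = 1 from rfl, e1, e2]; exact hx⟩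
      · rintro ⟨k, hk, hx⟩
        have hk1 := hk.1
        have hk2 := hk.2
        rcases Nat.lt_or_ge k 2 with hk3 | hk3
        · have : k = 1 := by omega
          subst this
          rw [show 2 * 1 = 2 from rfl, show 2 - 1 = 1 from rfl, e1, e2] at hx
          exact Or.inr hx
        · left
          refine ⟨k - 1, ⟨by omega, by omega⟩, ?_⟩
          rw [e3 _ (by omega), e3 _ (by omega)] at hx
          have a1 : 2 * (k - 1) = 2 * k - 2 := by omega
          have a2 : 2 * k - 2 - 1 = 2 * k - 1 - 2 := by omega
          rwa [a1, a2]

/-! ### Estimates uniform in the dimension -/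

/-- The consequences of `Admissible` used in the uniform estimates, with `a` in the place of
`|z|²`. -/
structure Bounds (τ : ℝ) (σ : Fin N → ℝ) (a : ℝ) : Prop where
  pos : 0 < τ
  le_eig : ∀ i, τ ≤ σ i
  eig_le : ∀ i, σ i ≤ τ⁻¹
  avg_eq : avg σ = 1
  nonneg : 0 ≤ a
  le : a ≤ 1 + τ⁻¹

lemma Admissible.bounds (h : Admissible τ σ z) (hτ : 0 < τ) : Bounds τ σ (‖z‖ ^ 2) :=
  ⟨hτ, h.le_eig, h.eig_le, h.avg_eq, by positivity, by
    have := (abs_le.1 h.dist_le).2; linarith⟩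

lemma Bounds.eig_pos (h : Bounds τ σ a) (i : Fin N) : 0 < σ i := h.pos.trans_le (h.le_eig i)

lemma Bounds.avg_mul_le (h : Bounds τ σ a) {f : Fin N → ℝ} {k : ℝ} (hf : ∀ i, f i ≤ k) :
    avg (fun i => σ i * f i) ≤ k := by
  have h1 : avg (fun i => σ i * f i) ≤ avg (fun i => k * σ i) := avg_mono fun i => by
    rw [mul_comm k]; exact mul_le_mul_of_nonneg_left (hf i) (h.eig_pos i).le
  rwa [avg_mul_left, h.avg_eq, mul_one] at h1

lemma Bounds.avg_mul_ge (h : Bounds τ σ a) {f : Fin N → ℝ} {k : ℝ} (hf : ∀ i, k ≤ f i) :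
    k ≤ avg (fun i => σ i * f i) := by
  have h1 : avg (fun i => k * σ i) ≤ avg (fun i => σ i * f i) := avg_mono fun i => by
    rw [mul_comm k]; exact mul_le_mul_of_nonneg_left (hf i) (h.eig_pos i).le
  rwa [avg_mul_left, h.avg_eq, mul_one] at h1

/-- The norm `√|w| |b|` of `m_c = √w (1 + m₁)`. -/
def mcNorm (w b : ℂ) : ℝ := √‖w‖ * ‖b‖

lemma mcNorm_sq (w b : ℂ) : mcNorm w b ^ 2 = ‖w‖ * ‖b‖ ^ 2 := by
  rw [mcNorm, mul_pow, Real.sq_sqrt (norm_nonneg w)]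

lemma mcNorm_sq' (w b : ℂ) : mcNorm w b ^ 2 = ‖w * b ^ 2‖ := by
  rw [mcNorm_sq, norm_mul, norm_pow]

lemma mcNorm_nonneg (w b : ℂ) : 0 ≤ mcNorm w b := by unfold mcNorm; positivity

lemma norm_mul_eq_mcNorm (w b : ℂ) : ‖w * b‖ = √‖w‖ * mcNorm w b := by
  rw [mcNorm, norm_mul, ← mul_assoc, Real.mul_self_sqrt (norm_nonneg w)]

lemma IsSol.mcNorm_le (h : IsSol σ a w b) (hB : Bounds τ σ a) : mcNorm w b ≤ √‖w‖ + 1 := by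
  have h1 := h.norm_sub_one_le hB.eig_pos hB.avg_eq
  have h2 : √‖w‖ * ‖b - 1‖ ≤ 1 := by
    have : (√‖w‖ * ‖b - 1‖) ^ 2 ≤ 1 ^ 2 := by
      rw [mul_pow, Real.sq_sqrt (norm_nonneg w)]; simpa using h1
    exact (sq_le_sq₀ (by positivity) (by norm_num)).1 this
  have h3 : ‖b‖ ≤ 1 + ‖b - 1‖ := by
    have := norm_add_le 1 (b - 1); simpa using this
  have h4 := mul_le_mul_of_nonneg_left h3 (Real.sqrt_nonneg ‖w‖)
  unfold mcNorm; linarith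

lemma IsSol.sqrt_mul_mcNorm_le (h : IsSol σ a w b) (hB : Bounds τ σ a) :
    √τ * mcNorm w b ≤ ‖(a : ℂ) - w * b ^ 2‖ := by
  have h1 := h.norm_c_ge hB.pos hB.le_eig
  refine (sq_le_sq₀ (mul_nonneg (Real.sqrt_nonneg _) (mcNorm_nonneg _ _)) (norm_nonneg _)).1 ?_
  rw [mul_pow, Real.sq_sqrt hB.pos.le, mcNorm_sq]; linarith

lemma Bounds.norm_c_le (hB : Bounds τ σ a) (w b : ℂ) :
    ‖(a : ℂ) - w * b ^ 2‖ ≤ a + mcNorm w b ^ 2 := by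
  refine (norm_sub_le _ _).trans ?_
  rw [mcNorm_sq', Complex.norm_real, Real.norm_eq_abs, abs_of_nonneg hB.nonneg]

/-- The quantity `y = w b² / (a - w b²)` appearing in the denominators. -/
def yVal (a : ℝ) (w b : ℂ) : ℂ := w * b ^ 2 / (a - w * b ^ 2)

lemma den_eq (a s : ℝ) (w b : ℂ) : den a s w b = a - w * b - s * yVal a w b := rfl

lemma norm_yVal (a : ℝ) (w b : ℂ) : ‖yVal a w b‖ = mcNorm w b ^ 2 / ‖(a : ℂ) - w * b ^ 2‖ := by
  rw [yVal, norm_div, mcNorm_sq']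

lemma IsSol.norm_yVal_le (h : IsSol σ a w b) (hB : Bounds τ σ a) :
    ‖yVal a w b‖ ≤ mcNorm w b / √τ := by
  have h1 := h.sqrt_mul_mcNorm_le hB
  have hs : 0 < √τ := Real.sqrt_pos.2 hB.pos
  have hc : 0 < ‖(a : ℂ) - w * b ^ 2‖ := norm_pos_iff.2 h.c_ne
  rw [norm_yVal, div_le_div_iff₀ hc hs]
  nlinarith [mul_le_mul_of_nonneg_left h1 (mcNorm_nonneg w b)]

lemma IsSol.norm_den_le (h : IsSol σ a w b) (hB : Bounds τ σ a) {X : ℝ} (hX : ‖w‖ ≤ X)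
    (i : Fin N) : ‖den a (σ i) w b‖ ≤ a + (√X + (τ * √τ)⁻¹) * mcNorm w b := by
  have h1 := h.norm_yVal_le hB
  have hτ := hB.pos
  have h2 : ‖(σ i : ℂ) * yVal a w b‖ ≤ (τ * √τ)⁻¹ * mcNorm w b := by
    rw [norm_mul, Complex.norm_real, Real.norm_eq_abs, abs_of_pos (hB.eig_pos i)]
    calc _ ≤ τ⁻¹ * (mcNorm w b / √τ) :=
          mul_le_mul (hB.eig_le i) h1 (norm_nonneg _) (by positivity)
      _ = _ := by rw [mul_inv]; ring
  have h3 : ‖w * b‖ ≤ √X * mcNorm w b := by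
    rw [norm_mul_eq_mcNorm]
    exact mul_le_mul_of_nonneg_right (Real.sqrt_le_sqrt hX) (mcNorm_nonneg _ _)
  have h4 : ‖(a : ℂ)‖ = a := by
    rw [Complex.norm_real, Real.norm_eq_abs, abs_of_nonneg hB.nonneg]
  rw [den_eq]
  have h5 := norm_sub_le ((a : ℂ) - w * b) (σ i * yVal a w b)
  have h6 := norm_sub_le (a : ℂ) (w * b)
  linarith

lemma Bounds.avg_div_nonneg (hB : Bounds τ σ a) :
    0 ≤ avg fun i => σ i / ‖den a (σ i) w b‖ ^ 2 :=
  avg_nonneg fun i => div_nonneg (hB.eig_pos i).le (by positivity)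

/-- Convexity bounds `avg σ / |D|²` from below: `1 ≤ (avg σ / |D|²) (avg σ |D|²)`. -/
lemma IsSol.one_le_mul (h : IsSol σ a w b) (hB : Bounds τ σ a) {M : ℝ}
    (hD : ∀ i, ‖den a (σ i) w b‖ ≤ M) :
    1 ≤ (avg fun i => σ i / ‖den a (σ i) w b‖ ^ 2) * M ^ 2 := by
  have h1 : avg σ ^ 2 ≤ (avg fun i => σ i / ‖den a (σ i) w b‖ ^ 2) *
      avg fun i => σ i * ‖den a (σ i) w b‖ ^ 2 := by
    refine sq_avg_le (fun i => div_nonneg (hB.eig_pos i).le (by positivity))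
      (fun i => mul_nonneg (hB.eig_pos i).le (by positivity)) fun i => le_of_eq ?_
    have := norm_ne_zero_iff.2 (h.den_ne i)
    field_simp
  rw [hB.avg_eq, one_pow] at h1
  refine h1.trans (mul_le_mul_of_nonneg_left (hB.avg_mul_le fun i => ?_)
    (hB.avg_div_nonneg))
  exact pow_le_pow_left₀ (norm_nonneg _) (hD i) 2

/-- If `|z| < 1` stays away from zero and one, then `m_c` stays away from zero: otherwise all
denominators would be close to `a = |z|²`, and then `bound_one` contradicts `one_le_mul`. -/
lemma IsSol.sqrt_le (h : IsSol σ a w b) (hB : Bounds τ σ a) {X : ℝ} (hX : ‖w‖ ≤ X) :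
    √a * (1 - √a) ≤ (√X + (τ * √τ)⁻¹) * mcNorm w b := by
  set K := √X + (τ * √τ)⁻¹
  have hτ := hB.pos
  have hK : 0 ≤ K := by positivity
  have hn := mcNorm_nonneg w b
  have ha := hB.nonneg
  have h1 := h.one_le_mul hB (h.norm_den_le hB hX)
  have h2 : a ≤ (a + K * mcNorm w b) ^ 2 := by
    have h3 := mul_le_mul_of_nonneg_left h1 ha
    have h4 := mul_le_mul_of_nonneg_right h.bound_one (sq_nonneg (a + K * mcNorm w b))
    nlinarith
  have h5 : √a ≤ a + K * mcNorm w b := by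
    rw [← Real.sqrt_sq (by positivity : 0 ≤ a + K * mcNorm w b)]
    exact Real.sqrt_le_sqrt h2
  have := Real.mul_self_sqrt ha
  nlinarith

lemma IsSol.mcNorm_pos (h : IsSol σ a w b) (hw : w ≠ 0) : 0 < mcNorm w b :=
  mul_pos (Real.sqrt_pos.2 (norm_pos_iff.2 hw)) (norm_pos_iff.2 h.b_ne)

/-- For `|z|` small, `m_c` stays away from zero. -/
lemma exists_mcNorm_ge_of_small (hτ : 0 < τ) (X : ℝ) : ∃ a₀ : ℝ, 0 < a₀ ∧
    ∀ {N : ℕ} {σ : Fin N → ℝ} {a : ℝ} {w b : ℂ}, Bounds τ σ a → IsSol σ a w b → w ≠ 0 →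
      ‖w‖ ≤ X → a ≤ a₀ → √τ / 2 ≤ mcNorm w b := by
  set K := √X + (τ * √τ)⁻¹ with hK
  have hs : 0 < √τ := Real.sqrt_pos.2 hτ
  have hK0 : 0 < K := by positivity
  set r := min (1 / 2) (√τ / (4 * K)) with hr
  have hr0 : 0 < r := by positivity
  refine ⟨r ^ 2, by positivity, fun {N σ a w b} hB h hw hX ha => ?_⟩
  have hn := h.mcNorm_pos hw
  set n := mcNorm w b
  have h1 : √a ≤ r := by rw [← Real.sqrt_sq hr0.le]; exact Real.sqrt_le_sqrt ha
  have h2 := h.sqrt_le hB hX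
  have h3 := h.sqrt_mul_mcNorm_le hB
  have h4 := h3.trans (hB.norm_c_le w b)
  have h5 := Real.mul_self_sqrt hB.nonneg
  have h6 := Real.sqrt_nonneg a
  have r1 : r ≤ 1 / 2 := min_le_left _ _
  have r2 : r ≤ √τ / (4 * K) := min_le_right _ _
  rw [le_div_iff₀ (by positivity)] at r2
  change √a * (1 - √a) ≤ K * n at h2
  change √τ * n ≤ a + n ^ 2 at h4
  have h7 : √a ≤ 2 * K * n := by nlinarith
  have h8 : a ≤ √a * (2 * K * n) := by
    calc a = √a * √a := h5.symm
      _ ≤ _ := by gcongr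
  have h9 : √τ * n ≤ (2 * K * √a + n) * n := by nlinarith
  have h10 := le_of_mul_le_mul_right h9 hn
  nlinarith

/-- The ratio of `Im m₂` and `Im m₁` is bounded from above and below. -/
lemma exists_ratio_bounds (hτ : 0 < τ) (X : ℝ) : ∃ K : ℝ, 0 < K ∧
    ∀ {N : ℕ} {σ : Fin N → ℝ} {a : ℝ} {w b : ℂ}, Bounds τ σ a → IsSol σ a w b → w ≠ 0 →
      ‖w‖ ≤ X → mcNorm w b ^ 2 + a ≤ K * ‖(a : ℂ) - w * b ^ 2‖ ^ 2 ∧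
        ‖(a : ℂ) - w * b ^ 2‖ ^ 2 ≤ K * (mcNorm w b ^ 2 + a) := by
  obtain ⟨a₀, ha₀, hsmall⟩ := exists_mcNorm_ge_of_small hτ X
  set K₁ := (√X + 1) ^ 2 + (1 + τ⁻¹) with hK₁
  set K₂ := (1 + 4 * (1 + τ⁻¹) / τ) / τ with hK₂
  have p1 : 0 < K₁ := by positivity
  have p2 : 0 < K₂ := by positivity
  refine ⟨K₁ + K₂ + 6 / a₀ + 3 / τ, by positivity, fun {N σ a w b} hB h hw hX => ?_⟩
  set K := K₁ + K₂ + 6 / a₀ + 3 / τ with hK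
  have q1 : 0 < 6 / a₀ := by positivity
  have q2 : 0 < 3 / τ := by positivity
  have ha := hB.nonneg
  have hn := mcNorm_nonneg w b
  have h1 := hB.norm_c_le w b
  have h2 := h.mcNorm_le hB
  have h3 : mcNorm w b ^ 2 ≤ (√X + 1) ^ 2 := by
    have := Real.sqrt_le_sqrt hX
    gcongr; linarith
  have h4 : τ * mcNorm w b ^ 2 ≤ ‖(a : ℂ) - w * b ^ 2‖ ^ 2 := by
    have := h.norm_c_ge hB.pos hB.le_eig
    rw [mcNorm_sq]; linarith
  have h5 : a - mcNorm w b ^ 2 ≤ ‖(a : ℂ) - w * b ^ 2‖ := by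
    have := norm_sub_norm_le (a : ℂ) (w * b ^ 2)
    rwa [Complex.norm_real, Real.norm_eq_abs, abs_of_nonneg ha, ← mcNorm_sq'] at this
  set n := mcNorm w b
  set c := ‖(a : ℂ) - w * b ^ 2‖ with hc
  have hc0 : 0 ≤ c := norm_nonneg _
  constructor
  · have key : ∀ k, k ≤ K → n ^ 2 + a ≤ k * c ^ 2 → n ^ 2 + a ≤ K * c ^ 2 := fun k hk h =>
      h.trans (mul_le_mul_of_nonneg_right hk (by positivity))
    rcases le_total a a₀ with hs | hs
    · have h6 : √τ / 2 ≤ n := hsmall hB h hw hX hs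
      have h7 : τ / 4 ≤ n ^ 2 := by
        have := pow_le_pow_left₀ (by positivity) h6 2
        rw [div_pow, Real.sq_sqrt hτ.le] at this; linarith
      refine key K₂ (by linarith) ?_
      have h8 : a ≤ 4 * (1 + τ⁻¹) / τ * n ^ 2 := by
        calc a ≤ 1 + τ⁻¹ := hB.le
          _ = 4 * (1 + τ⁻¹) / τ * (τ / 4) := by field_simp
          _ ≤ _ := by gcongr
      calc n ^ 2 + a ≤ (1 + 4 * (1 + τ⁻¹) / τ) * n ^ 2 := by linarith
        _ = K₂ * (τ * n ^ 2) := by rw [hK₂]; field_simp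
        _ ≤ _ := by gcongr
    · rcases le_total (n ^ 2) (a / 2) with hna | hna
      · refine key (6 / a₀) (by linarith) ?_
        have h6 : a / 2 ≤ c := by linarith
        have h7 : (a / 2) ^ 2 ≤ c ^ 2 := by gcongr
        calc n ^ 2 + a ≤ 6 / a₀ * (a₀ * a / 4) := by field_simp; linarith
          _ ≤ 6 / a₀ * (a / 2) ^ 2 := by gcongr; nlinarith
          _ ≤ _ := by gcongr
      · refine key (3 / τ) (by linarith) ?_
        calc n ^ 2 + a ≤ 3 / τ * (τ * n ^ 2) := by field_simp; linarith
          _ ≤ _ := by gcongr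
  · have h6 : n ^ 2 + a ≤ K := by have := hB.le; linarith
    calc c ^ 2 ≤ (a + n ^ 2) ^ 2 := by gcongr
      _ = (n ^ 2 + a) * (n ^ 2 + a) := by ring
      _ ≤ _ := by gcongr

/-- If `|z| < 1`, then `m_c` stays away from zero. -/
lemma exists_mcNorm_ge (hτ : 0 < τ) : ∃ n₁ : ℝ, 0 < n₁ ∧
    ∀ {N : ℕ} {σ : Fin N → ℝ} {a : ℝ} {w b : ℂ}, Bounds τ σ a → IsSol σ a w b → w ≠ 0 →
      ‖w‖ ≤ 1 → a ≤ 1 - τ → n₁ ≤ mcNorm w b := by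
  obtain ⟨a₀, ha₀, hsmall⟩ := exists_mcNorm_ge_of_small hτ 1
  set K := √1 + (τ * √τ)⁻¹ with hK
  have hs : 0 < √τ := Real.sqrt_pos.2 hτ
  have hK0 : 0 < K := by positivity
  refine ⟨min (√τ / 2) (√a₀ * (τ / 2) / K), by positivity, fun {N σ a w b} hB h hw hX ha => ?_⟩
  rcases le_total a a₀ with hs | hs
  · exact (min_le_left _ _).trans (hsmall hB h hw hX hs)
  · refine (min_le_right _ _).trans ?_
    rw [div_le_iff₀ hK0, mul_comm _ K]
    refine le_trans ?_ (h.sqrt_le hB hX)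
    have h1 : √a ≤ 1 - τ / 2 := by
      rw [← Real.sqrt_sq (by have := hB.nonneg; linarith : 0 ≤ 1 - τ / 2)]
      exact Real.sqrt_le_sqrt (by nlinarith [sq_nonneg τ])
    exact mul_le_mul (Real.sqrt_le_sqrt hs) (by linarith) (by positivity) (Real.sqrt_nonneg _)

/-- The equation for `m₁` after multiplication of each summand by its conjugate denominator. -/
lemma IsSol.eq_conj (h : IsSol σ a w b) : 1 - b⁻¹ =
    (avg fun i => σ i / ‖den a (σ i) w b‖ ^ 2 : ℝ) * (a - starRingEnd ℂ (w * b)) -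
      (avg fun i => σ i ^ 2 / ‖den a (σ i) w b‖ ^ 2 : ℝ) * starRingEnd ℂ (yVal a w b) := by
  rw [h.eq_one, ← cavg_ofReal, ← cavg_ofReal, mul_comm (SelfConsistent.cavg _),
    mul_comm (SelfConsistent.cavg _), ← cavg_mul_left, ← cavg_mul_left, ← cavg_sub]
  congr 1; funext i
  have h1 := h.den_ne i
  have h2 : (‖den a (σ i) w b‖ ^ 2 : ℂ) = den a (σ i) w b * starRingEnd ℂ (den a (σ i) w b) := by
    rw [Complex.mul_conj, Complex.normSq_eq_norm_sq]; push_cast; rfl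
  have h3 : starRingEnd ℂ (den a (σ i) w b) ≠ 0 := by simpa using h1
  have h4 : starRingEnd ℂ (den a (σ i) w b) =
      a - starRingEnd ℂ (w * b) - σ i * starRingEnd ℂ (yVal a w b) := by
    rw [den_eq, map_sub, map_sub, map_mul (starRingEnd ℂ) (σ i : ℂ), Complex.conj_ofReal,
      Complex.conj_ofReal]
  push_cast
  rw [h2]
  field_simp
  rw [h4]

lemma IsSol.norm_one_sub_inv_sq_le (h : IsSol σ a w b) (hB : Bounds τ σ a) :
    ‖1 - b⁻¹‖ ^ 2 ≤ avg (fun i => σ i / ‖den a (σ i) w b‖ ^ 2) ∧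
    ‖1 - b⁻¹‖ ^ 2 ≤ avg (fun i => σ i ^ 2 / ‖den a (σ i) w b‖ ^ 2) := by
  have hN : N ≠ 0 := by
    rintro rfl
    have := hB.avg_eq
    simp [avg] at this
  rw [h.eq_one]
  have hn : ∀ i, ‖(σ i : ℂ) / den a (σ i) w b‖ = σ i / ‖den a (σ i) w b‖ := fun i => by
    rw [norm_div, Complex.norm_real, Real.norm_eq_abs, abs_of_pos (hB.eig_pos i)]
  constructor
  · have h2 := sq_avg_le (r := fun i => ‖(σ i : ℂ) / den a (σ i) w b‖) (f := σ)
      (g := fun i => σ i / ‖den a (σ i) w b‖ ^ 2)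
      (fun i => (hB.eig_pos i).le) (fun i => div_nonneg (hB.eig_pos i).le (by positivity))
      fun i => by rw [hn]; exact le_of_eq (by ring)
    rw [hB.avg_eq, one_mul] at h2
    exact (pow_le_pow_left₀ (norm_nonneg _) (norm_cavg_le _) 2).trans h2
  · have h2 := sq_avg_le (r := fun i => ‖(σ i : ℂ) / den a (σ i) w b‖) (f := fun _ => 1)
      (g := fun i => σ i ^ 2 / ‖den a (σ i) w b‖ ^ 2)
      (fun i => zero_le_one) (fun i => by positivity)
      fun i => by rw [hn]; exact le_of_eq (by ring)
    rw [avg_const hN, one_mul] at h2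
    exact (pow_le_pow_left₀ (norm_nonneg _) (norm_cavg_le _) 2).trans h2

/-- Near `w = 0` the number `y` is a nonpositive real up to an error of order `√|w|`. -/
lemma IsSol.yVal_approx (h : IsSol σ a w b) (hB : Bounds τ σ a) {n₁ : ℝ} (hn₁ : 0 < n₁)
    (hn : n₁ ≤ mcNorm w b) (hr : √‖w‖ ≤ n₁ / 2) :
    (yVal a w b).re ≤ 8 * (√‖w‖ / n₁) ∧ |(yVal a w b).im| ≤ 8 * (√‖w‖ / n₁) := by
  set r := √‖w‖
  have hr0 : 0 ≤ r := Real.sqrt_nonneg _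
  have hbn : 0 < ‖b‖ := norm_pos_iff.2 h.b_ne
  have hA2 := h.bound_two
  rw [← mcNorm_sq] at hA2
  have hwb := norm_mul_eq_mcNorm w b
  have hmc : mcNorm w b = r * ‖b‖ := rfl
  have hconj := h.eq_conj
  have hB2 := (h.norm_one_sub_inv_sq_le hB).2
  set n := mcNorm w b
  have hnpos : 0 < n := hn₁.trans_le hn
  have hA0 : 0 ≤ avg fun i => σ i / ‖den a (σ i) w b‖ ^ 2 := hB.avg_div_nonneg
  have hA1 := h.bound_one
  set A := avg fun i => σ i / ‖den a (σ i) w b‖ ^ 2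
  set B := avg fun i => σ i ^ 2 / ‖den a (σ i) w b‖ ^ 2
  set y := yVal a w b
  have hrn : r / n₁ ≤ 1 / 2 := by rw [div_le_iff₀ hn₁]; linarith
  have hrn0 : 0 ≤ r / n₁ := by positivity
  have hbinv : ‖b⁻¹‖ ≤ r / n₁ := by
    rw [norm_inv, inv_eq_one_div, div_le_div_iff₀ hbn hn₁, one_mul, ← hmc]; exact hn
  have hwbA : ‖w * b‖ * A ≤ r / n₁ := by
    have h1 : r * n * A ≤ r / n := by
      rw [le_div_iff₀ hnpos]
      calc r * n * A * n = r * (n ^ 2 * A) := by ring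
        _ ≤ r * 1 := by gcongr
        _ = r := mul_one r
    rw [hwb]
    exact h1.trans (by gcongr)
  -- the approximate equation `1 - a A + ȳ B = O(√|w|)`
  have happ : ‖((1 - a * A : ℝ) : ℂ) + B * starRingEnd ℂ y‖ ≤ 2 * (r / n₁) := by
    have h1 : ((1 - a * A : ℝ) : ℂ) + B * starRingEnd ℂ y = b⁻¹ - A * starRingEnd ℂ (w * b) := by
      push_cast; linear_combination hconj
    rw [h1]
    refine (norm_sub_le _ _).trans ?_
    rw [norm_mul, Complex.norm_real, Real.norm_eq_abs, abs_of_nonneg hA0, Complex.norm_conj]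
    linarith [mul_comm A ‖w * b‖]
  have hB4 : 1 / 4 ≤ B := by
    have h1 : 1 / 2 ≤ ‖1 - b⁻¹‖ := by
      have := norm_sub_norm_le 1 b⁻¹
      rw [norm_one] at this; linarith
    have h2 : (1 / 2) ^ 2 ≤ ‖1 - b⁻¹‖ ^ 2 := by gcongr
    linarith
  have key : ∀ t : ℝ, B * t ≤ 2 * (r / n₁) → t ≤ 8 * (r / n₁) := fun t ht => by
    rcases le_total t 0 with h0 | h0
    · linarith
    · have := mul_le_mul_of_nonneg_right hB4 h0
      linarith
  constructor
  · have h1 := (Complex.re_le_norm _).trans happ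
    rw [Complex.add_re, Complex.ofReal_re, Complex.re_ofReal_mul, Complex.conj_re] at h1
    exact key _ (by linarith)
  · have h1 := (Complex.abs_im_le_norm _).trans happ
    rw [Complex.add_im, Complex.ofReal_im, zero_add, Complex.im_ofReal_mul, Complex.conj_im,
      abs_mul, abs_neg, abs_of_nonneg (by linarith : 0 ≤ B)] at h1
    exact key _ h1

/-- If the denominators lie in a bounded part of a right half plane, then `a - w b²`, whose inverse
is the average of their inverses, has real part bounded below. -/
lemma IsSol.re_c_ge (h : IsSol σ a w b) (hB : Bounds τ σ a) {d M : ℝ} (hd0 : 0 < d)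
    (hDre : ∀ i, d ≤ (den a (σ i) w b).re) (hDM : ∀ i, ‖den a (σ i) w b‖ ≤ M) :
    d / M ^ 2 * d ^ 2 ≤ ((a : ℂ) - w * b ^ 2).re := by
  have hcpos : 0 < ‖(a : ℂ) - w * b ^ 2‖ := norm_pos_iff.2 h.c_ne
  have hN : N ≠ 0 := by
    rintro rfl
    have := hB.avg_eq
    simp [avg] at this
  have heq := h.eq_two
  set c := (a : ℂ) - w * b ^ 2 with hc
  have hcinv : d / M ^ 2 ≤ (c⁻¹).re := by
    rw [heq, cavg_re, ← avg_const hN (d / M ^ 2)]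
    refine avg_mono fun i => ?_
    rw [Complex.inv_re, Complex.normSq_eq_norm_sq]
    have h1 : 0 < ‖den a (σ i) w b‖ := norm_pos_iff.2 (h.den_ne i)
    have := hDM i
    exact div_le_div₀ (hd0.le.trans (hDre i)) (hDre i) (by positivity) (by gcongr)
  have hcinvn : ‖c⁻¹‖ ≤ d⁻¹ := by
    rw [heq, ← avg_const hN d⁻¹]
    refine (norm_cavg_le _).trans (avg_mono fun i => ?_)
    rw [norm_inv]
    exact inv_anti₀ hd0 ((hDre i).trans (Complex.re_le_norm _))
  have hdc : d ≤ ‖c‖ := by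
    rw [norm_inv] at hcinvn
    exact (inv_le_inv₀ hcpos hd0).1 hcinvn
  have h1 : c.re = (c⁻¹).re * ‖c‖ ^ 2 := by
    rw [Complex.inv_re, Complex.normSq_eq_norm_sq]; field_simp
  have h2 : 0 ≤ d / M ^ 2 := by positivity
  rw [h1]
  exact mul_le_mul hcinv (pow_le_pow_left₀ hd0.le hdc 2) (by positivity) (h2.trans hcinv)

/-- If `|z| < 1`, then near `w = 0` the square of `m_c = √w (1 + m₁)` has real part bounded away
from zero from above: up to small errors `y` is a negative real, hence so is `m_c²`. -/
lemma exists_re_le_neg (hτ : 0 < τ) : ∃ δ c : ℝ, 0 < δ ∧ 0 < c ∧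
    ∀ {N : ℕ} {σ : Fin N → ℝ} {a : ℝ} {w b : ℂ}, Bounds τ σ a → IsSol σ a w b → w ≠ 0 →
      ‖w‖ ≤ δ → a ≤ 1 - τ → (w * b ^ 2).re ≤ -c := by
  obtain ⟨n₁, hn₁, hlow⟩ := exists_mcNorm_ge hτ
  set y₁ := n₁ ^ 2 / (1 + n₁ ^ 2) with hy₁
  have hy₁0 : 0 < y₁ := by positivity
  set d := τ * y₁ / 4 with hd
  have hd0 : 0 < d := by positivity
  set M := 1 + (1 + (τ * √τ)⁻¹) * 2 with hM
  have hs : 0 < √τ := Real.sqrt_pos.2 hτ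
  have hM0 : 0 < M := by positivity
  set g := d / M ^ 2 * d ^ 2 with hg
  have hg0 : 0 < g := by positivity
  -- `η` bounds `√|w|`
  set η := min (min 1 (n₁ / 2)) (min (n₁ * (y₁ / 32)) (min (d / 2) (n₁ * (y₁ * g / 160)))) with hη
  have hη0 : 0 < η := by positivity
  have e1 : η ≤ 1 := (min_le_left _ _).trans (min_le_left _ _)
  have e2 : η ≤ n₁ / 2 := (min_le_left _ _).trans (min_le_right _ _)
  have e3 : η ≤ n₁ * (y₁ / 32) := (min_le_right _ _).trans (min_le_left _ _)
  have e4 : η ≤ d / 2 := (min_le_right _ _).trans ((min_le_right _ _).trans (min_le_left _ _))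
  have e5 : η ≤ n₁ * (y₁ * g / 160) :=
    (min_le_right _ _).trans ((min_le_right _ _).trans (min_le_right _ _))
  clear_value η
  refine ⟨η ^ 2, y₁ * g / 4, by positivity, by positivity,
    fun {N σ a w b} hB h hw hδ ha => ?_⟩
  set r := √‖w‖ with hr
  have hr0 : 0 ≤ r := Real.sqrt_nonneg _
  have hrη : r ≤ η := by rw [← Real.sqrt_sq hη0.le]; exact Real.sqrt_le_sqrt hδ
  have hw1 : ‖w‖ ≤ 1 := hδ.trans (pow_le_one₀ hη0.le e1)
  have hn := hlow hB h hw hw1 ha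
  have hn2 : mcNorm w b ≤ 2 := by have := h.mcNorm_le hB; linarith
  have hwb := norm_mul_eq_mcNorm w b
  obtain ⟨hre, him⟩ := h.yVal_approx hB hn₁ hn (by linarith)
  have hcle := hB.norm_c_le w b
  have hyn := norm_yVal a w b
  have hcpos : 0 < ‖(a : ℂ) - w * b ^ 2‖ := norm_pos_iff.2 h.c_ne
  have hDle := h.norm_den_le hB hw1
  have hfin : w * b ^ 2 = yVal a w b * (a - w * b ^ 2) := by rw [yVal, div_mul_cancel₀ _ h.c_ne]
  have hn0 := mcNorm_nonneg w b
  set n := mcNorm w b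
  have hr1 : r / n₁ ≤ y₁ / 32 := by rw [div_le_iff₀' hn₁]; linarith
  have hr2 : r / n₁ ≤ y₁ * g / 160 := by rw [div_le_iff₀' hn₁]; linarith
  set ε := r / n₁
  have ha0 := hB.nonneg
  have ha1 : a ≤ 1 := by linarith
  have hynorm : y₁ ≤ ‖yVal a w b‖ := by
    rw [hyn, hy₁, div_le_div_iff₀ (by positivity) hcpos]
    have h1 : n₁ ^ 2 ≤ n ^ 2 := by gcongr
    have h2 : ‖(a : ℂ) - w * b ^ 2‖ ≤ 1 + n ^ 2 := by linarith
    calc n₁ ^ 2 * ‖(a : ℂ) - w * b ^ 2‖ ≤ n₁ ^ 2 * (1 + n ^ 2) := by gcongr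
      _ = n₁ ^ 2 + n₁ ^ 2 * n ^ 2 := by ring
      _ ≤ n ^ 2 + n₁ ^ 2 * n ^ 2 := by gcongr
      _ = _ := by ring
  have hyre : (yVal a w b).re ≤ -(y₁ / 2) := by
    have h1 := Complex.norm_le_abs_re_add_abs_im (yVal a w b)
    rcases abs_cases (yVal a w b).re with ⟨h2, h3⟩ | ⟨h2, h3⟩ <;> linarith
  have hDre : ∀ i, d ≤ (den a (σ i) w b).re := fun i => by
    have h1 : (den a (σ i) w b).re = a - (w * b).re - σ i * (yVal a w b).re := by
      rw [den_eq, Complex.sub_re, Complex.sub_re, Complex.re_ofReal_mul, Complex.ofReal_re]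
    have h2 : (w * b).re ≤ r * 2 := by
      refine (Complex.re_le_norm _).trans ?_
      rw [hwb]; gcongr
    have h3 : τ * (y₁ / 2) ≤ σ i * (-(yVal a w b).re) :=
      mul_le_mul (hB.le_eig i) (by linarith) (by positivity) (hB.eig_pos i).le
    rw [h1]
    have : τ * (y₁ / 2) = 2 * d := by rw [hd]; ring
    linarith
  have hDM : ∀ i, ‖den a (σ i) w b‖ ≤ M := fun i => by
    refine (hDle i).trans ?_
    have h1 : (√1 + (τ * √τ)⁻¹) * n ≤ (1 + (τ * √τ)⁻¹) * 2 := by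
      rw [Real.sqrt_one]; gcongr
    rw [hM]; linarith
  have hcre := h.re_c_ge hB hd0 hDre hDM
  rw [hfin, Complex.mul_re]
  generalize (a : ℂ) - w * b ^ 2 = c at *
  generalize yVal a w b = y at *
  have hc5 : ‖c‖ ≤ 5 := by
    have : n ^ 2 ≤ 2 ^ 2 := by gcongr
    linarith
  have h1 : -(y.im * c.im) ≤ 8 * ε * 5 := by
    have h2 := neg_abs_le (y.im * c.im)
    rw [abs_mul] at h2
    have h3 : |y.im| * |c.im| ≤ 8 * ε * 5 := by
      have := (Complex.abs_im_le_norm c).trans hc5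
      gcongr
    linarith
  have h2 : y₁ / 2 * g ≤ -y.re * c.re :=
    mul_le_mul (by linarith) hcre hg0.le (by linarith)
  linarith

/-- If `|z| > 1`, then `m₁` is bounded. -/
lemma exists_norm_le_of_one_add_le (hτ : 0 < τ) : ∃ B₁ : ℝ, 0 < B₁ ∧
    ∀ {N : ℕ} {σ : Fin N → ℝ} {a : ℝ} {w b : ℂ}, Bounds τ σ a → IsSol σ a w b →
      1 + τ ≤ a → ‖b‖ ≤ B₁ := by
  set t := √(1 + τ) with ht
  have ht1 : 1 < t := by rw [ht, Real.lt_sqrt] <;> linarith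
  refine ⟨t / (t - 1), div_pos (by linarith) (by linarith), fun {N σ a w b} hB h ha => ?_⟩
  have h1 := (h.norm_one_sub_inv_sq_le hB).1
  have h2 := h.bound_one
  set A := avg fun i => σ i / ‖den a (σ i) w b‖ ^ 2
  have h3 : (t * ‖1 - b⁻¹‖) ^ 2 ≤ 1 ^ 2 := by
    rw [mul_pow, ht, Real.sq_sqrt (by linarith)]
    have ha0 := hB.nonneg
    have h4 : (1 + τ) * ‖1 - b⁻¹‖ ^ 2 ≤ a * A := by gcongr
    linarith
  have h4 : t * ‖1 - b⁻¹‖ ≤ 1 := (sq_le_sq₀ (by positivity) (by norm_num)).1 h3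
  have h5 : 1 - ‖1 - b⁻¹‖ ≤ ‖b⁻¹‖ := by
    have := norm_sub_norm_le (1 : ℂ) (1 - b⁻¹)
    rw [norm_one, sub_sub_cancel] at this; exact this
  rw [norm_inv] at h5
  have hb : 0 < ‖b‖ := norm_pos_iff.2 h.b_ne
  have h6 : t - 1 ≤ t * ‖b‖⁻¹ := by nlinarith
  rw [le_div_iff₀ (by linarith)]
  calc ‖b‖ * (t - 1) ≤ ‖b‖ * (t * ‖b‖⁻¹) := by gcongr
    _ = t := by field_simp

/-- At a real point where `m₁` is not real, comparing the equation with its conjugate gives a lower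
bound on the stability factor. -/
lemma IsSol.one_le_of_im_pos {x : ℝ} (h : IsSol σ a x b) (hB : Bounds τ σ a) (hx : 0 < x)
    (hb : 0 < b.im) : 1 ≤ ‖b‖ ^ 2 * (x * (avg fun i => σ i / ‖den a (σ i) x b‖ ^ 2) *
      (1 + 2 * a * ‖b‖ / (τ * ‖(a : ℂ) - x * b ^ 2‖ ^ 2))) := by
  set c := (a : ℂ) - x * b ^ 2 with hc
  have hcpos : 0 < ‖c‖ := norm_pos_iff.2 h.c_ne
  have hbpos : 0 < ‖b‖ := norm_pos_iff.2 h.b_ne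
  have hτ := hB.pos
  have ha := hB.nonneg
  have hyim : (yVal a x b).im = a * (2 * x * (b.re * b.im)) / ‖c‖ ^ 2 := by
    have h1 : yVal a x b = a * c⁻¹ - 1 := by
      have h0 : c ≠ 0 := h.c_ne
      rw [yVal, ← hc]; field_simp; rw [hc]; ring
    have h2 : c.im = -(2 * x * (b.re * b.im)) := by
      rw [hc, Complex.sub_im, Complex.im_ofReal_mul, sq, Complex.mul_im, Complex.ofReal_im]; ring
    rw [h1, Complex.sub_im, Complex.im_ofReal_mul, Complex.inv_im, Complex.normSq_eq_norm_sq, h2,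
      Complex.one_im]
    ring
  set A := avg fun i => σ i / ‖den a (σ i) x b‖ ^ 2 with hA
  set k := x * (1 + 2 * a * ‖b‖ / (τ * ‖c‖ ^ 2)) with hk
  have hmain : (1 - b⁻¹).im ≤ k * b.im * A := by
    rw [h.eq_one, cavg_im, hA, ← avg_mul_left]
    refine avg_mono fun i => ?_
    have h1 : (den a (σ i) x b).im = -(x * b.im + σ i * (yVal a x b).im) := by
      rw [den_eq, Complex.sub_im, Complex.sub_im, Complex.im_ofReal_mul, Complex.im_ofReal_mul,
        Complex.ofReal_im]; ring
    rw [div_eq_mul_inv, Complex.im_ofReal_mul, Complex.inv_im, Complex.normSq_eq_norm_sq, h1,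
      neg_neg]
    have h2 : σ i * (yVal a x b).im ≤ x * b.im * (2 * a * ‖b‖ / (τ * ‖c‖ ^ 2)) := by
      rw [hyim]
      calc σ i * (a * (2 * x * (b.re * b.im)) / ‖c‖ ^ 2)
          ≤ τ⁻¹ * (a * (2 * x * (‖b‖ * b.im)) / ‖c‖ ^ 2) := by
            refine (mul_le_mul_of_nonneg_left ?_ (hB.eig_pos i).le).trans
              (mul_le_mul_of_nonneg_right (hB.eig_le i) (by positivity))
            have := Complex.re_le_norm b
            gcongr
        _ = _ := by rw [mul_comm τ, ← div_div]; field_simp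
    have h3 : x * b.im + σ i * (yVal a x b).im ≤ k * b.im := by rw [hk]; linarith
    have h4 := hB.eig_pos i
    calc σ i * ((x * b.im + σ i * (yVal a x b).im) / ‖den a (σ i) x b‖ ^ 2)
        ≤ σ i * ((k * b.im) / ‖den a (σ i) x b‖ ^ 2) := by gcongr
      _ = _ := by ring
  have h5 : (1 - b⁻¹).im = b.im / ‖b‖ ^ 2 := by
    rw [Complex.sub_im, Complex.inv_im, Complex.normSq_eq_norm_sq, Complex.one_im]; ring
  rw [h5, div_le_iff₀ (by positivity)] at hmain
  have h6 : b.im * 1 ≤ b.im * (‖b‖ ^ 2 * (x * A * (1 + 2 * a * ‖b‖ / (τ * ‖c‖ ^ 2)))) := by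
    rw [hk] at hmain; linarith
  exact le_of_mul_le_mul_left h6 hb

/-- If `|z| > 1`, then the boundary values are real near zero. -/
lemma exists_im_eq_zero_near_zero (hτ : 0 < τ) : ∃ ε₀ : ℝ, 0 < ε₀ ∧
    ∀ {N : ℕ} {σ : Fin N → ℝ} {a x : ℝ} {b : ℂ}, Bounds τ σ a → IsSol σ a x b →
      1 + τ ≤ a → 0 < x → x ≤ ε₀ → b.im = 0 := by
  obtain ⟨B₁, hB₁, hbd⟩ := exists_norm_le_of_one_add_le hτ
  set k := 1 + 8 * (1 + τ⁻¹) * B₁ / τ with hk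
  have hk0 : 0 < k := by positivity
  refine ⟨min (1 / (2 * B₁ ^ 2)) (1 / (2 * B₁ ^ 2 * k)), by positivity,
    fun {N σ a x b} hB h ha hx hxε => ?_⟩
  by_contra hne
  have him : 0 < b.im := lt_of_le_of_ne h.im_nonneg (Ne.symm hne)
  have h1 := h.one_le_of_im_pos hB hx him
  have hb := hbd hB h ha
  have x1 := hxε.trans (min_le_left _ _)
  have x2 := hxε.trans (min_le_right _ _)
  rw [le_div_iff₀ (by positivity)] at x1 x2
  have hA0 : 0 ≤ avg fun i => σ i / ‖den a (σ i) x b‖ ^ 2 := hB.avg_div_nonneg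
  have hA1 := h.bound_one
  set A := avg fun i => σ i / ‖den a (σ i) x b‖ ^ 2
  have hA : A ≤ 1 := by nlinarith
  have hc : 1 / 2 ≤ ‖(a : ℂ) - x * b ^ 2‖ := by
    have h2 := norm_sub_norm_le (a : ℂ) (x * b ^ 2)
    rw [Complex.norm_real, Real.norm_eq_abs, abs_of_nonneg hB.nonneg, norm_mul, norm_pow,
      Complex.norm_real, Real.norm_eq_abs, abs_of_pos hx] at h2
    have h3 : x * ‖b‖ ^ 2 ≤ x * B₁ ^ 2 := by gcongr
    linarith
  set c := ‖(a : ℂ) - x * b ^ 2‖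
  have hcsq : (1 / 2) ^ 2 ≤ c ^ 2 := by gcongr
  have hq : 1 + 2 * a * ‖b‖ / (τ * c ^ 2) ≤ k := by
    rw [hk]
    have : 2 * a * ‖b‖ / (τ * c ^ 2) ≤ 2 * (1 + τ⁻¹) * B₁ / (τ * (1 / 2) ^ 2) := by
      have := hB.le
      have := hB.nonneg
      gcongr
    refine (add_le_add_right this 1).trans (le_of_eq ?_)
    field_simp; ring
  have ha := hB.nonneg
  have h4 : ‖b‖ ^ 2 * (x * A * (1 + 2 * a * ‖b‖ / (τ * c ^ 2))) ≤ B₁ ^ 2 * (x * 1 * k) := by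
    gcongr
  nlinarith

/-- For large `x` the boundary values are real. -/
lemma exists_im_eq_zero_large (hτ : 0 < τ) : ∃ C₀ : ℝ, 0 < C₀ ∧
    ∀ {N : ℕ} {σ : Fin N → ℝ} {a x : ℝ} {b : ℂ}, Bounds τ σ a → IsSol σ a x b →
      C₀ ≤ x → b.im = 0 := by
  set R := 1 + τ⁻¹ with hR
  have hR0 : 0 < R := by positivity
  set k := 1 + 2 * R * (3 / 2) / τ with hk
  have hk0 : 0 < k := by positivity
  refine ⟨4 + 8 * (R + 1) + 16 * (R + 2 / τ) + 64 * k, by positivity,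
    fun {N σ a x b} hB h hx => ?_⟩
  have q1 : 0 < 2 / τ := by positivity
  have hx4 : 4 ≤ x := by linarith
  have hx0 : 0 < x := by linarith
  by_contra hne
  have him : 0 < b.im := lt_of_le_of_ne h.im_nonneg (Ne.symm hne)
  have h1 := h.one_le_of_im_pos hB hx0 him
  have ha := hB.nonneg
  have haR : a ≤ R := hB.le
  have hbone := h.norm_sub_one_le hB.eig_pos hB.avg_eq
  have hxn : ‖(x : ℂ)‖ = x := by rw [Complex.norm_real, Real.norm_eq_abs, abs_of_pos hx0]
  rw [hxn] at hbone
  have hb1 : ‖b - 1‖ ≤ 1 / 2 := by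
    have : ‖b - 1‖ ^ 2 ≤ (1 / 2) ^ 2 := by nlinarith [sq_nonneg ‖b - 1‖]
    exact (sq_le_sq₀ (norm_nonneg _) (by norm_num)).1 this
  have hbl : 1 / 2 ≤ ‖b‖ := by
    have := norm_sub_norm_le (1 : ℂ) (1 - b)
    rw [norm_one, sub_sub_cancel, norm_sub_rev] at this; linarith
  have hbu : ‖b‖ ≤ 3 / 2 := by
    have := norm_add_le (1 : ℂ) (b - 1)
    rw [norm_one, add_sub_cancel] at this; linarith
  have hmc : mcNorm x b ^ 2 = x * ‖b‖ ^ 2 := by rw [mcNorm_sq, hxn]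
  have hmcl : x / 4 ≤ mcNorm x b ^ 2 := by
    rw [hmc]
    nlinarith [mul_le_mul hbl hbl (by norm_num) (norm_nonneg b)]
  have hcl : mcNorm x b ^ 2 - a ≤ ‖(a : ℂ) - x * b ^ 2‖ := by
    have := norm_sub_norm_le ((x : ℂ) * b ^ 2) a
    rwa [Complex.norm_real, Real.norm_eq_abs, abs_of_nonneg ha, ← mcNorm_sq', norm_sub_rev]
      at this
  have hy : ‖yVal a x b‖ ≤ 2 := by
    rw [norm_yVal, div_le_iff₀ (norm_pos_iff.2 h.c_ne)]; linarith
  have hD : ∀ i, x / 4 ≤ ‖den a (σ i) x b‖ := fun i => by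
    have h2 : ‖(σ i : ℂ) * yVal a x b‖ ≤ 2 / τ := by
      rw [norm_mul, Complex.norm_real, Real.norm_eq_abs, abs_of_pos (hB.eig_pos i)]
      calc _ ≤ τ⁻¹ * 2 := mul_le_mul (hB.eig_le i) hy (norm_nonneg _) (by positivity)
        _ = _ := by ring
    have h3 : x / 2 ≤ ‖(x : ℂ) * b‖ := by rw [norm_mul, hxn]; nlinarith
    have h4 : ‖(a : ℂ)‖ = a := by
      rw [Complex.norm_real, Real.norm_eq_abs, abs_of_nonneg ha]
    have h5 := norm_sub_norm_le ((x : ℂ) * b) (a - σ i * yVal a x b)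
    have h6 := norm_sub_le (a : ℂ) (σ i * yVal a x b)
    have h7 : ‖den a (σ i) x b‖ = ‖(x : ℂ) * b - (a - σ i * yVal a x b)‖ := by
      rw [den_eq, ← norm_neg]; congr 1; ring
    rw [h7]; linarith
  have hA : avg (fun i => σ i / ‖den a (σ i) x b‖ ^ 2) ≤ 16 / x ^ 2 := by
    have : (fun i => σ i / ‖den a (σ i) x b‖ ^ 2) = fun i => σ i * (1 / ‖den a (σ i) x b‖ ^ 2) := by
      funext i; ring
    rw [this]
    refine hB.avg_mul_le fun i => ?_
    have h2 : (x / 4) ^ 2 ≤ ‖den a (σ i) x b‖ ^ 2 := by have := hD i; gcongr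
    calc 1 / ‖den a (σ i) x b‖ ^ 2 ≤ 1 / (x / 4) ^ 2 := by gcongr
      _ = _ := by field_simp; norm_num
  have hA0 : 0 ≤ avg fun i => σ i / ‖den a (σ i) x b‖ ^ 2 := hB.avg_div_nonneg
  set A := avg fun i => σ i / ‖den a (σ i) x b‖ ^ 2
  have hc1 : 1 ≤ ‖(a : ℂ) - x * b ^ 2‖ := by linarith
  set c := ‖(a : ℂ) - x * b ^ 2‖
  have hq : 1 + 2 * a * ‖b‖ / (τ * c ^ 2) ≤ k := by
    rw [hk]
    have h2 : 1 ≤ c ^ 2 := one_le_pow₀ hc1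
    have h3 : 2 * a * ‖b‖ / (τ * c ^ 2) ≤ 2 * R * (3 / 2) / (τ * 1) := by gcongr
    rw [mul_one] at h3; linarith
  have h4 : ‖b‖ ^ 2 * (x * A * (1 + 2 * a * ‖b‖ / (τ * c ^ 2))) ≤
      (3 / 2) ^ 2 * (x * (16 / x ^ 2) * k) := by gcongr
  have h5 : (3 / 2 : ℝ) ^ 2 * (x * (16 / x ^ 2) * k) = 36 * k / x := by field_simp; ring
  rw [h5] at h4
  have h6 : 36 * k / x < 1 := by rw [div_lt_one hx0]; linarith
  linarith

/-! ### The densities -/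

lemma tendsto_vertical (x : ℝ) :
    Tendsto (fun η : ℝ => (x : ℂ) + η * Complex.I) (𝓝[>] 0) (𝓝[upper] (x : ℂ)) := by
  refine tendsto_nhdsWithin_iff.2 ⟨?_, eventually_nhdsWithin_of_forall fun η hη => ?_⟩
  · have h : Continuous fun η : ℝ => (x : ℂ) + η * Complex.I := by fun_prop
    have := (h.tendsto 0).mono_left (nhdsWithin_le_nhds (s := Set.Ioi (0 : ℝ)))
    simpa using this
  · simpa [upper] using hη

lemma density_eq_of_tendsto {m : ℂ → ℂ} {x : ℝ} {l : ℂ}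
    (h : Tendsto m (𝓝[upper] (x : ℂ)) (𝓝 l)) : density m x = (1 / Real.pi) * l.im := by
  have h1 : Tendsto (fun η : ℝ => (m (x + η * Complex.I)).im) (𝓝[>] 0) (𝓝 l.im) :=
    (Complex.continuous_im.tendsto l).comp (h.comp (tendsto_vertical x))
  rw [density, if_pos ⟨l.im, h1⟩, h1.limUnder_eq]

/-- The boundary value of `m₂c` at a real point. -/
def m2val (σ : Fin N → ℝ) (z : ℂ) (w : ℂ) : ℂ :=
  bval σ z w / (((‖z‖ ^ 2 : ℝ) : ℂ) - w * bval σ z w ^ 2)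

lemma Admissible.m2c_eq (h : Admissible τ σ z) (hτ : 0 < τ) (hw : 0 < w.im) :
    m2c σ z w = (1 + m1c σ z w) / (((‖z‖ ^ 2 : ℝ) : ℂ) - w * (1 + m1c σ z w) ^ 2) := by
  have h1 := (h.isSol_upper hτ hw).b_ne
  have h2 := (h.isSol_upper hτ hw).c_ne
  rw [m2c, m2Of, ← Complex.ofReal_pow]
  set b := 1 + m1c σ z w
  have e : -w * b + ((‖z‖ ^ 2 : ℝ) : ℂ) / b = (((‖z‖ ^ 2 : ℝ) : ℂ) - w * b ^ 2) / b := by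
    field_simp; ring
  rw [e, inv_div]

lemma Admissible.tendsto_m1c (h : Admissible τ σ z) (hτ : 0 < τ) {x : ℝ} (hx : x ≠ 0) :
    Tendsto (m1c σ z) (𝓝[upper] (x : ℂ)) (𝓝 (bval σ z x - 1)) := by
  simpa using (h.tendsto_bval hτ hx).sub_const 1

lemma Admissible.tendsto_m2c (h : Admissible τ σ z) (hτ : 0 < τ) {x : ℝ} (hx : x ≠ 0) :
    Tendsto (m2c σ z) (𝓝[upper] (x : ℂ)) (𝓝 (m2val σ z x)) := by
  have h1 := h.tendsto_bval hτ hx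
  have h2 := h1.div (tendsto_const_nhds.sub
    ((tendsto_id'.2 (nhdsWithin_le_nhds (s := upper))).mul (h1.pow 2))) (h.isSol_real hτ hx).c_ne
  exact h2.congr' (eventually_nhdsWithin_of_forall fun w hw => (h.m2c_eq hτ hw).symm)

lemma Admissible.rho1c_eq (h : Admissible τ σ z) (hτ : 0 < τ) {x : ℝ} (hx : x ≠ 0) :
    rho1c σ z x = (1 / Real.pi) * (bval σ z x).im := by
  rw [rho1c, density_eq_of_tendsto (h.tendsto_m1c hτ hx)]; simp

lemma Admissible.rho2c_eq (h : Admissible τ σ z) (hτ : 0 < τ) {x : ℝ} (hx : x ≠ 0) :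
    rho2c σ z x = (1 / Real.pi) * (m2val σ z x).im :=
  density_eq_of_tendsto (h.tendsto_m2c hτ hx)

lemma Admissible.mc_eq (h : Admissible τ σ z) (hτ : 0 < τ) {x : ℝ} (hx : x ≠ 0) :
    mc σ z x = (√x : ℝ) * bval σ z x := by
  have h1 : boundaryValue (m1c σ z) x = bval σ z x - 1 :=
    ((h.tendsto_m1c hτ hx).comp (tendsto_vertical x)).limUnder_eq
  rw [mc, h1, add_sub_cancel]

lemma im_m2_real (a x : ℝ) (b : ℂ) : (b / ((a : ℂ) - x * b ^ 2)).im =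
    (x * ‖b‖ ^ 2 + a) / ‖(a : ℂ) - x * b ^ 2‖ ^ 2 * b.im := by
  have h1 : ((a : ℂ) - x * b ^ 2).re = a - x * (b.re ^ 2 - b.im ^ 2) := by
    rw [Complex.sub_re, Complex.re_ofReal_mul, Complex.ofReal_re, sq b, Complex.mul_re]; ring
  have h2 : ((a : ℂ) - x * b ^ 2).im = -(x * (2 * b.re * b.im)) := by
    rw [Complex.sub_im, Complex.im_ofReal_mul, Complex.ofReal_im, sq b, Complex.mul_im]; ring
  have h3 : ‖b‖ ^ 2 = b.re ^ 2 + b.im ^ 2 := by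
    rw [← Complex.normSq_eq_norm_sq, Complex.normSq_apply]; ring
  rw [Complex.div_im, Complex.normSq_eq_norm_sq, h1, h2, h3]
  ring

/-- The ratio of the densities, whose bounds are those of `exists_ratio_bounds`. -/
lemma Admissible.rho2c_eq_mul (h : Admissible τ σ z) (hτ : 0 < τ) {x : ℝ} (hx : x ≠ 0) :
    rho2c σ z x = (x * ‖bval σ z x‖ ^ 2 + ‖z‖ ^ 2) /
      ‖((‖z‖ ^ 2 : ℝ) : ℂ) - x * bval σ z x ^ 2‖ ^ 2 * rho1c σ z x := by
  rw [h.rho2c_eq hτ hx, h.rho1c_eq hτ hx, m2val, im_m2_real]; ring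

lemma Admissible.rho1c_nonneg_of_ne (h : Admissible τ σ z) (hτ : 0 < τ) {x : ℝ} (hx : x ≠ 0) :
    0 ≤ rho1c σ z x := by
  rw [h.rho1c_eq hτ hx]
  have := (h.isSol_real hτ hx).im_nonneg
  positivity

lemma Admissible.rho1c_of_neg (h : Admissible τ σ z) (hτ : 0 < τ) {x : ℝ} (hx : x < 0) :
    rho1c σ z x = 0 := by
  have hs := h.isSol_real hτ hx.ne
  have h1 := hs.im_nonneg
  have h2 := hs.im_mul_nonneg
  rw [Complex.im_ofReal_mul, Complex.sub_im, Complex.one_im, sub_zero] at h2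
  rw [h.rho1c_eq hτ hx.ne]
  have : (bval σ z x).im = 0 := by nlinarith
  rw [this, mul_zero]

lemma Admissible.rho2c_of_neg (h : Admissible τ σ z) (hτ : 0 < τ) {x : ℝ} (hx : x < 0) :
    rho2c σ z x = 0 := by
  rw [h.rho2c_eq_mul hτ hx.ne, h.rho1c_of_neg hτ hx, mul_zero]

/-- The densities are comparable, uniformly on the half line. -/
lemma exists_comparable (hτ : 0 < τ) : ∃ K : ℝ, 0 < K ∧
    ∀ {N : ℕ} {σ : Fin N → ℝ} {z : ℂ}, Admissible τ σ z → ∀ x : ℝ, 0 < x →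
      rho2c σ z x ≤ K * rho1c σ z x ∧ rho1c σ z x ≤ K * rho2c σ z x := by
  obtain ⟨C₀, hC₀, hlarge⟩ := exists_im_eq_zero_large hτ
  obtain ⟨K, hK, hr⟩ := exists_ratio_bounds hτ C₀
  refine ⟨K, hK, fun {N σ z} h x hx => ?_⟩
  have hs := h.isSol_real hτ hx.ne'
  have hB := h.bounds hτ
  have h2 := h.rho2c_eq_mul hτ hx.ne'
  rcases le_total C₀ x with hx0 | hx0
  · have h1 : rho1c σ z x = 0 := by rw [h.rho1c_eq hτ hx.ne', hlarge hB hs hx0, mul_zero]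
    rw [h1, mul_zero] at h2
    rw [h1, h2]; simp
  · have hxn : ‖(x : ℂ)‖ = x := by rw [Complex.norm_real, Real.norm_eq_abs, abs_of_pos hx]
    obtain ⟨k1, k2⟩ := hr hB hs (by exact_mod_cast hx.ne') (by rw [hxn]; exact hx0)
    rw [mcNorm_sq, hxn] at k1 k2
    have hc : 0 < ‖((‖z‖ ^ 2 : ℝ) : ℂ) - x * bval σ z x ^ 2‖ ^ 2 :=
      pow_pos (norm_pos_iff.2 hs.c_ne) 2
    have hρ := h.rho1c_nonneg_of_ne hτ hx.ne'
    rw [h2]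
    constructor
    · exact mul_le_mul_of_nonneg_right ((div_le_iff₀ hc).2 k1) hρ
    · rw [← mul_assoc]
      refine le_mul_of_one_le_left hρ ?_
      rw [← mul_div_assoc, one_le_div hc]; exact k2

lemma Admissible.rho2c_nonneg_of_ne (h : Admissible τ σ z) (hτ : 0 < τ) {x : ℝ} (hx : x ≠ 0) :
    0 ≤ rho2c σ z x := by
  rcases lt_or_gt_of_ne hx with hx | hx
  · rw [h.rho2c_of_neg hτ hx]
  · rw [h.rho2c_eq_mul hτ hx.ne']
    have := h.rho1c_nonneg_of_ne hτ hx.ne'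
    positivity

/-- For `|z| > 1` both `m₁c` and `m₂c` have real limits at the origin. -/
lemma Admissible.tendsto_zero (h : Admissible τ σ z) (hτ : 0 < τ) (hz : 1 + τ ≤ ‖z‖ ^ 2) :
    ∃ l l' : ℝ, Tendsto (m1c σ z) (𝓝[upper] (0 : ℝ)) (𝓝 (l : ℂ)) ∧
      Tendsto (m2c σ z) (𝓝[upper] (0 : ℝ)) (𝓝 (l' : ℂ)) := by
  obtain ⟨B₁, -, hb⟩ := exists_norm_le_of_one_add_le hτ
  have hB := h.bounds hτ
  have hm2 := fun {w : ℂ} (hw : 0 < w.im) => h.m2c_eq hτ hw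
  have hs := fun {w : ℂ} (hw : 0 < w.im) => h.isSol_upper hτ hw
  set a : ℝ := ‖z‖ ^ 2
  have ha : (a : ℂ) ≠ 0 := by
    have : a ≠ 0 := by linarith
    exact_mod_cast this
  set v : ℂ → ℂ := fun w => 1 + m1c σ z w with hv
  have hw0 : Tendsto (fun w : ℂ => w) (𝓝[upper] ((0 : ℝ) : ℂ)) (𝓝 0) := by
    have : Tendsto (fun w : ℂ => w) (𝓝[upper] ((0 : ℝ) : ℂ)) (𝓝 ((0 : ℝ) : ℂ)) :=
      tendsto_id'.2 nhdsWithin_le_nhds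
    simpa only [Complex.ofReal_zero] using this
  have hbdd : IsBoundedUnder (· ≤ ·) (𝓝[upper] ((0 : ℝ) : ℂ)) (norm ∘ v) :=
    isBoundedUnder_of_eventually_le (a := B₁)
      (eventually_nhdsWithin_of_forall fun w hw => hb hB (hs hw) hz)
  have h1 : Tendsto (fun w => w * v w) (𝓝[upper] ((0 : ℝ) : ℂ)) (𝓝 0) :=
    hw0.zero_mul_isBoundedUnder_le hbdd
  have h2 : Tendsto (fun w => w * v w ^ 2) (𝓝[upper] ((0 : ℝ) : ℂ)) (𝓝 0) :=
    (h1.zero_mul_isBoundedUnder_le hbdd).congr fun w => by ring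
  have hc : Tendsto (fun w => (a : ℂ) - w * v w ^ 2) (𝓝[upper] ((0 : ℝ) : ℂ)) (𝓝 a) := by
    simpa using h2.const_sub (a : ℂ)
  have hd : ∀ i, Tendsto (fun w => den a (σ i) w (v w)) (𝓝[upper] ((0 : ℝ) : ℂ)) (𝓝 a) := by
    intro i
    have := (h1.const_sub (a : ℂ)).sub ((h2.div hc ha).const_mul (σ i : ℂ))
    simpa [den] using this
  have hinv : Tendsto (fun w => (v w)⁻¹) (𝓝[upper] ((0 : ℝ) : ℂ)) (𝓝 (1 - (a : ℂ)⁻¹)) := by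
    have h3 : Tendsto (fun w => 1 - cavg fun i => (σ i : ℂ) / den a (σ i) w (v w))
        (𝓝[upper] ((0 : ℝ) : ℂ)) (𝓝 (1 - cavg fun i => (σ i : ℂ) / a)) :=
      (tendsto_cavg fun i => tendsto_const_nhds.div (hd i) ha).const_sub 1
    have h4 : cavg (fun i => (σ i : ℂ) / a) = (a : ℂ)⁻¹ := by
      have : (fun i => (σ i : ℂ) / a) = fun i => (a : ℂ)⁻¹ * (σ i : ℂ) := by funext i; ring
      rw [this, cavg_mul_left, cavg_ofReal, hB.avg_eq]; simp
    rw [h4] at h3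
    refine h3.congr' (eventually_nhdsWithin_of_forall fun w hw => ?_)
    beta_reduce
    rw [← (hs hw).eq_one]; simp [hv]
  have hne : 1 - (a : ℂ)⁻¹ ≠ 0 := by
    have h5 : a⁻¹ < 1 := inv_lt_one_of_one_lt₀ (by linarith)
    have h6 : (1 - a⁻¹ : ℝ) ≠ 0 := by linarith
    have : ((1 - a⁻¹ : ℝ) : ℂ) ≠ 0 := by exact_mod_cast h6
    push_cast at this; exact this
  have hvl : Tendsto v (𝓝[upper] ((0 : ℝ) : ℂ)) (𝓝 (1 - (a : ℂ)⁻¹)⁻¹) := by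
    simpa using hinv.inv₀ hne
  refine ⟨(1 - a⁻¹)⁻¹ - 1, (1 - a⁻¹)⁻¹ / a, ?_, ?_⟩
  · have := hvl.sub_const 1
    push_cast
    simpa [hv] using this
  · have := hvl.div hc ha
    push_cast
    exact this.congr' (eventually_nhdsWithin_of_forall fun w hw => (hm2 hw).symm)

lemma Admissible.rho_zero (h : Admissible τ σ z) (hτ : 0 < τ) (hz : 1 + τ ≤ ‖z‖ ^ 2) :
    rho1c σ z 0 = 0 ∧ rho2c σ z 0 = 0 := by
  obtain ⟨l, l', h1, h2⟩ := h.tendsto_zero hτ hz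
  exact ⟨by rw [rho1c, density_eq_of_tendsto h1]; simp,
    by rw [rho2c, density_eq_of_tendsto h2]; simp⟩

lemma Admissible.rho1c_pos_iff (h : Admissible τ σ z) (hτ : 0 < τ) {x : ℝ} (hx : 0 < x) :
    0 < rho1c σ z x ↔ x ∈ bulk σ z := by
  have hp : 0 < 1 / Real.pi := by positivity
  rw [h.rho1c_eq hτ hx.ne', mul_pos_iff_of_pos_left hp]
  exact ⟨fun h => ⟨hx, h⟩, fun h => h.2⟩

/-! ### Behaviour at the origin -/

lemma SimWith.mono {C C' s t : ℝ} (h : SimWith C s t) (hC : 0 < C) (hCC : C ≤ C') (ht : 0 ≤ t) :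
    SimWith C' s t :=
  ⟨(mul_le_mul_of_nonneg_right (inv_anti₀ hC hCC) ht).trans h.1,
    h.2.trans (mul_le_mul_of_nonneg_right hCC ht)⟩

lemma SimWith.of_comparable {C K s s' t : ℝ} (h : SimWith C s t) (hK : 0 < K)
    (h1 : s' ≤ K * s) (h2 : s ≤ K * s') : SimWith (C * K) s' t := by
  refine ⟨?_, ?_⟩
  · rw [mul_inv, mul_comm C⁻¹, mul_assoc, inv_mul_le_iff₀ hK]
    exact h.1.trans h2
  · calc s' ≤ K * s := h1
      _ ≤ K * (C * t) := by gcongr; exact h.2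
      _ = _ := by ring

/-- It suffices to estimate the first density. -/
lemma exists_simWith_both (hτ : 0 < τ) {C : ℝ} (hC : 0 < C) : ∃ C' : ℝ, 0 < C' ∧
    ∀ {N : ℕ} {σ : Fin N → ℝ} {z : ℂ}, Admissible τ σ z → ∀ x t : ℝ, 0 < x → 0 ≤ t →
      SimWith C (rho1c σ z x) t → SimWith C' (rho1c σ z x) t ∧ SimWith C' (rho2c σ z x) t := by
  obtain ⟨K, hK, hcomp⟩ := exists_comparable hτ
  refine ⟨C * (1 + K), by positivity, fun {N σ z} h x t hx ht hs => ?_⟩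
  obtain ⟨h1, h2⟩ := hcomp h x hx
  refine ⟨hs.mono hC (by nlinarith) ht, ?_⟩
  exact (hs.of_comparable hK h1 h2).mono (by positivity) (by nlinarith) ht

/-- The upper bound for the first density, from `|w| |m₁|² ≤ 1`. -/
lemma Admissible.im_bval_le (h : Admissible τ σ z) (hτ : 0 < τ) {x : ℝ} (hx : 0 < x) :
    (bval σ z x).im ≤ 1 / √x := by
  have h1 := (h.isSol_real hτ hx.ne').norm_sub_one_le (h.pos hτ) h.avg_eq
  rw [Complex.norm_real, Real.norm_eq_abs, abs_of_pos hx] at h1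
  have hs : 0 < √x := Real.sqrt_pos.2 hx
  have h2 : (bval σ z x).im ≤ ‖bval σ z x - 1‖ := by
    have := Complex.im_le_norm (bval σ z x - 1)
    simpa using this
  refine h2.trans ?_
  rw [le_div_iff₀ hs]
  have : (‖bval σ z x - 1‖ * √x) ^ 2 ≤ 1 ^ 2 := by
    rw [mul_pow, Real.sq_sqrt hx.le]; linarith
  exact (sq_le_sq₀ (by positivity) (by norm_num)).1 this

lemma one_div_pi_le_one : 1 / Real.pi ≤ 1 := by
  rw [div_le_one Real.pi_pos]; linarith [Real.pi_gt_three]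

/-- The behaviour of the first density at the origin. -/
lemma exists_simWith_origin (hτ : 0 < τ) : ∃ C δ : ℝ, 0 < C ∧ 0 < δ ∧
    ∀ {N : ℕ} {σ : Fin N → ℝ} {z : ℂ}, Admissible τ σ z → ‖z‖ ^ 2 ≤ 1 - τ →
      ∀ x ∈ Set.Ioo 0 δ, SimWith C (rho1c σ z x) (x ^ (-(1 / 2) : ℝ)) := by
  obtain ⟨δ, c, hδ, hc, hre⟩ := exists_re_le_neg hτ
  have hsc : 0 < √c := Real.sqrt_pos.2 hc
  refine ⟨1 + Real.pi / √c, δ, by positivity, hδ, fun {N σ z} h hz x hx => ?_⟩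
  have hx0 : 0 < x := hx.1
  have hs : 0 < √x := Real.sqrt_pos.2 hx0
  have hxp : x ^ (-(1 / 2) : ℝ) = 1 / √x := by
    rw [Real.rpow_neg hx0.le, ← Real.sqrt_eq_rpow, one_div]
  have h1 := hre (h.bounds hτ) (h.isSol_real hτ hx0.ne') (by exact_mod_cast hx0.ne')
    (by rw [Complex.norm_real, Real.norm_eq_abs, abs_of_pos hx0]; exact hx.2.le) hz
  have him := (h.isSol_real hτ hx0.ne').im_nonneg
  rw [Complex.re_ofReal_mul, sq, Complex.mul_re] at h1
  have h2 : √c ≤ √x * (bval σ z x).im := by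
    rw [← Real.sqrt_sq (by positivity : 0 ≤ √x * (bval σ z x).im)]
    refine Real.sqrt_le_sqrt ?_
    rw [mul_pow, Real.sq_sqrt hx0.le]
    nlinarith [mul_nonneg hx0.le (mul_self_nonneg (bval σ z x).re)]
  rw [hxp, h.rho1c_eq hτ hx0.ne']
  have hpc : 0 < Real.pi / √c := by positivity
  constructor
  · calc (1 + Real.pi / √c)⁻¹ * (1 / √x) ≤ (Real.pi / √c)⁻¹ * (1 / √x) := by
          gcongr; linarith
      _ = 1 / Real.pi * (√c / √x) := by rw [inv_div]; ring
      _ ≤ 1 / Real.pi * (bval σ z x).im := by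
          gcongr
          rw [div_le_iff₀ hs]; linarith
  · calc 1 / Real.pi * (bval σ z x).im ≤ 1 * (1 / √x) :=
          mul_le_mul one_div_pi_le_one (h.im_bval_le hτ hx0) him (by norm_num)
      _ ≤ _ := by gcongr; linarith

/-! ### Total mass of the second density -/

lemma im_inv_line (x η : ℝ) : (((x : ℂ) + η * Complex.I)⁻¹).im = -(η / (x ^ 2 + η ^ 2)) := by
  rw [Complex.inv_im, Complex.normSq_apply]
  simp
  ring

lemma integral_poisson {η : ℝ} (hη : 0 < η) (R : ℝ) :
    ∫ x in (-R)..R, η / (x ^ 2 + η ^ 2) = 2 * Real.arctan (R / η) := by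
  have hd : ∀ x ∈ Set.uIcc (-R) R, HasDerivAt (fun x => Real.arctan (x / η))
      (η / (x ^ 2 + η ^ 2)) x := by
    intro x _
    have := ((hasDerivAt_id' x).div_const η).arctan
    convert this using 1
    field_simp
    ring
  rw [intervalIntegral.integral_eq_sub_of_hasDerivAt hd, neg_div, Real.arctan_neg]
  · ring
  · refine Continuous.intervalIntegrable ?_ _ _
    refine continuous_const.div (by fun_prop) fun x => ?_
    positivity

/-- If `m(w) = -1 / w + O(|w| ^ (-3/2))`, then the mass of `Im m` on a long horizontal segment is
close to `π`: the difference is an integral over the remaining three sides of a rectangle. -/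
lemma abs_integral_im_sub_le {m : ℂ → ℂ} (hm : DifferentiableOn ℂ m upper) {K X R η : ℝ}
    (hK : 0 ≤ K) (hR : 0 < R) (hX : X ≤ R)
    (hb : ∀ w ∈ upper, X ≤ ‖w‖ → ‖m w + w⁻¹‖ ≤ K / (‖w‖ * √‖w‖)) (hη : 0 < η) (hηR : η ≤ R) :
    |(∫ x in (-R)..R, (m (x + η * Complex.I)).im) - 2 * Real.arctan (R / η)| ≤ 4 * K / √R := by
  set g : ℂ → ℂ := fun w => m w + w⁻¹ with hg
  have hgd : DifferentiableOn ℂ g upper := by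
    refine hm.add (differentiableOn_id.inv fun w hw => ?_)
    rintro rfl
    simp at hw
  have hsq : 0 < √R := Real.sqrt_pos.2 hR
  have hgb : ∀ w ∈ upper, R ≤ ‖w‖ → ‖g w‖ ≤ K / (R * √R) := fun w hw hwR => by
    refine (hb w hw (hX.trans hwR)).trans ?_
    gcongr
  have hrect := Complex.integral_boundary_rect_eq_zero_of_differentiableOn g ⟨-R, η⟩ ⟨R, R⟩
    (hgd.mono fun w hw => by
      have := hw.2
      simp only [Set.mem_preimage, Set.uIcc_of_le hηR] at this
      exact hη.trans_le this.1)
  simp only at hrect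
  have htop : ‖∫ x in (-R)..R, g (x + R * Complex.I)‖ ≤ K / (R * √R) * (2 * R) := by
    have := intervalIntegral.norm_integral_le_of_norm_le_const (a := -R) (b := R)
      (f := fun x : ℝ => g (x + R * Complex.I)) (C := K / (R * √R)) fun x _ => ?_
    · rwa [show R - -R = 2 * R by ring, abs_of_pos (by positivity)] at this
    · refine hgb _ (by simpa [upper] using hR) ?_
      have := Complex.abs_im_le_norm ((x : ℂ) + R * Complex.I)
      simpa [abs_of_pos hR] using this
  have hside : ∀ s : ℝ, |s| = R → ‖∫ y in η..R, g (s + y * Complex.I)‖ ≤ K / (R * √R) * R := by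
    intro s hs
    have := intervalIntegral.norm_integral_le_of_norm_le_const (a := η) (b := R)
      (f := fun y : ℝ => g (s + y * Complex.I)) (C := K / (R * √R)) fun y hy => ?_
    · refine this.trans ?_
      gcongr
      rw [abs_of_nonneg (by linarith)]; linarith
    · rw [Set.uIoc_of_le hηR] at hy
      refine hgb _ (by simpa [upper] using hη.trans hy.1) ?_
      have := Complex.abs_re_le_norm ((s : ℂ) + y * Complex.I)
      simpa [hs] using this
  have hbot : ‖∫ x in (-R)..R, g (x + η * Complex.I)‖ ≤ 4 * K / √R := by
    have h1 := hside R (abs_of_pos hR)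
    have h2 := hside (-R) (by rw [abs_neg, abs_of_pos hR])
    have e : (∫ x in (-R)..R, g (x + η * Complex.I)) = (∫ x in (-R)..R, g (x + R * Complex.I))
        - Complex.I * (∫ y in η..R, g ((R : ℝ) + y * Complex.I))
        + Complex.I * (∫ y in η..R, g ((-R : ℝ) + y * Complex.I)) := by
      simp only [smul_eq_mul] at hrect
      linear_combination hrect
    rw [e]
    refine (norm_add_le _ _).trans ?_
    refine (add_le_add_left (norm_sub_le _ _) _).trans ?_
    rw [norm_mul, norm_mul, Complex.norm_I, one_mul, one_mul]
    calc _ ≤ K / (R * √R) * (2 * R) + K / (R * √R) * R + K / (R * √R) * R := by gcongr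
      _ = 4 * K / √R := by field_simp; ring
  have hcont : Continuous fun x : ℝ => g (x + η * Complex.I) :=
    hgd.continuousOn.comp_continuous (by fun_prop) fun x => by simpa [upper] using hη
  have hcm : Continuous fun x : ℝ => m (x + η * Complex.I) :=
    hm.continuousOn.comp_continuous (by fun_prop) fun x => by simpa [upper] using hη
  have him : (∫ x in (-R)..R, (g (x + η * Complex.I)).im) =
      (∫ x in (-R)..R, g (x + η * Complex.I)).im :=
    Complex.imCLM.intervalIntegral_comp_comm (hcont.intervalIntegrable _ _)
  have hsplit : (∫ x in (-R)..R, (g (x + η * Complex.I)).im) =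
      (∫ x in (-R)..R, (m (x + η * Complex.I)).im) - 2 * Real.arctan (R / η) := by
    rw [← integral_poisson hη R, ← intervalIntegral.integral_sub]
    · refine intervalIntegral.integral_congr fun x _ => ?_
      simp only [hg, Complex.add_im, im_inv_line]; ring
    · exact (Complex.continuous_im.comp hcm).intervalIntegrable _ _
    · refine Continuous.intervalIntegrable ?_ _ _
      refine continuous_const.div (by fun_prop) fun x => ?_
      positivity
  rw [← hsplit, him]
  exact (Complex.abs_im_le_norm _).trans hbot

lemma Admissible.differentiableOn_m2c (h : Admissible τ σ z) (hτ : 0 < τ) :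
    DifferentiableOn ℂ (m2c σ z) upper := by
  have h1 : DifferentiableOn ℂ (fun w => 1 + m1c σ z w) upper :=
    (h.isM1c hτ).analytic.differentiableOn.const_add 1
  have h2 : DifferentiableOn ℂ (fun w => (1 + m1c σ z w) /
      (((‖z‖ ^ 2 : ℝ) : ℂ) - w * (1 + m1c σ z w) ^ 2)) upper :=
    h1.div ((differentiableOn_const _).sub (differentiableOn_id.mul (h1.pow 2)))
      fun w hw => (h.isSol_upper hτ hw).c_ne
  exact h2.congr fun w hw => h.m2c_eq hτ hw

lemma Admissible.im_m2c_pos (h : Admissible τ σ z) (hτ : 0 < τ) (hw : 0 < w.im) :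
    0 < (m2c σ z w).im := by
  have := (im_den_facts (σ := σ) (a := ‖z‖ ^ 2) (by positivity) hw ((h.isM1c hτ).im_pos w hw).le
    ((h.isM1c hτ).im_mul_pos w hw).le).2.1
  simpa [m2c, m2Of] using this

lemma Admissible.norm_m2c_le (h : Admissible τ σ z) (hτ : 0 < τ) (hw : 0 < w.im) :
    ‖m2c σ z w‖ ≤ (√τ * √‖w‖)⁻¹ := by
  have hs := h.isSol_upper hτ hw
  have h1 := hs.sqrt_mul_mcNorm_le (h.bounds hτ)
  have hw0 : 0 < ‖w‖ := norm_pos_iff.2 (by rintro rfl; simp at hw)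
  have hb := norm_pos_iff.2 hs.b_ne
  have hc := norm_pos_iff.2 hs.c_ne
  have h3 : 0 < √τ * √‖w‖ := by positivity
  rw [h.m2c_eq hτ hw, norm_div, inv_eq_one_div, div_le_div_iff₀ hc h3]
  rw [mcNorm] at h1
  linarith

/-- The expansion `m₂ = -1 / w + O(|w| ^ (-3/2))` at infinity. -/
lemma IsSol.norm_m2_add_inv_le (h : IsSol σ a w b) (hB : Bounds τ σ a) (hw : 16 * (1 + a) ≤ ‖w‖) :
    ‖b / ((a : ℂ) - w * b ^ 2) + w⁻¹‖ ≤ 2 * (a + 2) / (‖w‖ * √‖w‖) := by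
  have ha := hB.nonneg
  have hwp : 0 < ‖w‖ := by linarith
  have hw0 := norm_pos_iff.1 hwp
  have h1 := h.norm_sub_one_le hB.eig_pos hB.avg_eq
  set r := √‖w‖ with hr
  have hr2 : ‖w‖ = r ^ 2 := (Real.sq_sqrt hwp.le).symm
  have hr0 : 0 ≤ r := Real.sqrt_nonneg _
  rw [hr2] at h1 hw ⊢
  have hr4 : 4 ≤ r := by nlinarith
  have h2 : r * ‖b - 1‖ ≤ 1 := by
    have : (r * ‖b - 1‖) ^ 2 ≤ 1 ^ 2 := by rw [mul_pow]; linarith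
    exact (sq_le_sq₀ (by positivity) (by norm_num)).1 this
  have h3 : ‖b - 1‖ ≤ 1 / 4 := by nlinarith [norm_nonneg (b - 1)]
  have h4 : ‖b‖ ≤ 5 / 4 := by
    have := norm_add_le (b - 1) 1
    rw [sub_add_cancel, norm_one] at this; linarith
  have h5 : 3 / 4 ≤ ‖b‖ := by
    have := norm_sub_norm_le (1 : ℂ) (1 - b)
    rw [sub_sub_cancel, norm_one, norm_sub_rev] at this; linarith
  have hc : r ^ 2 / 2 ≤ ‖(a : ℂ) - w * b ^ 2‖ := by
    have := norm_sub_norm_le (w * b ^ 2) (a : ℂ)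
    rw [norm_mul, norm_pow, hr2, Complex.norm_real, Real.norm_eq_abs, abs_of_nonneg ha,
      norm_sub_rev] at this
    have h6 : (3 / 4 : ℝ) ^ 2 ≤ ‖b‖ ^ 2 := by gcongr
    nlinarith
  have hcp : 0 < ‖(a : ℂ) - w * b ^ 2‖ := norm_pos_iff.2 h.c_ne
  have hnum : ‖(a : ℂ) - w * (b * (b - 1))‖ ≤ (a + 2) * r := by
    refine (norm_sub_le _ _).trans ?_
    rw [norm_mul, norm_mul, hr2, Complex.norm_real, Real.norm_eq_abs, abs_of_nonneg ha]
    have : r ^ 2 * (‖b‖ * ‖b - 1‖) ≤ 5 / 4 * r := by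
      calc r ^ 2 * (‖b‖ * ‖b - 1‖) = ‖b‖ * r * (r * ‖b - 1‖) := by ring
        _ ≤ 5 / 4 * r * 1 := by gcongr
        _ = _ := by ring
    nlinarith
  have e : b / ((a : ℂ) - w * b ^ 2) + w⁻¹ =
      ((a : ℂ) - w * (b * (b - 1))) / (w * ((a : ℂ) - w * b ^ 2)) := by
    rw [div_add' _ _ _ h.c_ne, div_eq_div_iff h.c_ne (mul_ne_zero hw0 h.c_ne)]
    linear_combination (a - w * b ^ 2) ^ 2 * (mul_inv_cancel₀ hw0)
  rw [e, norm_div, norm_mul, hr2]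
  calc _ ≤ (a + 2) * r / (r ^ 2 * (r ^ 2 / 2)) := by gcongr
    _ = _ := by field_simp

lemma norm_re_le_line (x η : ℝ) : |x| ≤ ‖(x : ℂ) + η * Complex.I‖ := by
  simpa using Complex.abs_re_le_norm ((x : ℂ) + η * Complex.I)

lemma intervalIntegrable_abs_rpow {s : ℝ} (hs : -1 < s) (p q : ℝ) :
    IntervalIntegrable (fun x : ℝ => |x| ^ s) volume p q := by
  have := (intervalIntegral.intervalIntegrable_cpow' (a := p) (b := q) (r := (s : ℂ))
    (by simpa using hs)).norm
  simpa [Complex.norm_cpow_real] using this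

lemma Admissible.tendsto_im_m2c (h : Admissible τ σ z) (hτ : 0 < τ) {x : ℝ} (hx : x ≠ 0) :
    Tendsto (fun η : ℝ => (m2c σ z (x + η * Complex.I)).im) (𝓝[>] 0)
      (𝓝 (Real.pi * rho2c σ z x)) := by
  have := (Complex.continuous_im.tendsto _).comp ((h.tendsto_m2c hτ hx).comp (tendsto_vertical x))
  rw [h.rho2c_eq hτ hx, ← mul_assoc, mul_one_div_cancel Real.pi_ne_zero, one_mul]
  exact this

lemma Admissible.abs_im_m2c_le (h : Admissible τ σ z) (hτ : 0 < τ) {x η : ℝ} (hx : x ≠ 0)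
    (hη : 0 < η) : ‖(m2c σ z (x + η * Complex.I)).im‖ ≤ (√τ)⁻¹ * |x| ^ (-(1 / 2) : ℝ) := by
  have hx' : 0 < |x| := abs_pos.2 hx
  have hsx : 0 < √|x| := Real.sqrt_pos.2 hx'
  refine (Complex.abs_im_le_norm _).trans
    ((h.norm_m2c_le hτ (by simpa using hη)).trans ?_)
  rw [mul_inv, Real.rpow_neg hx'.le, ← Real.sqrt_eq_rpow]
  gcongr
  exact norm_re_le_line x η

lemma Admissible.aestronglyMeasurable_rho2c (h : Admissible τ σ z) (hτ : 0 < τ) :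
    AEStronglyMeasurable (rho2c σ z) := by
  have hc : ContinuousOn (rho2c σ z) {0}ᶜ := by
    intro x hx
    have hx0 : x ≠ 0 := hx
    have hb := h.tendsto_bval_real hτ hx0
    have hm : Tendsto (fun x : ℝ => m2val σ z x) (𝓝 x) (𝓝 (m2val σ z x)) :=
      hb.div (tendsto_const_nhds.sub (((Complex.continuous_ofReal.tendsto x)).mul (hb.pow 2)))
        (h.isSol_real hτ hx0).c_ne
    have h2 : Tendsto (fun x : ℝ => (1 / Real.pi) * (m2val σ z x).im) (𝓝 x)
        (𝓝 ((1 / Real.pi) * (m2val σ z x).im)) :=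
      ((Complex.continuous_im.tendsto _).comp hm).const_mul _
    rw [← h.rho2c_eq hτ hx0] at h2
    refine (h2.congr' ?_).mono_left nhdsWithin_le_nhds
    filter_upwards [isOpen_compl_singleton.mem_nhds hx0] with y hy
    exact (h.rho2c_eq hτ hy).symm
  have := hc.aestronglyMeasurable (μ := volume) (measurableSet_singleton (0 : ℝ)).compl
  rwa [restrict_compl_singleton] at this

lemma Admissible.rho2c_nonneg (h : Admissible τ σ z) (hτ : 0 < τ) (x : ℝ) : 0 ≤ rho2c σ z x := by
  rcases eq_or_ne x 0 with rfl | hx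
  · rw [rho2c, density]
    split_ifs with hl
    · obtain ⟨l, hl⟩ := hl
      rw [hl.limUnder_eq]
      have : 0 ≤ l := ge_of_tendsto hl (eventually_nhdsWithin_of_forall fun η hη =>
        (h.im_m2c_pos hτ (by simpa using hη)).le)
      positivity
    · exact le_rfl
  · exact h.rho2c_nonneg_of_ne hτ hx

lemma Admissible.rho2c_le (h : Admissible τ σ z) (hτ : 0 < τ) {x : ℝ} (hx : x ≠ 0) :
    rho2c σ z x ≤ Real.pi⁻¹ * ((√τ)⁻¹ * |x| ^ (-(1 / 2) : ℝ)) := by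
  have h1 := le_of_tendsto (h.tendsto_im_m2c hτ hx) (eventually_nhdsWithin_of_forall fun η hη =>
    (le_abs_self _).trans (h.abs_im_m2c_le hτ hx hη))
  rwa [le_inv_mul_iff₀ Real.pi_pos]

/-- The total mass is the limit of `π⁻¹ ∫ Im m₂(x + iη) dx`; the bound `|m₂| ≤ (τ |w|) ^ (-1/2)`
provides an integrable majorant near the origin. -/
lemma Admissible.isProbDensity_rho2c (h : Admissible τ σ z) (hτ : 0 < τ) :
    IsProbDensity (rho2c σ z) := by
  obtain ⟨C₀, hC₀, hlarge⟩ := exists_im_eq_zero_large hτ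
  have hB := h.bounds hτ
  have hsupp : ∀ R, C₀ ≤ R → Function.support (rho2c σ z) ⊆ Set.Ioc (-R) R := by
    intro R hR x hx
    rw [Function.mem_support] at hx
    constructor
    · by_contra hlt
      exact hx (h.rho2c_of_neg hτ (by linarith))
    · by_contra hlt
      have hxR : C₀ ≤ x := by linarith
      have hx0 : x ≠ 0 := by linarith
      refine hx ?_
      rw [h.rho2c_eq_mul hτ hx0, h.rho1c_eq hτ hx0, hlarge hB (h.isSol_real hτ hx0) hxR,
        mul_zero, mul_zero]
  have hbound : ∀ p q : ℝ,
      IntervalIntegrable (fun x : ℝ => (√τ)⁻¹ * |x| ^ (-(1 / 2) : ℝ)) volume p q := fun p q =>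
    (intervalIntegrable_abs_rpow (by norm_num) p q).const_mul _
  have hint : Integrable (rho2c σ z) := by
    rw [← integrableOn_iff_integrable_of_support_subset (hsupp C₀ le_rfl),
      ← intervalIntegrable_iff_integrableOn_Ioc_of_le (by linarith)]
    refine ((hbound _ _).const_mul Real.pi⁻¹).mono_fun'
      (h.aestronglyMeasurable_rho2c hτ).restrict ?_
    have h0 : ∀ᵐ x : ℝ, x ≠ 0 := by simp [ae_iff]
    filter_upwards [ae_restrict_of_ae h0] with x hx
    rw [Real.norm_eq_abs, abs_of_nonneg (h.rho2c_nonneg hτ x)]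
    exact h.rho2c_le hτ hx
  refine ⟨h.rho2c_nonneg hτ, hint, ?_⟩
  set K := 2 * (‖z‖ ^ 2 + 2) with hK
  -- For a fixed large `R` the height `η` tends to zero.
  have hR : ∀ R, max C₀ (16 * (1 + ‖z‖ ^ 2)) ≤ R →
      |Real.pi * (∫ x, rho2c σ z x) - Real.pi| ≤ 4 * K / √R := by
    intro R hR
    have hR0 : 0 < R := hC₀.trans_le ((le_max_left _ _).trans hR)
    have hlim : Tendsto (fun η : ℝ => ∫ x in (-R)..R, (m2c σ z (x + η * Complex.I)).im) (𝓝[>] 0)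
        (𝓝 (∫ x in (-R)..R, Real.pi * rho2c σ z x)) := by
      refine intervalIntegral.tendsto_integral_filter_of_dominated_convergence
        (fun x => (√τ)⁻¹ * |x| ^ (-(1 / 2) : ℝ)) ?_ ?_ (hbound _ _) ?_
      · refine eventually_nhdsWithin_of_forall fun η hη => ?_
        have hη' : 0 < η := hη
        refine Continuous.aestronglyMeasurable (Complex.continuous_im.comp ?_)
        exact (h.differentiableOn_m2c hτ).continuousOn.comp_continuous (by fun_prop)
          fun x => by simpa [upper] using hη'
      · refine eventually_nhdsWithin_of_forall fun η hη => ?_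
        have h0 : ∀ᵐ x : ℝ, x ≠ 0 := by simp [ae_iff]
        filter_upwards [h0] with x hx _
        exact h.abs_im_m2c_le hτ hx hη
      · have h0 : ∀ᵐ x : ℝ, x ≠ 0 := by simp [ae_iff]
        filter_upwards [h0] with x hx _
        exact h.tendsto_im_m2c hτ hx
    rw [intervalIntegral.integral_const_mul, intervalIntegral.integral_eq_integral_of_support_subset
      (hsupp R ((le_max_left _ _).trans hR))] at hlim
    have harc : Tendsto (fun η : ℝ => 2 * Real.arctan (R / η)) (𝓝[>] 0) (𝓝 Real.pi) := by
      have h1 : Tendsto (fun η : ℝ => R / η) (𝓝[>] 0) atTop := by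
        simpa only [div_eq_mul_inv] using tendsto_inv_nhdsGT_zero.const_mul_atTop hR0
      have h2 := (Real.tendsto_arctan_atTop.mono_right nhdsWithin_le_nhds).comp h1
      have h3 := h2.const_mul 2
      rwa [mul_div_cancel₀ _ (two_ne_zero : (2 : ℝ) ≠ 0)] at h3
    refine le_of_tendsto (hlim.sub harc).abs ?_
    filter_upwards [Ioo_mem_nhdsGT hR0] with η hη
    refine abs_integral_im_sub_le (h.differentiableOn_m2c hτ) (K := K)
      (X := 16 * (1 + ‖z‖ ^ 2)) (by positivity) hR0
      ((le_max_right _ _).trans hR) (fun w hw hwX => ?_) hη.1 hη.2.le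
    have := (h.isSol_upper hτ hw).norm_m2_add_inv_le hB hwX
    rwa [← h.m2c_eq hτ hw] at this
  have hz : |Real.pi * (∫ x, rho2c σ z x) - Real.pi| ≤ 0 := by
    have hl : Tendsto (fun R : ℝ => 4 * K / √R) atTop (𝓝 0) :=
      Real.tendsto_sqrt_atTop.const_div_atTop _
    exact ge_of_tendsto hl ((eventually_ge_atTop _).mono fun R h => hR R h)
  have h4 := abs_nonpos_iff.1 hz
  have h5 : Real.pi * ((∫ x, rho2c σ z x) - 1) = 0 := by linarith
  rcases mul_eq_zero.1 h5 with h6 | h6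
  · exact absurd h6 Real.pi_ne_zero
  · linarith

/-! ### The support and its edges -/

lemma Admissible.rho2c_pos_iff (h : Admissible τ σ z) (hτ : 0 < τ) {x : ℝ} (hx : 0 < x) :
    0 < rho2c σ z x ↔ x ∈ bulk σ z := by
  obtain ⟨K, hK, hcomp⟩ := exists_comparable hτ
  obtain ⟨h1, h2⟩ := hcomp h x hx
  rw [← h.rho1c_pos_iff hτ hx]
  exact ⟨fun h3 => pos_of_mul_pos_right (h3.trans_le h1) hK.le,
    fun h3 => pos_of_mul_pos_right (h3.trans_le h2) hK.le⟩

lemma Admissible.le_or_le (h : Admissible τ σ z) : 1 + τ ≤ ‖z‖ ^ 2 ∨ ‖z‖ ^ 2 ≤ 1 - τ := by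
  rcases le_abs.1 h.le_dist with h | h
  · left; linarith
  · right; linarith

/-- If `|z| < 1`, then the bulk reaches down to the origin. -/
lemma exists_Ioo_subset_bulk (hτ : 0 < τ) : ∃ δ : ℝ, 0 < δ ∧
    ∀ {N : ℕ} {σ : Fin N → ℝ} {z : ℂ}, Admissible τ σ z → ‖z‖ ^ 2 ≤ 1 - τ →
      Set.Ioo 0 δ ⊆ bulk σ z := by
  obtain ⟨C, δ, hC, hδ, hs⟩ := exists_simWith_origin hτ
  refine ⟨δ, hδ, fun {N σ z} h hz x hx => ?_⟩
  have h1 := (hs h hz x hx).1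
  have hx0 : 0 < x := hx.1
  rw [← h.rho1c_pos_iff hτ hx0]
  exact lt_of_lt_of_le (by positivity) h1

lemma Admissible.zero_mem_closure_bulk (h : Admissible τ σ z) (hτ : 0 < τ)
    (hz : ‖z‖ ^ 2 ≤ 1 - τ) : (0 : ℝ) ∈ closure (bulk σ z) := by
  obtain ⟨δ, hδ, hs⟩ := exists_Ioo_subset_bulk hτ
  refine closure_mono (hs h hz) ?_
  rw [closure_Ioo hδ.ne]
  exact ⟨le_rfl, hδ.le⟩

lemma Admissible.tsupport_rho1c (h : Admissible τ σ z) (hτ : 0 < τ) :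
    tsupport (rho1c σ z) = closure (bulk σ z) := by
  refine (closure_minimal ?_ isClosed_closure).antisymm (closure_mono fun x hx =>
    ((h.rho1c_pos_iff hτ hx.1).2 hx).ne')
  intro x hx
  rcases lt_trichotomy x 0 with h0 | rfl | h0
  · exact absurd (h.rho1c_of_neg hτ h0) hx
  · rcases h.le_or_le with hz | hz
    · exact absurd (h.rho_zero hτ hz).1 hx
    · exact h.zero_mem_closure_bulk hτ hz
  · exact subset_closure ((h.rho1c_pos_iff hτ h0).1
      ((h.rho1c_nonneg_of_ne hτ h0.ne').lt_of_ne' hx))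

lemma Admissible.tsupport_rho2c (h : Admissible τ σ z) (hτ : 0 < τ) :
    tsupport (rho2c σ z) = closure (bulk σ z) := by
  refine (closure_minimal ?_ isClosed_closure).antisymm (closure_mono fun x hx =>
    ((h.rho2c_pos_iff hτ hx.1).2 hx).ne')
  intro x hx
  rcases lt_trichotomy x 0 with h0 | rfl | h0
  · exact absurd (h.rho2c_of_neg hτ h0) hx
  · rcases h.le_or_le with hz | hz
    · exact absurd (h.rho_zero hτ hz).2 hx
    · exact h.zero_mem_closure_bulk hτ hz
  · exact subset_closure ((h.rho2c_pos_iff hτ h0).1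
      ((h.rho2c_nonneg_of_ne hτ h0.ne').lt_of_ne' hx))

lemma Admissible.bulk_nonempty (h : Admissible τ σ z) (hτ : 0 < τ) : (bulk σ z).Nonempty := by
  by_contra hne
  rw [Set.not_nonempty_iff_eq_empty] at hne
  have h1 : tsupport (rho2c σ z) = ∅ := by rw [h.tsupport_rho2c hτ, hne, closure_empty]
  have h2 := (h.isProbDensity_rho2c hτ).integral_eq_one
  rw [tsupport_eq_empty_iff.1 h1] at h2
  simp at h2

/-- Uniform bounds for the bulk. -/
lemma exists_bulk_subset (hτ : 0 < τ) : ∃ C₀ ε₀ : ℝ, 0 < C₀ ∧ 0 < ε₀ ∧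
    ∀ {N : ℕ} {σ : Fin N → ℝ} {z : ℂ}, Admissible τ σ z →
      closure (bulk σ z) ⊆ Set.Icc 0 C₀ ∧
      (1 + τ ≤ ‖z‖ ^ 2 → closure (bulk σ z) ⊆ Set.Ici ε₀) := by
  obtain ⟨C₀, hC₀, hlarge⟩ := exists_im_eq_zero_large hτ
  obtain ⟨ε₀, hε₀, hsmall⟩ := exists_im_eq_zero_near_zero hτ
  refine ⟨C₀, ε₀, hC₀, hε₀, fun {N σ z} h => ⟨?_, fun hz => ?_⟩⟩
  · refine closure_minimal (fun x hx => ⟨hx.1.le, ?_⟩) isClosed_Icc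
    by_contra hlt
    exact hx.2.ne' (hlarge (h.bounds hτ) (h.isSol_real hτ hx.1.ne') (not_le.1 hlt).le)
  · refine closure_minimal (fun x hx => ?_) isClosed_Ici
    by_contra hlt
    exact hx.2.ne' (hsmall (h.bounds hτ) (h.isSol_real hτ hx.1.ne') hz hx.1 (not_le.1 hlt).le)

/-- The common support of the densities is the closure of the bulk, whose edges are bounded and, for
`|z| > 1`, stay away from the origin. -/
lemma exists_edges (hτ : 0 < τ) : ∃ C₀ ε₀ : ℝ, 0 < C₀ ∧ 0 < ε₀ ∧
    ∀ {N : ℕ} {σ : Fin N → ℝ} {z : ℂ}, Admissible τ σ z → ∃ (L : ℕ) (e : ℕ → ℝ),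
      IsEdges (rho1c σ z) L e ∧ IsEdges (rho2c σ z) L e ∧ e 1 ≤ C₀ ∧
      (1 + τ ≤ ‖z‖ ^ 2 → ε₀ ≤ e (2 * L)) ∧ (‖z‖ ^ 2 ≤ 1 - τ → e (2 * L) = 0) := by
  obtain ⟨C₀, ε₀, hC₀, hε₀, hsub⟩ := exists_bulk_subset hτ
  refine ⟨C₀, ε₀, hC₀, hε₀, fun {N σ z} h => ?_⟩
  obtain ⟨hK, hK'⟩ := hsub h
  have hop := h.isOpen_bulk hτ
  obtain ⟨L, e, he, hmem, heq⟩ := exists_edges_of_finite_frontier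
    (frontier (closure (bulk σ z))).ncard (closure (bulk σ z)) isClosed_closure
    (closure_mono (interior_maximal subset_closure hop)) (Metric.isBounded_Icc 0 C₀ |>.subset hK)
    ((h.finite_frontier_bulk hτ).subset frontier_closure_subset) le_rfl
  have hL : 1 ≤ L := by
    obtain ⟨x, hx⟩ := h.bulk_nonempty hτ
    have hx' := subset_closure hx
    rw [heq] at hx'
    simp only [Set.mem_iUnion] at hx'
    obtain ⟨k, hk, -⟩ := hx'
    exact hk.1.trans hk.2
  have h2L : 2 * L ∈ Set.Icc 1 (2 * L) := ⟨by omega, le_rfl⟩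
  have h0 : 0 ≤ e (2 * L) := (hK (hmem _ h2L)).1
  refine ⟨L, e, ⟨hL, he, h0, (h.tsupport_rho1c hτ).trans heq⟩,
    ⟨hL, he, h0, (h.tsupport_rho2c hτ).trans heq⟩, (hK (hmem 1 ⟨le_rfl, by omega⟩)).2,
    fun hz => hK' hz (hmem _ h2L), fun hz => h0.antisymm' ?_⟩
  have hx := h.zero_mem_closure_bulk hτ hz
  rw [heq] at hx
  simp only [Set.mem_iUnion] at hx
  obtain ⟨k, hk, hxk⟩ := hx
  exact (he.antitoneOn ⟨by have := hk.1; omega, by have := hk.2; omega⟩ h2L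
    (by have := hk.2; omega)).trans hxk.1

lemma IsEdges.nonneg_of_mem {ρ : ℝ → ℝ} {L : ℕ} {e : ℕ → ℝ} (h : IsEdges ρ L e) {j : ℕ}
    (hj : j ∈ Set.Icc 1 (2 * L)) : 0 ≤ e j :=
  h.nonneg.trans (h.strictAnti.antitoneOn hj ⟨hj.1.trans hj.2, le_rfl⟩ hj.2)

lemma IsEdges.mem_tsupport {ρ : ℝ → ℝ} {L : ℕ} {e : ℕ → ℝ} (h : IsEdges ρ L e) {j : ℕ}
    (hj : j ∈ Set.Icc 1 (2 * L)) : e j ∈ tsupport ρ := by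
  rw [h.support_eq]
  simp only [Set.mem_iUnion]
  obtain ⟨h1, h2⟩ := hj
  rcases Nat.even_or_odd' j with ⟨k, rfl | rfl⟩
  · refine ⟨k, ⟨by omega, by omega⟩, le_rfl, ?_⟩
    exact h.strictAnti.antitoneOn ⟨by omega, by omega⟩ ⟨h1, h2⟩ (by omega)
  · refine ⟨k + 1, ⟨by omega, by omega⟩, ?_, le_of_eq (by congr 1)⟩
    exact h.strictAnti.antitoneOn ⟨by omega, by omega⟩ ⟨by omega, by omega⟩ (by omega)

/-- Immediately below an edge with even index there is a gap in the support. -/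
lemma IsEdges.exists_gap_of_even {ρ : ℝ → ℝ} {L : ℕ} {e : ℕ → ℝ} (h : IsEdges ρ L e) {j : ℕ}
    (hj : j ∈ Set.Icc 1 (2 * L)) (hev : Even j) :
    ∃ p < e j, ∀ x ∈ Set.Ioo p (e j), x ∉ tsupport ρ := by
  obtain ⟨h1, h2⟩ := hj
  have hp : ∃ p < e j, ∀ i ∈ Set.Icc 1 (2 * L), j < i → e i ≤ p := by
    rcases h2.lt_or_eq with h3 | h3
    · refine ⟨e (j + 1), h.strictAnti ⟨h1, h2⟩ ⟨by omega, by omega⟩ (by omega), fun i hi hji => ?_⟩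
      exact h.strictAnti.antitoneOn ⟨by omega, by omega⟩ hi hji
    · exact ⟨e j - 1, by linarith, fun i hi hji => absurd hi.2 (by omega)⟩
  obtain ⟨p, hpj, hp⟩ := hp
  refine ⟨p, hpj, fun x hx hxs => ?_⟩
  rw [h.support_eq] at hxs
  simp only [Set.mem_iUnion] at hxs
  obtain ⟨k, ⟨hk1, hk2⟩, hxk⟩ := hxs
  obtain ⟨l, hl⟩ := hev
  rcases le_or_gt (2 * k) j with hkj | hkj
  · have := h.strictAnti.antitoneOn (a := 2 * k) ⟨by omega, by omega⟩ ⟨h1, h2⟩ hkj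
    linarith [hxk.1, hx.2]
  · have := hp (2 * k - 1) ⟨by omega, by omega⟩ (by omega)
    linarith [hxk.2, hx.1]

/-- Immediately above an edge with odd index there is a gap in the support. -/
lemma IsEdges.exists_gap_of_odd {ρ : ℝ → ℝ} {L : ℕ} {e : ℕ → ℝ} (h : IsEdges ρ L e) {j : ℕ}
    (hj : j ∈ Set.Icc 1 (2 * L)) (hodd : Odd j) :
    ∃ p, e j < p ∧ ∀ x ∈ Set.Ioo (e j) p, x ∉ tsupport ρ := by
  obtain ⟨h1, h2⟩ := hj
  have hp : ∃ p, e j < p ∧ ∀ i ∈ Set.Icc 1 (2 * L), i < j → p ≤ e i := by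
    rcases h1.lt_or_eq with h3 | h3
    · refine ⟨e (j - 1), h.strictAnti ⟨by omega, by omega⟩ ⟨h1, h2⟩ (by omega), fun i hi hji => ?_⟩
      exact h.strictAnti.antitoneOn hi ⟨by omega, by omega⟩ (by omega)
    · exact ⟨e j + 1, by linarith, fun i hi hji => absurd hi.1 (by omega)⟩
  obtain ⟨p, hpj, hp⟩ := hp
  refine ⟨p, hpj, fun x hx hxs => ?_⟩
  rw [h.support_eq] at hxs
  simp only [Set.mem_iUnion] at hxs
  obtain ⟨k, ⟨hk1, hk2⟩, hxk⟩ := hxs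
  obtain ⟨l, hl⟩ := hodd
  rcases le_or_gt j (2 * k - 1) with hkj | hkj
  · have := h.strictAnti.antitoneOn (b := 2 * k - 1) ⟨h1, h2⟩ ⟨by omega, by omega⟩ hkj
    linarith [hxk.2, hx.1]
  · have := hp (2 * k) ⟨by omega, by omega⟩ (by omega)
    linarith [hxk.1, hx.2]

/-! ### The bulk -/

/-- On a regular bulk component the lower bound is an assumption and the upper bound holds for every
`x ≥ τ'`. -/
lemma exists_simWith_bulk (hτ : 0 < τ) (c : ℝ → ℝ) (hc : ∀ t, 0 < t → 0 < c t) {τ' : ℝ}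
    (hτ' : 0 < τ') : ∃ C : ℝ, 0 < C ∧ ∀ {N : ℕ} {σ : Fin N → ℝ} {z : ℂ}, Admissible τ σ z →
      ∀ x, τ' ≤ x → c τ' ≤ rho1c σ z x → SimWith C (rho1c σ z x) 1 := by
  have hc' := hc τ' hτ'
  have hs : 0 < √τ' := Real.sqrt_pos.2 hτ'
  refine ⟨(c τ')⁻¹ + 1 / √τ', by positivity, fun {N σ z} h x hx hcx => ⟨?_, ?_⟩⟩
  · rw [mul_one]
    refine le_trans ?_ hcx
    exact inv_le_of_inv_le₀ hc' (by have : 0 < 1 / √τ' := by positivity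
                                    linarith)
  · have hx0 := hτ'.trans_le hx
    rw [h.rho1c_eq hτ hx0.ne', mul_one]
    have him := (h.isSol_real hτ hx0.ne').im_nonneg
    calc 1 / Real.pi * (bval σ z x).im ≤ 1 * (1 / √x) :=
          mul_le_mul one_div_pi_le_one (h.im_bval_le hτ hx0) him (by norm_num)
      _ ≤ 1 / √τ' := by rw [one_mul]; gcongr
      _ ≤ _ := by have : 0 < (c τ')⁻¹ := by positivity
                  linarith

/-! ### The function `f` near a regular edge -/

/-- The cubic as a function of `s = σᵢ`, `a = |z|²`, `q` and `m`. -/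
def cub (s a : ℝ) (q m : ℂ) : ℂ := q * m ^ 3 - (s + a) * m ^ 2 - q * a * m + a ^ 2

lemma cubic_eq_cub (s : ℝ) (z q m : ℂ) : cubic s z q m = cub s (‖z‖ ^ 2) q m := by
  rw [cubic, cub]; push_cast; ring

/-- The summand of `f` belonging to `s = σᵢ`, without its factor `σᵢ`. -/
def summand (s a : ℝ) (q m : ℂ) : ℂ := m * (m ^ 2 - a) / cub s a q m

lemma fFun_eq (σ : Fin N → ℝ) (z q m : ℂ) : fFun σ z q m =
    -q + m + cavg fun i => (σ i : ℂ) * summand (σ i) (‖z‖ ^ 2) q m := by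
  simp only [fFun, cavg, cubic_eq_cub, summand, Complex.ofReal_pow]

lemma cub_mul (s a : ℝ) (q b : ℂ) (hc : (a : ℂ) - q ^ 2 * b ^ 2 ≠ 0) :
    cub s a q (q * b) = (a - q ^ 2 * b ^ 2) * den a s (q ^ 2) b := by
  rw [cub, den, mul_sub, mul_left_comm _ (s : ℂ), mul_div_cancel₀ _ hc]
  ring

lemma IsSol.fFun_eq_zero {q : ℂ} (h : IsSol σ (‖z‖ ^ 2) (q ^ 2) b) :
    fFun σ z q (q * b) = 0 := by
  have h1 : ∀ i, (σ i : ℂ) * summand (σ i) (‖z‖ ^ 2) q (q * b) =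
      -(q * b) * ((σ i : ℂ) / den (‖z‖ ^ 2) (σ i) (q ^ 2) b) := by
    intro i
    have hc := h.c_ne
    have hd := h.den_ne i
    rw [summand, cub_mul _ _ _ _ hc, mul_div_assoc', mul_div_assoc',
      div_eq_div_iff (mul_ne_zero hc hd) hd]
    ring
  have hb := h.b_ne
  rw [fFun_eq, funext h1, cavg_mul_left, ← h.eq_one]
  field_simp
  ring

/-- Along the zero set of `f`, the function `f(q₀, ·)` is `q - q₀` times a factor close to a
positive number. -/
lemma fFun_eq_mul {q q₀ m : ℂ} (h : fFun σ z q m = 0) (h1 : ∀ i, cub (σ i) (‖z‖ ^ 2) q m ≠ 0)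
    (h2 : ∀ i, cub (σ i) (‖z‖ ^ 2) q₀ m ≠ 0) : fFun σ z q₀ m = (q - q₀) *
      (1 + cavg fun i => (σ i : ℂ) *
        (summand (σ i) (‖z‖ ^ 2) q m * summand (σ i) (‖z‖ ^ 2) q₀ m)) := by
  rw [← sub_zero (fFun σ z q₀ m), ← h, fFun_eq, fFun_eq, mul_add, ← cavg_mul_left]
  have e : (fun i => (q - q₀) * ((σ i : ℂ) *
      (summand (σ i) (‖z‖ ^ 2) q m * summand (σ i) (‖z‖ ^ 2) q₀ m))) =
      fun i => (σ i : ℂ) * summand (σ i) (‖z‖ ^ 2) q₀ m -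
        (σ i : ℂ) * summand (σ i) (‖z‖ ^ 2) q m := by
    funext i
    have k1 := h1 i
    have k2 := h2 i
    rw [summand, summand, ← mul_sub, div_sub_div _ _ k2 k1, div_mul_div_comm, mul_div_assoc',
      mul_div_assoc', mul_div_assoc', mul_comm (cub _ _ q m)]
    congr 1
    rw [cub, cub]
    ring
  rw [e, cavg_sub]
  ring

/-- The cubics have only real roots. -/
lemma exists_cub_roots {s a q : ℝ} (hs : 0 < s) (ha : 0 ≤ a) (hq : 0 < q) :
    ∃ r₁ r₂ r₃ : ℝ, ∀ m : ℂ, cub s a q m = q * ((m - r₁) * (m - r₂) * (m - r₃)) := by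
  rcases ha.eq_or_lt with rfl | ha
  · refine ⟨0, 0, s / q, fun m => ?_⟩
    have : (q : ℂ) ≠ 0 := by exact_mod_cast hq.ne'
    rw [cub]; push_cast; field_simp; ring
  set P : ℝ → ℝ := fun m => q * m ^ 3 - (s + a) * m ^ 2 - q * a * m + a ^ 2 with hP
  have hcont : Continuous P := by fun_prop
  have hsa : 0 < √a := Real.sqrt_pos.2 ha
  have hsq : √a ^ 2 = a := Real.sq_sqrt ha.le
  have e0 : P 0 = a ^ 2 := by simp [hP]
  have e1 : P (√a) = -(s * a) := by
    simp only [hP]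
    linear_combination (q * √a - s) * hsq - a * hsq
  have e2 : P (-√a) = -(s * a) := by
    simp only [hP]
    linear_combination (-q * √a - s) * hsq - a * hsq
  have hneg : -(s * a) < 0 := by nlinarith
  have hpos : 0 < a ^ 2 := by positivity
  obtain ⟨r₁, hr₁, h1⟩ := intermediate_value_Ioo (by linarith : -√a ≤ 0) hcont.continuousOn
    (show (0 : ℝ) ∈ Set.Ioo _ _ by rw [e0, e2]; exact ⟨hneg, hpos⟩)
  obtain ⟨r₂, hr₂, h2⟩ := intermediate_value_Ioo' hsa.le hcont.continuousOn
    (show (0 : ℝ) ∈ Set.Ioo _ _ by rw [e0, e1]; exact ⟨hneg, hpos⟩)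
  have hne : r₁ - r₂ ≠ 0 := by
    have := hr₁.2; have := hr₂.1; intro h; linarith
  simp only [hP] at h1 h2
  -- The divided difference of the cubic at the two roots vanishes.
  have h3 : q * (r₁ ^ 2 + r₁ * r₂ + r₂ ^ 2) - (s + a) * (r₁ + r₂) - q * a = 0 := by
    refine ((mul_eq_zero (a := r₁ - r₂)).1 ?_).resolve_left hne
    linear_combination h1 - h2
  refine ⟨r₁, r₂, (s + a) / q - r₁ - r₂, fun m => ?_⟩
  have hqc : (q : ℂ) ≠ 0 := by exact_mod_cast hq.ne'
  have h1' : (q : ℂ) * r₁ ^ 3 - (s + a) * r₁ ^ 2 - q * a * r₁ + a ^ 2 = 0 := by exact_mod_cast h1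
  have h3' : (q : ℂ) * (r₁ ^ 2 + r₁ * r₂ + r₂ ^ 2) - (s + a) * (r₁ + r₂) - q * a = 0 := by
    exact_mod_cast h3
  have e : (q : ℂ) * ((m - r₁) * (m - r₂) * (m - ((s + a) / q - r₁ - r₂))) =
      (m - r₁) * (m - r₂) * (q * (m + r₁ + r₂) - (s + a)) := by
    field_simp; ring
  push_cast
  rw [e, cub]
  linear_combination h1' + (m - r₁) * h3'

/-- Distance from the real roots bounds the cubic from below, since it has no other roots. -/
lemma norm_cub_ge {s a q ε : ℝ} {m : ℂ} (hs : 0 < s) (ha : 0 ≤ a) (hq : 0 < q) (hε : 0 < ε)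
    (h : ∀ r : ℝ, cub s a q r = 0 → ε ≤ ‖m - r‖) : q * ε ^ 3 ≤ ‖cub s a q m‖ := by
  obtain ⟨r₁, r₂, r₃, hr⟩ := exists_cub_roots hs ha hq
  have h1 := h r₁ (by rw [hr]; ring)
  have h2 := h r₂ (by rw [hr]; ring)
  have h3 := h r₃ (by rw [hr]; ring)
  rw [hr, norm_mul, norm_mul, norm_mul, Complex.norm_real, Real.norm_eq_abs, abs_of_pos hq]
  calc q * ε ^ 3 = q * (ε * ε * ε) := by ring
    _ ≤ _ := by gcongr

/-- Uniform continuity of the cubic and of the summands of `f` near real points where the cubic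
is bounded below. -/
lemma exists_uniform_summand (M : ℝ) {p : ℝ} (hp : 0 < p) : ∃ r T : ℝ, 0 < r ∧ 0 < T ∧
    ∀ s a q₀ m₀ : ℝ, |s| ≤ M → |a| ≤ M → |q₀| ≤ M → |m₀| ≤ M → p ≤ ‖cub s a q₀ m₀‖ →
      ∀ q m : ℂ, ‖q - q₀‖ ≤ r → ‖m - m₀‖ ≤ r →
        cub s a q m ≠ 0 ∧ ‖summand s a q m‖ ≤ T ∧
        -(1 / 2) ≤ (summand s a q m * summand s a q₀ m).re := by
  set c : ℝ × ℝ × ℂ × ℂ → ℂ := fun v => cub v.1 v.2.1 v.2.2.1 v.2.2.2 with hc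
  set t : ℝ × ℝ × ℂ × ℂ → ℂ := fun v => summand v.1 v.2.1 v.2.2.1 v.2.2.2 with ht
  have hcc : Continuous c := by simp only [hc, cub]; fun_prop
  set D : Set (ℝ × ℝ × ℂ × ℂ) := Metric.closedBall 0 (M + 1) with hD
  have hDc : IsCompact D := isCompact_closedBall _ _
  set S : Set (ℝ × ℝ × ℂ × ℂ) := D ∩ {v | p / 2 ≤ ‖c v‖} with hS
  have hSc : IsCompact S :=
    hDc.inter_right (isClosed_le continuous_const hcc.norm)
  have htc : ContinuousOn t S := by
    have : Continuous fun v : ℝ × ℝ × ℂ × ℂ => v.2.2.2 * (v.2.2.2 ^ 2 - (v.2.1 : ℂ)) := by fun_prop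
    refine this.continuousOn.div hcc.continuousOn fun v hv h0 => ?_
    have := hv.2
    rw [Set.mem_ofPred_eq, show c v = 0 from h0, norm_zero] at this
    linarith
  obtain ⟨T₀, hT₀⟩ := hSc.exists_bound_of_continuousOn htc
  set T := max T₀ 1 with hT
  have hT1 : 0 < T := lt_of_lt_of_le one_pos (le_max_right _ _)
  obtain ⟨r₁, hr₁, h1⟩ := Metric.uniformContinuousOn_iff.1
    (hDc.uniformContinuousOn_of_continuous hcc.continuousOn) (p / 2) (by positivity)
  obtain ⟨r₂, hr₂, h2⟩ := Metric.uniformContinuousOn_iff.1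
    (hSc.uniformContinuousOn_of_continuous htc) (1 / (4 * T)) (by positivity)
  refine ⟨min 1 (min r₁ r₂ / 2), T, by positivity, hT1,
    fun s a q₀ m₀ hs ha hq₀ hm₀ hpc q m hq hm => ?_⟩
  have hM : 0 ≤ M := (abs_nonneg s).trans hs
  have hr1 : min 1 (min r₁ r₂ / 2) ≤ 1 := min_le_left _ _
  have hr2 : min 1 (min r₁ r₂ / 2) < min r₁ r₂ :=
    (min_le_right _ _).trans_lt (half_lt_self (lt_min hr₁ hr₂))
  set v₀ : ℝ × ℝ × ℂ × ℂ := (s, a, q₀, m₀) with hv₀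
  have hball : ∀ q' m' : ℂ, ‖q' - q₀‖ ≤ min 1 (min r₁ r₂ / 2) →
      ‖m' - m₀‖ ≤ min 1 (min r₁ r₂ / 2) → ((s, a, q', m') : ℝ × ℝ × ℂ × ℂ) ∈ D ∧
        dist ((s, a, q', m') : ℝ × ℝ × ℂ × ℂ) v₀ < min r₁ r₂ := by
    intro q' m' hq' hm'
    constructor
    · have k1 : ‖q'‖ ≤ M + 1 := by
        have := norm_add_le (q' - q₀) (q₀ : ℂ)
        rw [sub_add_cancel, Complex.norm_real, Real.norm_eq_abs] at this
        linarith
      have k2 : ‖m'‖ ≤ M + 1 := by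
        have := norm_add_le (m' - m₀) (m₀ : ℂ)
        rw [sub_add_cancel, Complex.norm_real, Real.norm_eq_abs] at this
        linarith
      rw [hD, mem_closedBall_zero_iff]
      simp only [Prod.norm_mk, Real.norm_eq_abs, max_le_iff]
      exact ⟨by linarith, by linarith, k1, k2⟩
    · simp only [hv₀, Prod.dist_eq, dist_self, dist_eq_norm (q' : ℂ), dist_eq_norm (m' : ℂ)]
      have := lt_min hr₁ hr₂
      refine max_lt this (max_lt this (max_lt (hq'.trans_lt hr2) (hm'.trans_lt hr2)))
  have hr0 : 0 ≤ min 1 (min r₁ r₂ / 2) := by positivity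
  have hv₀D := (hball q₀ m₀ (by simpa using hr0) (by simpa using hr0)).1
  have hmem : ∀ q' m' : ℂ, ‖q' - q₀‖ ≤ min 1 (min r₁ r₂ / 2) →
      ‖m' - m₀‖ ≤ min 1 (min r₁ r₂ / 2) → ((s, a, q', m') : ℝ × ℝ × ℂ × ℂ) ∈ S := by
    intro q' m' hq' hm'
    obtain ⟨k1, k2⟩ := hball q' m' hq' hm'
    refine ⟨k1, ?_⟩
    have k3 := h1 _ k1 v₀ hv₀D (k2.trans_le (min_le_left _ _))
    rw [dist_eq_norm, norm_sub_rev] at k3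
    have k4 := norm_sub_norm_le (c v₀) (c (s, a, q', m'))
    have k5 : p ≤ ‖c v₀‖ := hpc
    rw [Set.mem_ofPred_eq]
    linarith
  have hT' : ∀ q' m' : ℂ, ‖q' - q₀‖ ≤ min 1 (min r₁ r₂ / 2) →
      ‖m' - m₀‖ ≤ min 1 (min r₁ r₂ / 2) → ‖summand s a q' m'‖ ≤ T := fun q' m' hq' hm' =>
    (hT₀ _ (hmem q' m' hq' hm')).trans (le_max_left _ _)
  have hclose : ∀ q' m' : ℂ, ‖q' - q₀‖ ≤ min 1 (min r₁ r₂ / 2) →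
      ‖m' - m₀‖ ≤ min 1 (min r₁ r₂ / 2) →
      ‖summand s a q' m' - summand s a q₀ m₀‖ ≤ 1 / (4 * T) := fun q' m' hq' hm' => by
    have := h2 _ (hmem q' m' hq' hm') v₀ (hmem q₀ m₀ (by simpa using hr0) (by simpa using hr0))
      ((hball q' m' hq' hm').2.trans_le (min_le_right _ _))
    rw [dist_eq_norm] at this
    exact this.le
  refine ⟨fun h0 => ?_, hT' q m hq hm, ?_⟩
  · have := (hmem q m hq hm).2
    rw [Set.mem_ofPred_eq, show c (s, a, q, m) = 0 from h0, norm_zero] at this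
    linarith
  · have hq₀' : ‖(q₀ : ℂ) - q₀‖ ≤ min 1 (min r₁ r₂ / 2) := by simpa using hr0
    have hm₀' : ‖(m₀ : ℂ) - m₀‖ ≤ min 1 (min r₁ r₂ / 2) := by simpa using hr0
    -- At the centre the summand is real, so its square is nonnegative.
    obtain ⟨x, hx⟩ : ∃ x : ℝ, summand s a q₀ m₀ = x :=
      ⟨m₀ * (m₀ ^ 2 - a) / (q₀ * m₀ ^ 3 - (s + a) * m₀ ^ 2 - q₀ * a * m₀ + a ^ 2), by
        rw [summand, cub]; push_cast; rfl⟩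
    have k1 := hclose q m hq hm
    have k2 := hclose q₀ m hq₀' hm
    have k3 := hT' q m hq hm
    have k4 := hT' q₀ m₀ hq₀' hm₀'
    rw [hx] at k1 k2 k4
    set u := summand s a q m
    set u' := summand s a q₀ m
    have e : u * u' = u * (u' - x) + (u - x) * x + ((x * x : ℝ) : ℂ) := by push_cast; ring
    have k5 : ‖u * (u' - x) + (u - x) * x‖ ≤ 1 / 2 := by
      refine (norm_add_le _ _).trans ?_
      rw [norm_mul, norm_mul]
      calc ‖u‖ * ‖u' - x‖ + ‖u - x‖ * ‖(x : ℂ)‖ ≤ T * (1 / (4 * T)) + 1 / (4 * T) * T := by gcongr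
        _ = 1 / 2 := by field_simp; norm_num
    rw [e, Complex.add_re, Complex.ofReal_re]
    have k6 := (abs_le.1 ((Complex.abs_re_le_norm _).trans k5)).1
    nlinarith [mul_self_nonneg x]

/-! ### A fold of an analytic function -/

lemma norm_le_of_deriv_le {G : ℂ → ℂ} {m₀ : ℂ} {r K : ℝ} (n : ℕ) (hK : 0 ≤ K)
    (hG : DifferentiableOn ℂ G (Metric.ball m₀ r)) (h0 : G m₀ = 0)
    (hd : ∀ m ∈ Metric.ball m₀ r, ‖deriv G m‖ ≤ K * ‖m - m₀‖ ^ n) {m : ℂ}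
    (hm : m ∈ Metric.ball m₀ r) : ‖G m‖ ≤ K * ‖m - m₀‖ ^ (n + 1) := by
  have hsub : Metric.closedBall m₀ ‖m - m₀‖ ⊆ Metric.ball m₀ r :=
    Metric.closedBall_subset_ball (by rwa [Metric.mem_ball, dist_eq_norm] at hm)
  have := Convex.norm_image_sub_le_of_norm_deriv_le (f := G) (C := K * ‖m - m₀‖ ^ n)
    (s := Metric.closedBall m₀ ‖m - m₀‖) (x := m₀) (y := m)
    (fun x hx => hG.differentiableAt (Metric.isOpen_ball.mem_nhds (hsub hx)))
    (fun x hx => (hd x (hsub hx)).trans (by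
      rw [Metric.mem_closedBall, dist_eq_norm] at hx
      gcongr)) (convex_closedBall _ _)
    (Metric.mem_closedBall_self (norm_nonneg _)) (by rw [Metric.mem_closedBall, dist_eq_norm])
  rw [h0, sub_zero] at this
  exact this.trans_eq (by ring)

lemma norm_iteratedDeriv_le_of_bound {F : ℂ → ℂ} {m₀ : ℂ} {r B : ℝ} (hr : 0 < r)
    (hF : DifferentiableOn ℂ F (Metric.ball m₀ r)) (hB : ∀ m ∈ Metric.ball m₀ r, ‖F m‖ ≤ B)
    (n : ℕ) {m : ℂ} (hm : m ∈ Metric.ball m₀ (r / 2)) :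
    ‖iteratedDeriv n F m‖ ≤ n.factorial * B / (r / 4) ^ n := by
  have hsub : Metric.closedBall m (r / 4) ⊆ Metric.ball m₀ r := by
    refine Metric.closedBall_subset_ball' ?_
    rw [Metric.mem_ball] at hm
    linarith
  refine Complex.norm_iteratedDeriv_le_of_forall_mem_sphere_norm_le n (by positivity)
    ((hF.mono (Metric.closure_ball_subset_closedBall.trans hsub)).diffContOnCl)
    fun x hx => hB x (hsub (Metric.sphere_subset_closedBall hx))

/-- Taylor's formula of second order at a critical zero. -/
lemma norm_sub_quadratic_le {F : ℂ → ℂ} {m₀ : ℂ} {r B : ℝ} (hr : 0 < r) (hB0 : 0 ≤ B)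
    (hF : DifferentiableOn ℂ F (Metric.ball m₀ r)) (hB : ∀ m ∈ Metric.ball m₀ r, ‖F m‖ ≤ B)
    (h0 : F m₀ = 0) (h1 : deriv F m₀ = 0) {m : ℂ} (hm : m ∈ Metric.ball m₀ (r / 2)) :
    ‖F m - iteratedDeriv 2 F m₀ / 2 * (m - m₀) ^ 2‖ ≤ 6 * B / (r / 4) ^ 3 * ‖m - m₀‖ ^ 3 := by
  have hsub : Metric.ball m₀ (r / 2) ⊆ Metric.ball m₀ r :=
    Metric.ball_subset_ball (by linarith)
  have hK : 0 ≤ 6 * B / (r / 4) ^ 3 := by positivity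
  have hop := Metric.isOpen_ball (x := m₀) (ε := r / 2)
  have d0 : DifferentiableOn ℂ F (Metric.ball m₀ (r / 2)) := hF.mono hsub
  have d1 : DifferentiableOn ℂ (deriv F) (Metric.ball m₀ (r / 2)) := d0.deriv hop
  have d2 : DifferentiableOn ℂ (deriv (deriv F)) (Metric.ball m₀ (r / 2)) := d1.deriv hop
  have e2 : iteratedDeriv 2 F = deriv (deriv F) := by
    rw [iteratedDeriv_succ, iteratedDeriv_one]
  have e3 : iteratedDeriv 3 F = deriv (deriv (deriv F)) := by rw [iteratedDeriv_succ, e2]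
  rw [e2]
  set l := deriv (deriv F) m₀ with hl
  have hid : ∀ m : ℂ, HasDerivAt (fun m => m - m₀) 1 m := fun m => (hasDerivAt_id' m).sub_const m₀
  have b2 : ∀ m ∈ Metric.ball m₀ (r / 2), ‖deriv (deriv F) m - l‖ ≤
      6 * B / (r / 4) ^ 3 * ‖m - m₀‖ ^ (0 + 1) := fun m hm => by
    refine norm_le_of_deriv_le (G := fun m => deriv (deriv F) m - l) 0 hK (d2.sub_const l)
      (by simp [hl]) (fun x hx => ?_) hm
    have := norm_iteratedDeriv_le_of_bound hr hF hB 3 hx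
    rw [deriv_sub_const, ← e3]
    simpa [Nat.factorial] using this
  have b1 : ∀ m ∈ Metric.ball m₀ (r / 2), ‖deriv F m - l * (m - m₀)‖ ≤
      6 * B / (r / 4) ^ 3 * ‖m - m₀‖ ^ (1 + 1) := fun m hm => by
    refine norm_le_of_deriv_le (G := fun m => deriv F m - l * (m - m₀)) 1 hK
      (d1.sub fun x _ => ((hid x).const_mul l).differentiableAt.differentiableWithinAt)
      (by simp [h1]) (fun x hx => ?_) hm
    have h3 : HasDerivAt (fun m => deriv F m - l * (m - m₀)) (deriv (deriv F) x - l * 1) x :=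
      (d1.differentiableAt (hop.mem_nhds hx)).hasDerivAt.sub ((hid x).const_mul l)
    rw [h3.deriv, mul_one]
    exact b2 x hx
  refine norm_le_of_deriv_le (G := fun m => F m - l / 2 * (m - m₀) ^ 2) 2 hK
    (d0.sub fun x _ => (((hid x).pow 2).const_mul _).differentiableAt.differentiableWithinAt)
    (by simp [h0]) (fun x hx => ?_) hm
  have h3 := (d0.differentiableAt (hop.mem_nhds hx)).hasDerivAt.sub
    (((hid x).pow 2).const_mul (l / 2))
  have h4 : deriv (fun m => F m - l / 2 * (m - m₀) ^ 2) x = deriv F x - l * (x - m₀) := by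
    refine h3.deriv.trans ?_
    simp; ring
  rw [h4]
  exact b1 x hx

/-! ### The critical point at an edge -/

open ComplexConjugate in
lemma fFun_conj (σ : Fin N → ℝ) (z : ℂ) (q : ℝ) (m : ℂ) :
    fFun σ z q (conj m) = conj (fFun σ z q m) := by
  simp [fFun, cubic]

open ComplexConjugate in
lemma deriv_conj_symm {F : ℂ → ℂ} (h : ∀ m, F (conj m) = conj (F m)) (m : ℂ) :
    deriv F (conj m) = conj (deriv F m) := by
  have e : F = conj ∘ F ∘ conj := by funext m; simp [h]
  conv_lhs => rw [e, deriv_conj_conj]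
  simp

lemma iteratedDeriv_two_fFun_im (σ : Fin N → ℝ) (z : ℂ) (q x : ℝ) :
    (iteratedDeriv 2 (fun m : ℂ => fFun σ z q m) x).im = 0 := by
  rw [iteratedDeriv_succ, iteratedDeriv_one]
  have := deriv_conj_symm (deriv_conj_symm (fFun_conj σ z q)) (x : ℂ)
  rw [Complex.conj_ofReal] at this
  exact Complex.conj_eq_iff_im.1 this.symm

lemma contDiffAt_fFun {q₀ m₀ : ℂ} (h : ∀ i, cubic (σ i) z q₀ m₀ ≠ 0) :
    ContDiffAt ℂ 1 (fun v : ℂ × ℂ => fFun σ z v.1 v.2) (q₀, m₀) := by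
  unfold fFun
  refine ContDiffAt.add (by fun_prop) (contDiffAt_const.mul
    (ContDiffAt.sum fun i _ => contDiffAt_const.mul (ContDiffAt.div (by fun_prop) ?_ (h i))))
  unfold cubic
  fun_prop

lemma differentiableAt_fFun {q₀ m₀ : ℂ} (h : ∀ i, cubic (σ i) z q₀ m₀ ≠ 0) :
    DifferentiableAt ℂ (fun m : ℂ => fFun σ z q₀ m) m₀ :=
  DifferentiableAt.comp (f := fun m : ℂ => (q₀, m)) m₀
    ((contDiffAt_fFun h).differentiableAt one_ne_zero) (by fun_prop)

lemma Admissible.fFun_sqrt_eq_zero (h : Admissible τ σ z) (hτ : 0 < τ) {x : ℝ} (hx : 0 < x) :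
    fFun σ z (√x : ℝ) ((√x : ℝ) * bval σ z x) = 0 := by
  have e : (((√x : ℝ) : ℂ)) ^ 2 = x := by rw [← Complex.ofReal_pow, Real.sq_sqrt hx.le]
  exact IsSol.fFun_eq_zero (by rw [e]; exact h.isSol_real hτ hx.ne')

/-- At an edge the derivative of `f` vanishes: two distinct conjugate zeros merge there. -/
lemma Admissible.deriv_fFun_eq_zero (h : Admissible τ σ z) (hτ : 0 < τ) {x₀ : ℝ} (hx₀ : 0 < x₀)
    (hmem : x₀ ∈ closure (bulk σ z)) (him : (bval σ z x₀).im = 0)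
    (hcub : ∀ i, cubic (σ i) z (√x₀ : ℝ) ((√x₀ : ℝ) * bval σ z x₀) ≠ 0) :
    deriv (fun m : ℂ => fFun σ z (√x₀ : ℝ) m) ((√x₀ : ℝ) * bval σ z x₀) = 0 := by
  set q : ℝ → ℂ := fun x => ((√x : ℝ) : ℂ) with hq
  set m : ℝ → ℂ := fun x => q x * bval σ z x with hm
  set g : ℂ × ℂ → ℂ := fun v => fFun σ z v.1 v.2 with hg
  have hstrict : HasStrictFDerivAt g (fderiv ℂ g (q x₀, m x₀)) (q x₀, m x₀) :=
    (contDiffAt_fFun hcub).hasStrictFDerivAt one_ne_zero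
  set g' := fderiv ℂ g (q x₀, m x₀)
  have hderiv : deriv (fun m : ℂ => fFun σ z (q x₀) m) (m x₀) = g' (0, 1) :=
    (hstrict.hasFDerivAt.comp_hasDerivAt (m x₀)
      ((hasDerivAt_const (m x₀) (q x₀)).prodMk (hasDerivAt_id' (m x₀)))).deriv
  have hmreal : starRingEnd ℂ (m x₀) = m x₀ := by
    rw [hm]
    simp only [map_mul, hq, Complex.conj_ofReal]
    rw [Complex.conj_eq_iff_im.2 him]
  have hqt : Tendsto q (𝓝[bulk σ z] x₀) (𝓝 (q x₀)) :=
    ((Complex.continuous_ofReal.comp Real.continuous_sqrt).tendsto x₀).mono_left nhdsWithin_le_nhds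
  have hmt : Tendsto m (𝓝[bulk σ z] x₀) (𝓝 (m x₀)) :=
    hqt.mul ((h.tendsto_bval_real hτ hx₀.ne').mono_left nhdsWithin_le_nhds)
  have hmt' : Tendsto (fun x => starRingEnd ℂ (m x)) (𝓝[bulk σ z] x₀) (𝓝 (m x₀)) := by
    have := (Complex.continuous_conj.tendsto (m x₀)).comp hmt
    rw [hmreal] at this
    exact this
  have hne : (𝓝[bulk σ z] x₀).NeBot := mem_closure_iff_nhdsWithin_neBot.1 hmem
  have hlim : Tendsto (fun x => ((q x, m x), (q x, starRingEnd ℂ (m x)))) (𝓝[bulk σ z] x₀)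
      (𝓝 ((q x₀, m x₀), (q x₀, m x₀))) :=
    (hqt.prodMk_nhds hmt).prodMk_nhds (hqt.prodMk_nhds hmt')
  have ho := hstrict.isLittleO.comp_tendsto hlim
  refine hderiv.trans (norm_le_zero_iff.1 (le_of_forall_pos_le_add fun c hc => ?_))
  obtain ⟨x, hx, hxb⟩ := ((ho.def hc).and self_mem_nhdsWithin).exists
  have hx0 : 0 < x := hxb.1
  have h1 : g (q x, m x) = 0 := h.fFun_sqrt_eq_zero hτ hx0
  have h2 : g (q x, starRingEnd ℂ (m x)) = 0 := by
    have := fFun_conj σ z (√x) (m x)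
    rw [show fFun σ z (√x : ℝ) (m x) = 0 from h1, map_zero] at this
    exact this
  have h3 : ((q x, m x) - (q x, starRingEnd ℂ (m x)) : ℂ × ℂ) =
      (m x - starRingEnd ℂ (m x)) • ((0, 1) : ℂ × ℂ) := by simp
  simp only [Function.comp_apply] at hx
  rw [h1, h2, h3, map_smul, sub_zero, zero_sub, norm_neg, norm_smul, norm_smul, mul_comm,
    show ‖((0, 1) : ℂ × ℂ)‖ = 1 by simp [Prod.norm_mk], mul_one] at hx
  rw [zero_add]
  refine le_of_mul_le_mul_right hx (norm_pos_iff.2 fun h0 => ?_)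
  have h4 := Complex.conj_eq_iff_im.1 (sub_eq_zero.1 h0).symm
  simp only [hm, hq, Complex.im_ofReal_mul] at h4
  exact (mul_pos (Real.sqrt_pos.2 hx0) hxb.2).ne' h4

/-! ### Square root behaviour at a regular edge -/

/-- If `l u² ≈ y E` with `E` bounded and `l` bounded below, then `u = O(√|y|)`. -/
lemma fold_norm_sq_le {F l u E : ℂ} {y K ε B : ℝ} (hε : 0 < ε) (hF : F = y * E)
    (h : ‖F - l * u ^ 2‖ ≤ K * ‖u‖ ^ 3) (hE : ‖E‖ ≤ B) (hl : ε / 2 ≤ ‖l‖)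
    (hu : K * ‖u‖ ≤ ε / 4) : ‖u‖ ^ 2 ≤ 4 * B / ε * |y| := by
  have h1 := norm_sub_norm_le (l * u ^ 2) F
  rw [norm_sub_rev] at h1
  have h2 : ‖F‖ ≤ |y| * B := by
    rw [hF, norm_mul, Complex.norm_real, Real.norm_eq_abs]; gcongr
  rw [norm_mul, norm_pow] at h1
  have h3 : K * ‖u‖ ^ 3 ≤ ε / 4 * ‖u‖ ^ 2 := by
    calc K * ‖u‖ ^ 3 = K * ‖u‖ * ‖u‖ ^ 2 := by ring
      _ ≤ _ := by gcongr
  have h4 : ε / 2 * ‖u‖ ^ 2 ≤ ‖l‖ * ‖u‖ ^ 2 := by gcongr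
  have h5 : ε * ‖u‖ ^ 2 ≤ 4 * (|y| * B) := by linarith
  rw [div_mul_eq_mul_div, le_div_iff₀ hε]
  linarith

/-- If `l u² ≈ y E` with `l` and `y` of opposite signs and `Re E ≥ 1 / 2`, then `u` is nearly
imaginary, so that `Im u` is at least of order `√|y|`. -/
lemma fold_im_sq_ge {F u E : ℂ} {l y K Λ : ℝ} (hF : F = y * E)
    (h : ‖F - l * u ^ 2‖ ≤ K * ‖u‖ ^ 3) (hE : 1 / 2 ≤ E.re) (hu : K * ‖u‖ ^ 3 ≤ |y| / 4)
    (hl : |l| ≤ Λ) (hly : l * y < 0) : |y| ≤ 4 * Λ * u.im ^ 2 := by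
  have h1 : |(F - l * u ^ 2).re| ≤ |y| / 4 := (Complex.abs_re_le_norm _).trans (h.trans hu)
  have e : (F - l * u ^ 2).re = y * E.re - l * (u.re ^ 2 - u.im ^ 2) := by
    rw [hF, Complex.sub_re, Complex.re_ofReal_mul, Complex.re_ofReal_mul, sq u, Complex.mul_re]
    ring
  rw [e] at h1
  obtain ⟨h2, h3⟩ := abs_le.1 h1
  rcases le_total 0 y with hy | hy
  · rw [abs_of_nonneg hy] at *
    have hl0 : l < 0 := by
      by_contra hn
      exact absurd (mul_nonneg (not_lt.1 hn) hy) (not_le.2 hly)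
    rw [abs_of_neg hl0] at hl
    nlinarith [mul_nonneg hy (sub_nonneg.2 hE), sq_nonneg u.re, sq_nonneg u.im,
      mul_nonneg (neg_nonneg.2 hl0.le) (sq_nonneg u.re),
      mul_le_mul_of_nonneg_right hl (sq_nonneg u.im)]
  · rw [abs_of_nonpos hy] at *
    have hl0 : 0 < l := by
      by_contra hn
      exact absurd (mul_nonneg_of_nonpos_of_nonpos (not_lt.1 hn) hy) (not_le.2 hly)
    rw [abs_of_pos hl0] at hl
    nlinarith [mul_nonneg (neg_nonneg.2 hy) (sub_nonneg.2 hE), sq_nonneg u.re, sq_nonneg u.im,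
      mul_nonneg hl0.le (sq_nonneg u.re), mul_le_mul_of_nonneg_right hl (sq_nonneg u.im)]

lemma simWith_sqrt {k₁ k₂ ρ t : ℝ} (hk₁ : 0 < k₁) (hk₂ : 0 < k₂) (hρ : 0 ≤ ρ)
    (h1 : k₁ * t ≤ ρ ^ 2) (h2 : ρ ^ 2 ≤ k₂ * t) : SimWith (√k₂ + 1 / √k₁) ρ (√t) := by
  have hs₁ : 0 < √k₁ := Real.sqrt_pos.2 hk₁
  have hs₂ : 0 < √k₂ := Real.sqrt_pos.2 hk₂
  constructor
  · calc (√k₂ + 1 / √k₁)⁻¹ * √t ≤ (1 / √k₁)⁻¹ * √t := by gcongr; linarith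
      _ = √(k₁ * t) := by rw [Real.sqrt_mul hk₁.le, one_div, inv_inv]
      _ ≤ √(ρ ^ 2) := Real.sqrt_le_sqrt h1
      _ = ρ := Real.sqrt_sq hρ
  · calc ρ = √(ρ ^ 2) := (Real.sqrt_sq hρ).symm
      _ ≤ √(k₂ * t) := Real.sqrt_le_sqrt h2
      _ = √k₂ * √t := Real.sqrt_mul hk₂.le _
      _ ≤ _ := by gcongr; linarith [one_div_pos.2 hs₁]

/-- The constants in the expansion of `f(√x₀, ·)` at a regular edge `x₀`. -/
lemma exists_fold_constants (hτ : 0 < τ) {κ X ε : ℝ} (hκ : 0 < κ) (hε : 0 < ε) :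
    ∃ r K B Λ : ℝ, 0 < r ∧ 0 < K ∧ 0 < B ∧ 0 < Λ ∧
    ∀ {N : ℕ} {σ : Fin N → ℝ} {z : ℂ}, Admissible τ σ z → ∀ x₀ : ℝ, κ ≤ x₀ → x₀ ≤ X →
      x₀ ∈ closure (bulk σ z) → (bval σ z x₀).im = 0 → IsRegularEdge σ z ε x₀ →
      ∃ l : ℝ, ε / 2 ≤ |l| ∧ |l| ≤ Λ ∧ ∀ x : ℝ, 0 < x → |√x - √x₀| ≤ r →
        ‖(√x : ℝ) * bval σ z x - (√x₀ : ℝ) * bval σ z x₀‖ ≤ r →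
        ∃ F E : ℂ, F = ((√x - √x₀ : ℝ) : ℂ) * E ∧ ‖E‖ ≤ B ∧ 1 / 2 ≤ E.re ∧
          ‖F - l * ((√x : ℝ) * bval σ z x - (√x₀ : ℝ) * bval σ z x₀) ^ 2‖ ≤
            K * ‖(√x : ℝ) * bval σ z x - (√x₀ : ℝ) * bval σ z x₀‖ ^ 3 := by
  set M : ℝ := max (√X + 1) (1 + τ⁻¹) with hM
  have hτi : 0 < τ⁻¹ := inv_pos.2 hτ
  have hM1 : √X + 1 ≤ M := le_max_left _ _
  have hM2 : 1 + τ⁻¹ ≤ M := le_max_right _ _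
  have hsκ : 0 < √κ := Real.sqrt_pos.2 hκ
  obtain ⟨r, T, hr, hT, huni⟩ := exists_uniform_summand M (p := √κ * ε ^ 3) (by positivity)
  have hM0 : 0 < M := by linarith
  set B : ℝ := M + (M + r) + T with hB
  have hB0 : 0 < B := by positivity
  refine ⟨r / 4, 6 * B / (r / 4) ^ 3, 1 + T ^ 2, B / (r / 4) ^ 2, by positivity, by positivity,
    by positivity, by positivity, fun {N σ z} h x₀ hκx hxX hmem him hreg => ?_⟩
  have hx₀ : 0 < x₀ := hκ.trans_le hκx
  have hBd := h.bounds hτ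
  have hs₀ := h.isSol_real hτ hx₀.ne'
  set q₀ : ℝ := √x₀ with hq₀
  have hq₀p : 0 < q₀ := Real.sqrt_pos.2 hx₀
  -- At the edge the value of `m_c` is real.
  obtain ⟨m₀, hm₀⟩ : ∃ m₀ : ℝ, (q₀ : ℂ) * bval σ z x₀ = m₀ :=
    ⟨q₀ * (bval σ z x₀).re, by
      conv_lhs => rw [← Complex.re_add_im (bval σ z x₀), him]
      push_cast; ring⟩
  have hmc : mc σ z x₀ = m₀ := by rw [h.mc_eq hτ hx₀.ne', ← hm₀]
  have hm₀M : |m₀| ≤ M := by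
    have h1 := hs₀.mcNorm_le hBd
    rw [mcNorm, Complex.norm_real, Real.norm_eq_abs, abs_of_pos hx₀] at h1
    have h2 : |m₀| = √x₀ * ‖bval σ z x₀‖ := by
      rw [← Real.norm_eq_abs, ← Complex.norm_real, ← hm₀, norm_mul, Complex.norm_real,
        Real.norm_eq_abs, abs_of_pos hq₀p]
    rw [h2]
    have : √x₀ ≤ √X := Real.sqrt_le_sqrt hxX
    linarith
  have hq₀M : |q₀| ≤ M := by
    rw [abs_of_pos hq₀p]
    have : √x₀ ≤ √X := Real.sqrt_le_sqrt hxX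
    linarith
  have huni' : ∀ (i : Fin N) (q m : ℂ), ‖q - q₀‖ ≤ r → ‖m - m₀‖ ≤ r →
      cub (σ i) (‖z‖ ^ 2) q m ≠ 0 ∧ ‖summand (σ i) (‖z‖ ^ 2) q m‖ ≤ T ∧
        -(1 / 2) ≤ (summand (σ i) (‖z‖ ^ 2) q m * summand (σ i) (‖z‖ ^ 2) q₀ m).re := by
    intro i
    refine huni (σ i) (‖z‖ ^ 2) q₀ m₀ ?_ ?_ hq₀M hm₀M ?_
    · rw [abs_of_pos (hBd.eig_pos i)]
      linarith [hBd.eig_le i]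
    · rw [abs_of_nonneg hBd.nonneg]
      exact hBd.le.trans hM2
    · refine le_trans ?_ (norm_cub_ge (hBd.eig_pos i) hBd.nonneg hq₀p hε fun t ht => ?_)
      · have := Real.sqrt_le_sqrt hκx
        gcongr
      · rw [← cubic_eq_cub] at ht
        rw [← hmc]
        exact hreg.root_dist i t ht
  set F : ℂ → ℂ := fun m => fFun σ z q₀ m with hF
  have hrefl : ‖(q₀ : ℂ) - q₀‖ ≤ r := by simpa using hr.le
  have hball : ∀ m ∈ Metric.ball (m₀ : ℂ) r, ‖m - m₀‖ ≤ r := fun m hm => by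
    rw [Metric.mem_ball, dist_eq_norm] at hm; exact hm.le
  have hFd : DifferentiableOn ℂ F (Metric.ball (m₀ : ℂ) r) := fun m hm =>
    (differentiableAt_fFun fun i => by
      rw [cubic_eq_cub]; exact (huni' i q₀ m hrefl (hball m hm)).1).differentiableWithinAt
  have hFB : ∀ m ∈ Metric.ball (m₀ : ℂ) r, ‖F m‖ ≤ B := fun m hm => by
    have h1 : ‖cavg fun i => (σ i : ℂ) * summand (σ i) (‖z‖ ^ 2) q₀ m‖ ≤ T := by
      refine (norm_cavg_le _).trans ?_
      have : (fun i => ‖(σ i : ℂ) * summand (σ i) (‖z‖ ^ 2) q₀ m‖) =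
          fun i => σ i * ‖summand (σ i) (‖z‖ ^ 2) q₀ m‖ := by
        funext i
        rw [norm_mul, Complex.norm_real, Real.norm_eq_abs, abs_of_pos (hBd.eig_pos i)]
      rw [this]
      exact hBd.avg_mul_le fun i => (huni' i q₀ m hrefl (hball m hm)).2.1
    have h2 : ‖m‖ ≤ M + r := by
      have := norm_add_le (m - m₀) (m₀ : ℂ)
      rw [sub_add_cancel, Complex.norm_real, Real.norm_eq_abs] at this
      linarith [hball m hm]
    have h3 : ‖-(q₀ : ℂ)‖ ≤ M := by
      rw [norm_neg, Complex.norm_real, Real.norm_eq_abs]; exact hq₀M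
    simp only [hF, fFun_eq]
    refine (norm_add_le _ _).trans ?_
    have := norm_add_le (-(q₀ : ℂ)) m
    linarith
  have hF0 : F m₀ = 0 := by rw [← hm₀]; exact h.fFun_sqrt_eq_zero hτ hx₀
  have hF1 : deriv F m₀ = 0 := by
    have := h.deriv_fFun_eq_zero hτ hx₀ hmem him fun i => by
      rw [cubic_eq_cub, ← hq₀, hm₀]
      exact (huni' i q₀ m₀ hrefl (by simpa using hr.le)).1
    rwa [← hq₀, hm₀] at this
  obtain ⟨l, hl⟩ : ∃ l : ℝ, iteratedDeriv 2 F m₀ / 2 = l :=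
    ⟨(iteratedDeriv 2 F m₀).re / 2, by
      have := iteratedDeriv_two_fFun_im σ z q₀ m₀
      conv_lhs => rw [← Complex.re_add_im (iteratedDeriv 2 F m₀), this]
      push_cast; ring⟩
  have hlabs : |l| = ‖iteratedDeriv 2 F m₀‖ / 2 := by
    rw [← Real.norm_eq_abs, ← Complex.norm_real, ← hl, norm_div, Complex.norm_ofNat]
  refine ⟨l, ?_, ?_, fun x hx hqx hmx => ?_⟩
  · have := hreg.second_deriv
    rw [hmc] at this
    rw [hlabs]
    linarith
  · have := norm_iteratedDeriv_le_of_bound hr hFd hFB 2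
      (Metric.mem_ball_self (by positivity : 0 < r / 2))
    rw [hlabs, div_le_iff₀ two_pos]
    refine this.trans_eq ?_
    simp only [Nat.factorial]; push_cast; ring
  · rw [hm₀] at hmx ⊢
    set q : ℝ := √x with hq
    set m : ℂ := q * bval σ z x with hm
    have hqr : ‖(q : ℂ) - q₀‖ ≤ r := by
      rw [← Complex.ofReal_sub, Complex.norm_real, Real.norm_eq_abs]; linarith
    have hmr : ‖m - m₀‖ ≤ r := by linarith
    refine ⟨F m, 1 + cavg fun i => (σ i : ℂ) *
        (summand (σ i) (‖z‖ ^ 2) q m * summand (σ i) (‖z‖ ^ 2) q₀ m), ?_, ?_, ?_, ?_⟩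
    · rw [Complex.ofReal_sub]
      exact fFun_eq_mul (h.fFun_sqrt_eq_zero hτ hx) (fun i => (huni' i q m hqr hmr).1)
        fun i => (huni' i q₀ m hrefl hmr).1
    · refine (norm_add_le _ _).trans ?_
      rw [norm_one]
      gcongr
      refine (norm_cavg_le _).trans ?_
      have : (fun i => ‖(σ i : ℂ) *
          (summand (σ i) (‖z‖ ^ 2) q m * summand (σ i) (‖z‖ ^ 2) q₀ m)‖) =
          fun i => σ i * (‖summand (σ i) (‖z‖ ^ 2) q m‖ * ‖summand (σ i) (‖z‖ ^ 2) q₀ m‖) := by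
        funext i
        rw [norm_mul, norm_mul, Complex.norm_real, Real.norm_eq_abs, abs_of_pos (hBd.eig_pos i)]
      rw [this]
      refine hBd.avg_mul_le fun i => ?_
      rw [sq T]
      exact mul_le_mul (huni' i q m hqr hmr).2.1 (huni' i q₀ m hrefl hmr).2.1 (norm_nonneg _) hT.le
    · rw [Complex.add_re, Complex.one_re, cavg_re]
      simp only [Complex.re_ofReal_mul]
      have := hBd.avg_mul_ge fun i => (huni' i q m hqr hmr).2.2
      linarith
    · rw [← hl]
      exact norm_sub_quadratic_le hr hB0.le hFd hFB hF0 hF1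
        (by rw [Metric.mem_ball, dist_eq_norm]; linarith)

/-- Near a regular edge `x₀` the first density behaves like a square root on the side of `x₀` where
`l (x - x₀) < 0`, with `l` half the second derivative of `f`. Regularity bounds the fold of `f`
uniformly, and a continuity argument keeps `m_c(x)` in the domain of the expansion. -/
lemma exists_simWith_sqrt (hτ : 0 < τ) {κ X ε : ℝ} (hκ : 0 < κ) (hX : 0 < X) (hε : 0 < ε) :
    ∃ C δ : ℝ, 0 < C ∧ 0 < δ ∧
    ∀ {N : ℕ} {σ : Fin N → ℝ} {z : ℂ}, Admissible τ σ z → ∀ x₀ : ℝ, κ ≤ x₀ → x₀ ≤ X →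
      x₀ ∈ closure (bulk σ z) → (bval σ z x₀).im = 0 → IsRegularEdge σ z ε x₀ →
      ∃ l : ℝ, l ≠ 0 ∧ ∀ x : ℝ, |x - x₀| < δ → l * (x - x₀) < 0 →
        0 < x ∧ SimWith C (rho1c σ z x) (√|x - x₀|) := by
  obtain ⟨r, K, B, Λ, hr, hK, hB, hΛ, hfold⟩ := exists_fold_constants hτ (X := X) hκ hε
  have hsκ : 0 < √κ := Real.sqrt_pos.2 hκ
  set r₁ : ℝ := min r (min (ε / (4 * K)) (ε / (16 * K * B))) with hr₁
  have hr₁0 : 0 < r₁ := by positivity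
  have hr₁r : r₁ ≤ r := min_le_left _ _
  have hr₁K : K * r₁ ≤ ε / 4 := by
    have : r₁ ≤ ε / (4 * K) := (min_le_right _ _).trans (min_le_left _ _)
    rw [le_div_iff₀ (by positivity)] at this
    linarith
  have hr₁B : K * r₁ * (4 * B / ε) ≤ 1 / 4 := by
    have : r₁ ≤ ε / (16 * K * B) := (min_le_right _ _).trans (min_le_right _ _)
    rw [le_div_iff₀ (by positivity)] at this
    rw [mul_div_assoc', div_le_iff₀ hε]
    linarith
  set δq : ℝ := min r (ε * r₁ ^ 2 / (8 * B)) with hδq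
  have hδq0 : 0 < δq := by positivity
  have hδqB : 4 * B / ε * δq < r₁ ^ 2 := by
    have : δq ≤ ε * r₁ ^ 2 / (8 * B) := min_le_right _ _
    rw [le_div_iff₀ (by positivity)] at this
    rw [div_mul_eq_mul_div, div_lt_iff₀ hε]
    nlinarith [pow_pos hr₁0 2]
  set δ : ℝ := min (κ / 2) (√κ * δq) with hδ
  have hδ0 : 0 < δ := by positivity
  set Q : ℝ := 2 * √(X + κ) with hQ
  have hQ0 : 0 < Q := by positivity
  set k₁ : ℝ := (Q * (4 * Λ) * (Real.pi ^ 2 * (X + κ)))⁻¹ with hk₁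
  set k₂ : ℝ := 4 * B / ε / √κ / (Real.pi ^ 2 * (κ / 2)) with hk₂
  have hpi := Real.pi_pos
  have hk₁0 : 0 < k₁ := by positivity
  have hk₂0 : 0 < k₂ := by positivity
  refine ⟨√k₂ + 1 / √k₁, δ, by positivity, hδ0, fun {N σ z} h x₀ hκx hxX hmem him hreg => ?_⟩
  obtain ⟨l, hl1, hl2, hexp⟩ := hfold h x₀ hκx hxX hmem him hreg
  have hx₀ : 0 < x₀ := hκ.trans_le hκx
  have hl0 : l ≠ 0 := by
    rintro rfl
    rw [abs_zero] at hl1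
    linarith
  refine ⟨l, hl0, ?_⟩
  set u : ℝ → ℂ := fun x => (√x : ℝ) * bval σ z x - (√x₀ : ℝ) * bval σ z x₀ with hu
  have hxpos : ∀ x, |x - x₀| < δ → κ / 2 < x ∧ x < X + κ := fun x hx => by
    have := abs_lt.1 (hx.trans_le (min_le_left _ _))
    constructor <;> linarith
  have hdiff : ∀ x, |x - x₀| < δ → (√x - √x₀) * (√x + √x₀) = x - x₀ := fun x hx => by
    have h1 := Real.sq_sqrt (show 0 ≤ x by linarith [(hxpos x hx).1])
    have h2 := Real.sq_sqrt hx₀.le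
    linear_combination h1 - h2
  have hsum : ∀ x, √κ ≤ √x + √x₀ := fun x => by
    have := Real.sqrt_le_sqrt hκx
    linarith [Real.sqrt_nonneg x]
  have hqle : ∀ x, |x - x₀| < δ → |√x - √x₀| ≤ |x - x₀| / √κ := fun x hx => by
    rw [le_div_iff₀ hsκ, ← hdiff x hx, abs_mul, abs_of_pos (hsκ.trans_le (hsum x))]
    exact mul_le_mul_of_nonneg_left (hsum x) (abs_nonneg _)
  have hqδ : ∀ x, |x - x₀| < δ → |√x - √x₀| < δq := fun x hx => by
    refine (hqle x hx).trans_lt ?_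
    rw [div_lt_iff₀ hsκ, mul_comm]
    exact hx.trans_le (min_le_right _ _)
  have hkey : ∀ x, |x - x₀| < δ → ‖u x‖ ≤ r₁ → ‖u x‖ ^ 2 ≤ 4 * B / ε * |√x - √x₀| := by
    intro x hx hux
    obtain ⟨F, E, hF, hE, -, hT⟩ := hexp x (by linarith [(hxpos x hx).1])
      ((hqδ x hx).le.trans (min_le_left _ _)) (hux.trans hr₁r)
    refine fold_norm_sq_le hε hF hT hE ?_ ((mul_le_mul_of_nonneg_left hux hK.le).trans hr₁K)
    rwa [Complex.norm_real, Real.norm_eq_abs]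
  -- The value `r₁` is not attained by `‖u‖`, and `u x₀ = 0`, so `‖u‖` stays below `r₁`.
  have hsmall : ∀ x, |x - x₀| < δ → ‖u x‖ < r₁ := by
    intro x hx
    by_contra hge
    have hcont : ContinuousOn (fun x => ‖u x‖) (Metric.ball x₀ δ) := by
      intro y hy
      have hy0 : y ≠ 0 := by
        rw [Metric.mem_ball, Real.dist_eq] at hy
        linarith [(hxpos y hy).1]
      have h1 : Tendsto (fun x : ℝ => ((√x : ℝ) : ℂ)) (𝓝 y) (𝓝 ((√y : ℝ) : ℂ)) :=
        (Complex.continuous_ofReal.comp Real.continuous_sqrt).tendsto y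
      exact ((h1.mul (h.tendsto_bval_real hτ hy0)).sub_const _).norm.mono_left nhdsWithin_le_nhds
    have hx' : x ∈ Metric.ball x₀ δ := by rwa [Metric.mem_ball, Real.dist_eq]
    obtain ⟨y, hy, hyr⟩ := (convex_ball x₀ δ).isPreconnected.intermediate_value
      (Metric.mem_ball_self hδ0) hx' hcont
      (show r₁ ∈ Set.Icc _ _ from ⟨by simpa [hu] using hr₁0.le, not_lt.1 hge⟩)
    rw [Metric.mem_ball, Real.dist_eq] at hy
    beta_reduce at hyr
    have h1 := hkey y hy hyr.le
    rw [hyr] at h1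
    have h2 : 4 * B / ε * |√y - √x₀| ≤ 4 * B / ε * δq := by
      gcongr; exact (hqδ y hy).le
    linarith
  intro x hx hlx
  obtain ⟨hxκ, hxX'⟩ := hxpos x hx
  have hx0 : 0 < x := by linarith
  have hux := (hsmall x hx).le
  have hsq := hkey x hx hux
  have hρ := h.rho1c_nonneg_of_ne hτ hx0.ne'
  have him_u : (u x).im = √x * (bval σ z x).im := by
    simp only [hu, Complex.sub_im, Complex.im_ofReal_mul, him]; ring
  have hρu : rho1c σ z x ^ 2 * (Real.pi ^ 2 * x) = (u x).im ^ 2 := by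
    rw [h.rho1c_eq hτ hx0.ne', him_u, mul_pow, mul_pow, Real.sq_sqrt hx0.le]
    field_simp
  have hly : l * (√x - √x₀) < 0 := by
    rw [← hdiff x hx, ← mul_assoc] at hlx
    by_contra hn
    exact absurd (mul_nonneg (not_lt.1 hn) (hsκ.trans_le (hsum x)).le) (not_le.2 hlx)
  have hlow : |√x - √x₀| ≤ 4 * Λ * (u x).im ^ 2 := by
    obtain ⟨F, E, hF, -, hE, hT⟩ := hexp x hx0
      ((hqδ x hx).le.trans (min_le_left _ _)) (hux.trans hr₁r)
    refine fold_im_sq_ge hF hT hE ?_ hl2 hly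
    calc K * ‖u x‖ ^ 3 = K * ‖u x‖ * ‖u x‖ ^ 2 := by ring
      _ ≤ K * r₁ * (4 * B / ε * |√x - √x₀|) := by gcongr
      _ = K * r₁ * (4 * B / ε) * |√x - √x₀| := by ring
      _ ≤ 1 / 4 * |√x - √x₀| := by gcongr
      _ = _ := by ring
  have hsumQ : √x + √x₀ ≤ Q := by
    have h1 : √x ≤ √(X + κ) := Real.sqrt_le_sqrt hxX'.le
    have h2 : √x₀ ≤ √(X + κ) := Real.sqrt_le_sqrt (by linarith)
    linarith
  refine ⟨hx0, simWith_sqrt hk₁0 hk₂0 hρ ?_ ?_⟩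
  · rw [hk₁, inv_mul_le_iff₀ (by positivity), ← hdiff x hx, abs_mul,
      abs_of_pos (hsκ.trans_le (hsum x))]
    calc |√x - √x₀| * (√x + √x₀) ≤ 4 * Λ * (u x).im ^ 2 * Q := by gcongr
      _ = 4 * Λ * (rho1c σ z x ^ 2 * (Real.pi ^ 2 * x)) * Q := by rw [hρu]
      _ ≤ 4 * Λ * (rho1c σ z x ^ 2 * (Real.pi ^ 2 * (X + κ))) * Q := by gcongr
      _ = _ := by ring
  · have h1 : rho1c σ z x ^ 2 * (Real.pi ^ 2 * (κ / 2)) ≤ 4 * B / ε * (|x - x₀| / √κ) := by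
      calc rho1c σ z x ^ 2 * (Real.pi ^ 2 * (κ / 2)) ≤ rho1c σ z x ^ 2 * (Real.pi ^ 2 * x) := by
            gcongr
        _ = (u x).im ^ 2 := hρu
        _ ≤ ‖u x‖ ^ 2 := by
            rw [← sq_abs]
            gcongr
            exact Complex.abs_im_le_norm _
        _ ≤ 4 * B / ε * |√x - √x₀| := hsq
        _ ≤ _ := by gcongr; exact hqle x hx
    rw [hk₂, div_mul_eq_mul_div, le_div_iff₀ (by positivity)]
    refine h1.trans_eq (by ring)

/-- Nonzero regular edges stay away from the origin, and there both densities behave like a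
square root on the side opposite to the gap. -/
lemma exists_simWith_edge (hτ : 0 < τ) {ε : ℝ} (hε : 0 < ε) : ∃ C δ : ℝ, 0 < C ∧ 0 < δ ∧
    ∀ {N : ℕ} {σ : Fin N → ℝ} {z : ℂ}, Admissible τ σ z → ∀ {L : ℕ} {e : ℕ → ℝ},
      IsEdges (rho1c σ z) L e → ∀ j ∈ Set.Icc 1 (2 * L), e j ≠ 0 → IsRegularEdge σ z ε (e j) →
      (Even j → ∀ x ∈ Set.Ioo (e j) (e j + δ), SimWith C (rho1c σ z x) (√(x - e j)) ∧
        SimWith C (rho2c σ z x) (√(x - e j))) ∧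
      (Odd j → ∀ x ∈ Set.Ioo (e j - δ) (e j), SimWith C (rho1c σ z x) (√(e j - x)) ∧
        SimWith C (rho2c σ z x) (√(e j - x))) := by
  obtain ⟨X, ε₀, hX, hε₀, hsub⟩ := exists_bulk_subset hτ
  obtain ⟨δ₀, hδ₀, horig⟩ := exists_Ioo_subset_bulk hτ
  obtain ⟨C, δ, hC, hδ, hsim⟩ :=
    exists_simWith_sqrt hτ (κ := min ε₀ δ₀) (X := X) (by positivity) hX hε
  obtain ⟨C', hC', hboth⟩ := exists_simWith_both hτ hC
  refine ⟨C', δ, hC', hδ, fun {N σ z} h {L e} he j hj hej hreg => ?_⟩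
  set x₀ := e j with hx₀
  have hx₀0 : 0 < x₀ := (he.nonneg_of_mem hj).lt_of_ne' hej
  have hmem : x₀ ∈ closure (bulk σ z) := by
    rw [← h.tsupport_rho1c hτ]; exact he.mem_tsupport hj
  -- Consequences of the existence of gap points arbitrarily close to the edge.
  have hgap : ∀ G : Set ℝ, x₀ ∈ closure G → (∀ x ∈ G, x ≠ x₀ ∧ x ∉ tsupport (rho1c σ z)) →
      ∃ l : ℝ, (∃ x ∈ G, 0 < l * (x - x₀)) ∧ ∀ x : ℝ, |x - x₀| < δ → l * (x - x₀) < 0 →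
        SimWith C' (rho1c σ z x) (√|x - x₀|) ∧ SimWith C' (rho2c σ z x) (√|x - x₀|) := by
    intro G hG hGs
    have hnb : x₀ ∉ bulk σ z := fun hb => by
      obtain ⟨x, hxb, hxG⟩ := mem_closure_iff.1 hG _ (h.isOpen_bulk hτ) hb
      exact (hGs x hxG).2 (by rw [h.tsupport_rho1c hτ]; exact subset_closure hxb)
    have him := h.im_eq_zero_of_notMem_bulk hτ hx₀0 hnb
    have hlow : min ε₀ δ₀ ≤ x₀ := by
      rcases h.le_or_le with hz | hz
      · exact (min_le_left _ _).trans ((hsub h).2 hz hmem)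
      · refine (min_le_right _ _).trans (not_lt.1 fun hlt => hnb (horig h hz ⟨hx₀0, hlt⟩))
    obtain ⟨l, hl, hl'⟩ := hsim h x₀ hlow ((hsub h).1 hmem).2 hmem him hreg
    refine ⟨l, ?_, fun x hxδ hlx => hboth h x _ (hl' x hxδ hlx).1 (Real.sqrt_nonneg _)
      (hl' x hxδ hlx).2⟩
    obtain ⟨x, hxG, hxd⟩ := Metric.mem_closure_iff.1 hG δ hδ
    rw [dist_comm, Real.dist_eq] at hxd
    obtain ⟨hne, hns⟩ := hGs x hxG
    have hne' := sub_ne_zero.2 hne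
    refine ⟨x, hxG, lt_of_not_ge fun hle => ?_⟩
    have h1 := (hl' x hxd (hle.lt_of_ne (mul_ne_zero hl hne'))).2.1
    rw [image_eq_zero_of_notMem_tsupport hns] at h1
    have h2 : 0 < √|x - x₀| := Real.sqrt_pos.2 (abs_pos.2 hne')
    exact absurd h1 (not_le.2 (by positivity))
  constructor
  · intro hev x hx
    obtain ⟨p, hp, hps⟩ := he.exists_gap_of_even hj hev
    obtain ⟨l, ⟨y, hy, hly⟩, hl⟩ := hgap (Set.Ioo p x₀)
      (by rw [closure_Ioo hp.ne]; exact ⟨hp.le, le_rfl⟩) fun y hy => ⟨hy.2.ne, hps y hy⟩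
    have hpos : 0 < x - x₀ := sub_pos.2 hx.1
    have hl0 : l < 0 := by
      by_contra hn
      exact absurd (mul_nonpos_of_nonneg_of_nonpos (not_lt.1 hn) (sub_nonpos.2 hy.2.le))
        (not_le.2 hly)
    have := hl x (by rw [abs_of_pos hpos]; linarith [hx.2]) (mul_neg_of_neg_of_pos hl0 hpos)
    rwa [abs_of_pos hpos] at this
  · intro hodd x hx
    obtain ⟨p, hp, hps⟩ := he.exists_gap_of_odd hj hodd
    obtain ⟨l, ⟨y, hy, hly⟩, hl⟩ := hgap (Set.Ioo x₀ p)
      (by rw [closure_Ioo hp.ne]; exact ⟨le_rfl, hp.le⟩) fun y hy => ⟨hy.1.ne', hps y hy⟩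
    have hneg : x - x₀ < 0 := sub_neg.2 hx.2
    have hl0 : 0 < l := by
      by_contra hn
      exact absurd (mul_nonpos_of_nonpos_of_nonneg (not_lt.1 hn) (sub_nonneg.2 hy.1.le))
        (not_le.2 hly)
    have := hl x (by rw [abs_of_neg hneg]; linarith [hx.1]) (mul_neg_of_pos_of_neg hl0 hneg)
    rwa [abs_of_neg hneg, neg_sub] at this

end SelfConsistent

end

theorem proposition2p6 (τ : ℝ) (hτ : 0 < τ) :
    -- well-posedness, structure of the supports, lowest edge, total mass of the second density
    (∃ C₀ : ℝ, ∃ ε₀ : ℝ, 0 < C₀ ∧ 0 < ε₀ ∧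
      ∀ (N : ℕ) (σ : Fin N → ℝ) (z : ℂ), SelfConsistent.Admissible τ σ z →
        SelfConsistent.IsM1c σ z (SelfConsistent.m1c σ z) ∧
        (∀ x : ℝ, x ≠ 0 →
          SelfConsistent.HasBoundaryLimit (SelfConsistent.m1c σ z) x ∧
          SelfConsistent.HasBoundaryLimit (SelfConsistent.m2c σ z) x) ∧
        (∃ (L : ℕ) (e : ℕ → ℝ),
          SelfConsistent.IsEdges (SelfConsistent.rho1c σ z) L e ∧
          SelfConsistent.IsEdges (SelfConsistent.rho2c σ z) L e ∧
          e 1 ≤ C₀ ∧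
          (1 + τ ≤ ‖z‖ ^ 2 → ε₀ ≤ e (2 * L)) ∧
          (‖z‖ ^ 2 ≤ 1 - τ → e (2 * L) = 0)) ∧
        SelfConsistent.IsProbDensity (SelfConsistent.rho2c σ z)) ∧
    -- regular bulk components
    (∀ c : ℝ → ℝ, (∀ t, 0 < t → 0 < c t) → ∀ τ' : ℝ, 0 < τ' → ∃ C : ℝ, 0 < C ∧
      ∀ (N : ℕ) (σ : Fin N → ℝ) (z : ℂ), SelfConsistent.Admissible τ σ z →
      ∀ (L : ℕ) (e : ℕ → ℝ), SelfConsistent.IsEdges (SelfConsistent.rho1c σ z) L e →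
      ∀ k ∈ Set.Icc 1 L, SelfConsistent.IsRegularBulk σ z c (e (2 * k)) (e (2 * k - 1)) →
      ∀ x ∈ Set.Icc (e (2 * k) + τ') (e (2 * k - 1) - τ'),
        SelfConsistent.SimWith C (SelfConsistent.rho1c σ z x) 1 ∧
        SelfConsistent.SimWith C (SelfConsistent.rho2c σ z x) 1) ∧
    -- nonzero regular edges
    (∀ ε : ℝ, 0 < ε → ∃ C : ℝ, ∃ δ : ℝ, 0 < C ∧ 0 < δ ∧
      ∀ (N : ℕ) (σ : Fin N → ℝ) (z : ℂ), SelfConsistent.Admissible τ σ z →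
      ∀ (L : ℕ) (e : ℕ → ℝ), SelfConsistent.IsEdges (SelfConsistent.rho1c σ z) L e →
      ∀ j ∈ Set.Icc 1 (2 * L), e j ≠ 0 → SelfConsistent.IsRegularEdge σ z ε (e j) →
        (Even j → ∀ x ∈ Set.Ioo (e j) (e j + δ),
          SelfConsistent.SimWith C (SelfConsistent.rho1c σ z x) (Real.sqrt (x - e j)) ∧
          SelfConsistent.SimWith C (SelfConsistent.rho2c σ z x) (Real.sqrt (x - e j))) ∧
        (Odd j → ∀ x ∈ Set.Ioo (e j - δ) (e j),
          SelfConsistent.SimWith C (SelfConsistent.rho1c σ z x) (Real.sqrt (e j - x)) ∧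
          SelfConsistent.SimWith C (SelfConsistent.rho2c σ z x) (Real.sqrt (e j - x)))) ∧
    -- behaviour at the origin
    (∃ C : ℝ, ∃ δ : ℝ, 0 < C ∧ 0 < δ ∧
      ∀ (N : ℕ) (σ : Fin N → ℝ) (z : ℂ), SelfConsistent.Admissible τ σ z →
      ‖z‖ ^ 2 ≤ 1 - τ → ∀ x ∈ Set.Ioo 0 δ,
        SelfConsistent.SimWith C (SelfConsistent.rho1c σ z x) (x ^ (-(1 / 2) : ℝ)) ∧
        SelfConsistent.SimWith C (SelfConsistent.rho2c σ z x) (x ^ (-(1 / 2) : ℝ))) := by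
  refine ⟨?_, fun c hc τ' hτ' => ?_, fun ε hε => ?_, ?_⟩
  · obtain ⟨C₀, ε₀, hC₀, hε₀, hedges⟩ := SelfConsistent.exists_edges hτ
    refine ⟨C₀, ε₀, hC₀, hε₀, fun N σ z h => ⟨h.isM1c hτ, fun x hx =>
      ⟨⟨_, (h.tendsto_m1c hτ hx).comp (SelfConsistent.tendsto_vertical x)⟩,
        ⟨_, (h.tendsto_m2c hτ hx).comp (SelfConsistent.tendsto_vertical x)⟩⟩,
      hedges h, h.isProbDensity_rho2c hτ⟩⟩
  · obtain ⟨C, hC, hbulk⟩ := SelfConsistent.exists_simWith_bulk hτ c hc hτ'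
    obtain ⟨C', hC', hboth⟩ := SelfConsistent.exists_simWith_both hτ hC
    refine ⟨C', hC', fun N σ z h L e he k hk hreg x hx => ?_⟩
    have h0 : 0 ≤ e (2 * k) :=
      he.nonneg_of_mem ⟨by have := hk.1; omega, by have := hk.2; omega⟩
    have hx0 : τ' ≤ x := by linarith [hx.1]
    exact hboth h x 1 (hτ'.trans_le hx0) zero_le_one (hbulk h x hx0 (hreg τ' hτ' x hx))
  · obtain ⟨C, δ, hC, hδ, hedge⟩ := SelfConsistent.exists_simWith_edge hτ hε
    exact ⟨C, δ, hC, hδ, fun N σ z h L e he => hedge h he⟩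
  · obtain ⟨C, δ, hC, hδ, horig⟩ := SelfConsistent.exists_simWith_origin hτ
    obtain ⟨C', hC', hboth⟩ := SelfConsistent.exists_simWith_both hτ hC
    refine ⟨C', δ, hC', hδ, fun N σ z h hz x hx => ?_⟩
    exact hboth h x _ hx.1 (Real.rpow_nonneg hx.1.le _) (horig h hz x hx)
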